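/- Let $n\ge 2$ and $k\ge 1$ be integers. Partitions are identified with their Young diagrams; $l(\kappa)$ is the number of rows and $\kappa'$ the conjugate of $\kappa$. A partition $\kappa$ is called $(n,k)$-restricted if $l(\kappa)\le n$ and $\kappa_1-\kappa_n\le k$; let $\Pi^{(n,k)}$ be the set of these partitions. **Fusion coefficients.** Let $\mathcal F^{(n,k)}$ be the quotient of the algebra $\mathbb Q[x_1,\dots,x_n]^{S_n}$ by the ideal generated by the Schur polynomials $s_\kappa$ with $l(\kappa)\le n$, $\kappa_1-\kappa_n=k+1$, and by $s_{(1^n)}-1$. The classes of the $s_\kappa$ with $l(\kappa)\le n-1$ and $\kappa_1\le k$ form a linear basis of $\mathcal F^{(n,k)}$. For $\nu\in\Pi^{(n,k)}$ put $\bar\nu=(\nu_1-\nu_n,\dots,\nu_{n-1}-\nu_n)$, so that $s_\nu=s_{\bar\nu}$ in $\mathcal F^{(n,k)}$. For $\lambda,\nu\in\Pi^{(n,k)}$ and a partition $\mu$ with $l(\mu)\le n$, the fusion coefficient $N_{\lambda\mu}^{(k)\nu}$ is the coefficient of $s_{\bar\nu}$ in the expansion of $s_\lambda s_\mu$ in this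 basis if $|\nu|=|\lambda|+|\mu|$, and $0$ otherwise; that is, $s_\lambda s_\mu=\sum_{\nu\in\Pi^{(n,k)},\,|\nu|=|\lambda|+|\mu|}N_{\lambda\mu}^{(k)\nu}s_\nu$ in $\mathcal F^{(n,k)}$. **Paths.** A path in Young's lattice from $\lambda$ to $\nu$ is a chain of partitions from $\lambda$ to $\nu$ in which each partition arises from the previous one by adding one box; the label of a box in row $i$ and column $j$ is $j-i$. For $p,q\ge 0$ let $\mathcal P^{(n,k)}_{(p,q)}$ be the set of paths $P=P_1*P_2$ such that $|P_1|=p$, $|P_2|=q$, the sequence of labels is strictly decreasing along $P_1$ and along $P_2$, and the initial partition, the partition reached after $P_1$, and the final partition are all $(n,k)$-restricted. Let $\mu$ be a partition with at most two columns and $(p,q)=(\mu'_1,\mu'_2)$. The tableau $T_P$ of $P\in\mathcal P^{(n,k)}_{(\mu')}$ has the labels of $P_1$ in its first and those of $P_2$ in its second column, each column sorted increasingly starting from the first (longest) row of $\mu$. The path $P$ fits $\mu$ if $T_P\in CS(\mu)$, i.e. $T_P$ is strictly increasing along columns and weakly increasing along rows. **The set $\mathcal D_2$.** The word $w$ of $P$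 is the sequence of all its labels in weakly increasing order, where of two equal labels the one from $P_1$ comes first. Replace the labels of $P_1$ by left and those of $P_2$ by right parentheses, and pair parentheses in the usual way. Let $\nu$ be the final partition of $P$. The path $P\in\mathcal P^{(n,k)}_{(\mu')}$ belongs to $\mathcal D_2$ if 1. $\nu_1-\nu_n=k$ and $T_P\in CS(\mu)$; 2. exactly one of $P_1$, $P_2$ adds a box in the first row, and $P_1$ but not $P_2$ adds a box in the $n$-th row; 3. $P_2$ adds a box in the last column (column $\nu_1$) of $\nu$, and the largest label $a$ of $P_2$ in that column is not paired with the letter $a_1-1$ (if $a_1-1$ occurs in $w$), where $a_1$ is the smallest label of a box of $P$ in the last column of $\nu$; 4. the letter of the box that $P$ adds in the $n$-th row is unpaired or is paired with $a$. The tableaux $T_P\in CS(\mu)$ with $P\notin\mathcal D_2$ are called $k$-fusion, and their set is $CSF_k(\mu)=CS(\mu)\setminus\mathcal D_2$. **Theorem 12.** For $\lambda,\nu\in\Pi^{(n,k)}$ and every partition $\mu$ with at most two columns and $l(\mu)\le n$, $$N_{\lambda\mu}^{(k)\nu}=\#\{\text{paths } P \text{ from } \lambda \text{ to } \nu \text{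 in } \mathcal P^{(n,k)}_{(\mu')} \text{ that fit } \mu \text{ and satisfy } T_P\in CSF_k(\mu)\}.$$ -/

import Mathlib

open MvPolynomial

namespace Fusion

/-! ### Schur polynomials in `n` variables -/

/-- The alternant `a_α = det (x_i ^ α_j)`. -/
noncomputable def alternant (n : ℕ) (a : Fin n → ℕ) : MvPolynomial (Fin n) ℚ :=
  Matrix.det (Matrix.of fun i j => (X i : MvPolynomial (Fin n) ℚ) ^ a j)

/-- The exponents `δ = (n-1, n-2, …, 1, 0)`. -/
def delta (n : ℕ) (j : Fin n) : ℕ := (j.rev : ℕ)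

theorem alternant_delta (n : ℕ) :
    ∃ u : ℤˣ, alternant n (delta n) = ((u : ℤ) : MvPolynomial (Fin n) ℚ) *
      ∏ i : Fin n, ∏ j ∈ Finset.Ioi i,
        ((X j : MvPolynomial (Fin n) ℚ) - X i) := by
  refine ⟨Equiv.Perm.sign (Fin.revPerm : Equiv.Perm (Fin n)), ?_⟩
  rw [← Matrix.det_vandermonde, ← Matrix.det_permute']
  rfl

theorem sub_dvd_alternant (n : ℕ) (a : Fin n → ℕ) {i j : Fin n} (h : i ≠ j) :
    ((X j : MvPolynomial (Fin n) ℚ) - X i) ∣ alternant n a := by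
  unfold alternant
  rw [← Matrix.det_updateRow_add_smul_self _ h.symm (-1 : MvPolynomial (Fin n) ℚ)]
  choose q hq using fun l : Fin n =>
    sub_dvd_pow_sub_pow (X j : MvPolynomial (Fin n) ℚ) (X i) (a l)
  have : ((Matrix.of fun i j => (X i : MvPolynomial (Fin n) ℚ) ^ a j) j +
      (-1 : MvPolynomial (Fin n) ℚ) •
        (Matrix.of fun i j => (X i : MvPolynomial (Fin n) ℚ) ^ a j) i) =
      ((X j : MvPolynomial (Fin n) ℚ) - X i) • q := by
    funext l
    simp only [Pi.add_apply, Pi.smul_apply, Matrix.of_apply, smul_eq_mul, ← hq]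
    ring
  rw [this, Matrix.det_updateRow_smul]
  exact dvd_mul_right _ _

theorem irreducible_X_sub_X (n : ℕ) {i j : Fin n} (h : i ≠ j) :
    Irreducible ((X j : MvPolynomial (Fin n) ℚ) - X i) := by
  have := irreducible_mul_X_add (1 : MvPolynomial (Fin n) ℚ) (-X i) j one_ne_zero
    (by simp) (by rw [vars_neg, vars_X]; simpa using h.symm) isRelPrime_one_left
  simpa [sub_eq_add_neg] using this

theorem alternant_delta_dvd (n : ℕ) (a : Fin n → ℕ) :
    alternant n (delta n) ∣ alternant n a := by
  classical
  obtain ⟨u, hu⟩ := alternant_delta n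
  have hu' : IsUnit (((u : ℤ) : MvPolynomial (Fin n) ℚ)) := u.isUnit.map (Int.castRingHom _)
  rw [hu, hu'.mul_left_dvd, Finset.prod_sigma']
  refine Finset.prod_dvd_of_isRelPrime ?_ ?_
  · rintro ⟨i, j⟩ hij ⟨l, m⟩ hlm hne
    simp only [Finset.coe_sigma, Set.mem_sigma_iff, Finset.mem_coe, Finset.mem_univ,
      Finset.mem_Ioi, true_and] at hij hlm
    refine (irreducible_X_sub_X n hij.ne).isRelPrime_iff_not_dvd.2 ?_
    intro hd
    have key : ∀ v : Fin n → ℚ, v i = v j → v l = v m := by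
      intro v hv
      have := map_dvd (eval v) hd
      simp only [map_sub, eval_X, hv, sub_self, zero_dvd_iff] at this
      linarith
    have h1 := key (fun x => if x = l then 1 else 0)
    have h2 := key (fun x => if x = m then 1 else 0)
    simp only [Sigma.mk.injEq, heq_eq_eq, ne_eq, not_and] at hne
    grind
  · rintro ⟨i, j⟩ hij
    simp only [Finset.mem_sigma, Finset.mem_univ, Finset.mem_Ioi, true_and] at hij
    exact sub_dvd_alternant n a hij.ne

theorem alternant_delta_ne_zero (n : ℕ) : alternant n (delta n) ≠ 0 := by
  obtain ⟨u, hu⟩ := alternant_delta n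
  have hu' : IsUnit (((u : ℤ) : MvPolynomial (Fin n) ℚ)) := u.isUnit.map (Int.castRingHom _)
  rw [hu, ← Matrix.det_vandermonde]
  exact mul_ne_zero hu'.ne_zero (Matrix.det_vandermonde_ne_zero_iff.2 (X_injective))

theorem rename_alternant (n : ℕ) (a : Fin n → ℕ) (e : Equiv.Perm (Fin n)) :
    rename e (alternant n a) =
      ((Equiv.Perm.sign e : ℤ) : MvPolynomial (Fin n) ℚ) * alternant n a := by
  unfold alternant
  rw [← Matrix.det_permute, AlgHom.map_det]
  congr 1
  ext1 i j
  simp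

/-- The quotient of alternants `a_{κ+δ} / a_δ` is a symmetric polynomial. -/
theorem exists_schur (n : ℕ) (a : Fin n → ℕ) :
    ∃ p : symmetricSubalgebra (Fin n) ℚ,
      (p : MvPolynomial (Fin n) ℚ) * alternant n (delta n) = alternant n a := by
  obtain ⟨p, hp⟩ := alternant_delta_dvd n a
  refine ⟨⟨p, ?_⟩, by rw [hp, mul_comm]⟩
  rw [mem_symmetricSubalgebra]
  intro e
  have h := congrArg (rename e) hp
  rw [map_mul, rename_alternant, rename_alternant, hp, mul_assoc] at h
  have hu' : (((Equiv.Perm.sign e : ℤ)) : MvPolynomial (Fin n) ℚ) ≠ 0 :=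
    ((Equiv.Perm.sign e).isUnit.map (Int.castRingHom (MvPolynomial (Fin n) ℚ))).ne_zero
  exact (mul_left_cancel₀ (alternant_delta_ne_zero n) (mul_left_cancel₀ hu' h)).symm

/-- The Schur polynomial `s_κ(x_1, …, x_n) = a_{κ+δ} / a_δ` of a partition `κ` with at most `n`
rows, as an element of the algebra of symmetric polynomials. -/
noncomputable def schur (n : ℕ) (κ : YoungDiagram) : symmetricSubalgebra (Fin n) ℚ :=
  (exists_schur n fun j => κ.rowLen j + delta n j).choose

theorem schur_spec (n : ℕ) (κ : YoungDiagram) :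
    (schur n κ : MvPolynomial (Fin n) ℚ) * alternant n (delta n) =
      alternant n fun j => κ.rowLen j + delta n j :=
  (exists_schur n fun j => κ.rowLen j + delta n j).choose_spec

/-! ### The fusion algebra -/

/-- `(n,k)`-restricted partitions: at most `n` rows and `κ_1 - κ_n ≤ k`. -/
def restricted (n k : ℕ) : Set YoungDiagram :=
  {κ | κ.colLen 0 ≤ n ∧ κ.rowLen 0 ≤ κ.rowLen (n - 1) + k}

/-- Edge diagrams: at most `n` rows and `κ_1 - κ_n = k`. -/
def edge (n k : ℕ) : Set YoungDiagram :=
  {κ | κ.colLen 0 ≤ n ∧ κ.rowLen 0 = κ.rowLen (n - 1) + k}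

/-- Border diagrams: at most `n` rows and `κ_1 - κ_n = k + 1`. -/
def border (n k : ℕ) : Set YoungDiagram :=
  {κ | κ.colLen 0 ≤ n ∧ κ.rowLen 0 = κ.rowLen (n - 1) + (k + 1)}

/-- The one-column partition `(1^n)`. -/
def column (n : ℕ) : YoungDiagram where
  cells := Finset.range n ×ˢ {0}
  isLowerSet := by
    rintro ⟨i, j⟩ ⟨i', j'⟩ ⟨hi, hj⟩ h
    simp only [Finset.coe_product, Finset.coe_range, Finset.coe_singleton, Set.mem_prod,
      Set.mem_Iio, Set.mem_singleton_iff] at h ⊢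
    simp only at hi hj
    omega

/-- The ideal of the algebra of symmetric polynomials generated by the `s_κ` with
`κ_1 - κ_n = k + 1` and by `s_{(1^n)} - 1`. -/
noncomputable def fusionIdeal (n k : ℕ) : Ideal (symmetricSubalgebra (Fin n) ℚ) :=
  Ideal.span (schur n '' border n k ∪ {schur n (column n) - 1})

/-- The fusion algebra of `sl(n)` at level `k`. -/
abbrev FusionAlgebra (n k : ℕ) : Type :=
  symmetricSubalgebra (Fin n) ℚ ⧸ fusionIdeal n k

/-- The class of the Schur polynomial `s_κ` in the fusion algebra. -/
noncomputable def schurClass (n k : ℕ) (κ : YoungDiagram) : FusionAlgebra n k :=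
  Ideal.Quotient.mk (fusionIdeal n k) (schur n κ)

/-- The partitions with at most `n - 1` rows and at most `k` columns. -/
def reduced (n k : ℕ) : Set YoungDiagram :=
  {κ | κ.colLen 0 ≤ n - 1 ∧ κ.rowLen 0 ≤ k}

/-- Removal of the first `c` columns of a diagram. -/
def dropColumns (c : ℕ) (κ : YoungDiagram) : YoungDiagram where
  cells := κ.cells.filter fun x => (x.1, x.2 + c) ∈ κ
  isLowerSet := by
    rintro ⟨i, j⟩ ⟨i', j'⟩ ⟨hi, hj⟩ h
    simp only at hi hj
    simp only [Finset.coe_filter, YoungDiagram.mem_cells, Set.mem_ofPred_eq] at h ⊢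
    exact ⟨κ.up_left_mem hi hj h.1, κ.up_left_mem hi (by omega) h.2⟩

theorem mem_dropColumns (c : ℕ) (κ : YoungDiagram) (i j : ℕ) :
    (i, j) ∈ dropColumns c κ ↔ (i, j + c) ∈ κ := by
  rw [← YoungDiagram.mem_cells]
  simp only [dropColumns, Finset.mem_filter, YoungDiagram.mem_cells, and_iff_right_iff_imp]
  exact fun h => κ.up_left_mem le_rfl (Nat.le_add_right _ _) h

/-- The map `κ ↦ (κ_1 - κ_n, …, κ_{n-1} - κ_n)` from restricted to reduced partitions. -/
def reduce {n k : ℕ} (κ : restricted n k) : reduced n k :=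
  ⟨dropColumns (κ.1.rowLen (n - 1)) κ.1, by
    obtain ⟨κ, h1, h2⟩ := κ
    constructor
    · rw [← not_lt, ← YoungDiagram.mem_iff_lt_colLen, mem_dropColumns,
        YoungDiagram.mem_iff_lt_rowLen]
      simp
    · rw [← not_lt, ← YoungDiagram.mem_iff_lt_rowLen, mem_dropColumns,
        YoungDiagram.mem_iff_lt_rowLen]
      simp only
      omega⟩

/-- The coefficient `N_{λμ}^{(k)ν}` of `s_ν` in the product `s_λ s_μ` in the fusion algebra, where
`b` is the basis of the fusion algebra formed by the classes of the `s_κ`, `κ` reduced.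
The classes of `s_ν` and of its reduction agree, and a restricted `ν` of given size is determined by
its reduction: the product is expanded in the `s_ν` with `|ν| = |λ| + |μ|`, and all other
restricted `ν` have coefficient `0`. -/
noncomputable def fusionCoeff {n k : ℕ} (b : Module.Basis (reduced n k) ℚ (FusionAlgebra n k))
    (lam mu : YoungDiagram) (nu : restricted n k) : ℚ :=
  if nu.1.card = lam.card + mu.card then
    b.repr (schurClass n k lam * schurClass n k mu) (reduce nu)
  else 0

/-! ### Paths in Young's lattice -/

/-- `κ'` is obtained from `κ` by adding one box. -/
def addBox : SetRel YoungDiagram YoungDiagram :=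
  {x | ∃ c ∉ x.1.cells, x.2.cells = insert c x.1.cells}

/-- A path in Young's lattice: a chain of partitions, each with one more box than the previous
one. -/
abbrev LatticePath : Type := RelSeries addBox

/-- The box `(row, column)`, counted from `0`, that is added in the step `t`. -/
noncomputable def box (P : LatticePath) (t : Fin P.length) : ℕ × ℕ :=
  Exists.choose (P.step t)

/-- The label of a box is the index of its diagonal, `column - row`. -/
noncomputable def label (P : LatticePath) (t : Fin P.length) : ℤ :=
  ((box P t).2 : ℤ) - ((box P t).1 : ℤ)

/-- The set `𝒫^{(n,k)}_{(p,q)}`: the paths `P = P₁ * P₂` with `|P₁| = p`, `|P₂| = q`, the labels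
decreasing along `P₁` and along `P₂`, and the partitions at the two ends and at the joint being
restricted. -/
def restrictedPaths (n k p q : ℕ) : Set LatticePath :=
  {P | P.length = p + q ∧
    (∀ s t : Fin P.length, s < t → ((t : ℕ) < p ∨ p ≤ (s : ℕ)) → label P t < label P s) ∧
    ∀ i : Fin (P.length + 1), ((i : ℕ) = 0 ∨ (i : ℕ) = p ∨ (i : ℕ) = p + q) →
      P.toFun i ∈ restricted n k}

/-- The entries of the tableau `T_P` of `P = P₁ * P₂`, where `|P₁| = p` and `|P₂| = q`. Its two
columns hold the labels of `P₁` and of `P₂` from top to bottom; rows are counted from `0` starting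
with the lowest one, which is the longest. -/
noncomputable def tableau (P : LatticePath) (p q : ℕ) (r c : ℕ) : ℤ :=
  let t := if c = 0 then p - 1 - r else p + q - 1 - r
  if h : t < P.length then label P ⟨t, h⟩ else 0

/-- A filling of the shape `mu` that is weakly increasing along rows (from left to right) and
strictly increasing along columns (away from the longest row). -/
def IsColumnStrict (mu : YoungDiagram) (T : ℕ → ℕ → ℤ) : Prop :=
  (∀ r c, (r, c + 1) ∈ mu → T r c ≤ T r (c + 1)) ∧
    ∀ r c, (r + 1, c) ∈ mu → T r c < T (r + 1) c

/-- A path with `|P₁| = μ'_1` and `|P₂| = μ'_2` fits the partition `μ`: its tableau is column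
strict. -/
def Fits (mu : YoungDiagram) (P : LatticePath) : Prop :=
  IsColumnStrict mu (tableau P (mu.colLen 0) (mu.colLen 1))

/-! ### The word of a path and its parentheses

The letters of the word of `P = P₁ * P₂` are the steps of `P`, sorted by increasing label; of two
equal labels the one in `P₁` comes first. Steps of `P₁`, those before step `p`, are left
parentheses, and steps of `P₂` are right ones. -/

/-- The letter `s` stands before the letter `t` in the word. -/
def Before (P : LatticePath) (s t : Fin P.length) : Prop :=
  label P s < label P t ∨ (label P s = label P t ∧ s < t)

open Classical in
/-- The number of left parentheses strictly between the letters `s` and `t` of the word. -/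
noncomputable def leftBetween (P : LatticePath) (p : ℕ) (s t : Fin P.length) : ℕ :=
  (Finset.univ.filter fun u : Fin P.length => (u : ℕ) < p ∧ Before P s u ∧ Before P u t).card

open Classical in
/-- The number of right parentheses strictly between the letters `s` and `t` of the word. -/
noncomputable def rightBetween (P : LatticePath) (p : ℕ) (s t : Fin P.length) : ℕ :=
  (Finset.univ.filter fun u : Fin P.length => p ≤ (u : ℕ) ∧ Before P s u ∧ Before P u t).card

/-- The left parenthesis `s` is matched with the right parenthesis `t`: the word strictly between
them is balanced. -/
def Paired (P : LatticePath) (p : ℕ) (s t : Fin P.length) : Prop :=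
  (s : ℕ) < p ∧ p ≤ (t : ℕ) ∧ Before P s t ∧
    leftBetween P p s t = rightBetween P p s t ∧
    ∀ u, Before P s u → Before P u t → rightBetween P p s u ≤ leftBetween P p s u

/-- Some box of `P₁` lies in the row `i` (counted from `0`). -/
def FirstMeetsRow (P : LatticePath) (p i : ℕ) : Prop :=
  ∃ t : Fin P.length, (t : ℕ) < p ∧ (box P t).1 = i

/-- Some box of `P₂` lies in the row `i` (counted from `0`). -/
def SecondMeetsRow (P : LatticePath) (p i : ℕ) : Prop :=
  ∃ t : Fin P.length, p ≤ (t : ℕ) ∧ (box P t).1 = i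

/-- The box added in step `t` lies in the last column of the end point `ν` of the path. -/
def InLastColumn (P : LatticePath) (t : Fin P.length) : Prop :=
  (box P t).2 + 1 = P.last.rowLen 0

/-- The letter `a` is the rightmost right parenthesis in the subword of the last column of `ν`. -/
def IsLastRight (P : LatticePath) (p : ℕ) (a : Fin P.length) : Prop :=
  InLastColumn P a ∧ p ≤ (a : ℕ) ∧
    ∀ t : Fin P.length, InLastColumn P t → p ≤ (t : ℕ) → t ≠ a → Before P t a

/-- The letter `a` has the smallest label in the last column of `ν`. -/
def IsLowestInLastColumn (P : LatticePath) (a : Fin P.length) : Prop :=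
  InLastColumn P a ∧ ∀ t : Fin P.length, InLastColumn P t → label P a ≤ label P t

/-- The exceptional set `𝒟₂` of paths `P = P₁ * P₂` with end point `ν` and `|P₁| = μ'_1`:
`ν` is an edge diagram; `T_P` is column strict; a box is added in the first row by exactly one of
`P₁` and `P₂`, and a box is added in the `n`-th row by `P₁` but not by `P₂`; the last column of `ν`
has a label from `P₂`, and the largest of these, `a`, is not paired with the letter whose label is
`a₁ - 1`, where `a₁` is the smallest label of the last column; the letter of the box in the `n`-th
row is unpaired or paired with `a`. -/
def exceptional (n k : ℕ) (mu : YoungDiagram) : Set LatticePath :=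
  {P | P.last ∈ edge n k ∧
    Fits mu P ∧
    Xor (FirstMeetsRow P (mu.colLen 0) 0) (SecondMeetsRow P (mu.colLen 0) 0) ∧
    FirstMeetsRow P (mu.colLen 0) (n - 1) ∧ ¬ SecondMeetsRow P (mu.colLen 0) (n - 1) ∧
    ∃ a a₁ : Fin P.length,
      IsLastRight P (mu.colLen 0) a ∧ IsLowestInLastColumn P a₁ ∧
      (∀ s : Fin P.length, label P s = label P a₁ - 1 → ¬ Paired P (mu.colLen 0) s a) ∧
      ∀ s : Fin P.length, (box P s).1 = n - 1 →
        (∀ t : Fin P.length, ¬ Paired P (mu.colLen 0) s t) ∨ Paired P (mu.colLen 0) s a}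

/-- The paths that fit `μ` and whose tableau is `k`-fusion: `CS(μ) \ 𝒟₂`. -/
def kFusion (n k : ℕ) (mu : YoungDiagram) : Set LatticePath :=
  {P | Fits mu P} \ exceptional n k mu

end Fusion

/-! Let p ≥ q be the column lengths of μ. Dual Jacobi–Trudi gives s_μ = e_p e_q - e_{p+1} e_{q-1}
(`schurRows_twoColumns`). In the fusion algebra, e_r times the class of a restricted f is the sum
over those vertical r-strips that lead to restricted partitions (`elemClass_mul_rowClass`): every
other term of the Pieri rule is an alternant with two equal exponents or a border diagram. So N
counts the restricted chains from λ to ν with strips of sizes p, q, minus those with sizes p+1, q-1.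

A chain is given by the set of rows of its first strip. A row with two boxes of ν/λ lies in both
strips; a row with one box becomes a left parenthesis if the first strip takes it and a right one
otherwise, and the word is read from the bottom row upwards. The intermediate shape is a partition
iff a left parenthesis in row i+1 forces one in row i whenever the two rows are linked. It is
restricted iff moreover, in the case `IsCyclic`, a left parenthesis in row 0 forces one in row n-1.
Thus N is the number of admissible words with a left parentheses minus the number with a+1
(`card_midStrips_filter`).

Without the cyclic condition, flipping the last unpaired right parenthesis maps the non-ballot words
with a left parentheses bijectively to the words with a+1 of them, so the difference counts ballot
words; these are the column strict tableaux (`fits_iff_isBallot`). With the cyclic condition, the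
violating words have a left parenthesis at row 0 and a right one at row n-1. Deleting these two
letters leaves arbitrary words on a shorter set, to which the same reflection applies; so the
difference drops by the number of ballot words on the shorter set. These correspond to the
exceptional ballot words (`card_words_exceptional`, `card_cyclic_words`), and
`isExceptionalPair_iff` recognises in them the pairing conditions that define 𝒟₂.

The basis: the reduced classes span because their span contains 1 and is stable under the e_r, which
generate the algebra. They are independent because of linear functionals that alternate under S_n
and are invariant under the translations of the affine Weyl group. These vanish on the ideal and
separate the points κ+δ of the alcove (`orbitFunctional_eq_zero`, `orbitSum_alcove`). -/

namespace Fusion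

/-! ### Signed words

A word is a subset `A` of a finite set `S` of natural numbers, read from the largest position to
the smallest one: the elements of `A` are left parentheses, those of `S \ A` right ones. -/

/-- The number of left minus the number of right parentheses at the positions `≥ i`. -/
def height (S A : Finset ℕ) (i : ℕ) : ℤ :=
  ∑ j ∈ S with i ≤ j, if j ∈ A then 1 else -1

theorem height_eq_succ_add (S A : Finset ℕ) (i : ℕ) :
    height S A i = height S A (i + 1) + if i ∈ S then (if i ∈ A then 1 else -1) else 0 := by
  unfold height
  split_ifs with hS hA
  · have : S.filter (i ≤ ·) = insert i (S.filter (i + 1 ≤ ·)) := by ext j; grind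
    rw [this, Finset.sum_insert (by simp), if_pos hA, add_comm]
  · have : S.filter (i ≤ ·) = insert i (S.filter (i + 1 ≤ ·)) := by ext j; grind
    rw [this, Finset.sum_insert (by simp), if_neg hA, add_comm]
  · have : S.filter (i ≤ ·) = S.filter (i + 1 ≤ ·) := by ext j; grind
    rw [this, add_zero]

theorem height_of_le {S : Finset ℕ} {n : ℕ} (hS : S ⊆ Finset.range n) (A : Finset ℕ) {i : ℕ}
    (hi : n ≤ i) : height S A i = 0 := by
  unfold height
  rw [Finset.filter_eq_empty_iff.2, Finset.sum_empty]
  intro j hj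
  have := Finset.mem_range.1 (hS hj)
  omega

theorem height_zero {S A : Finset ℕ} (hA : A ⊆ S) : height S A 0 = 2 * A.card - S.card := by
  unfold height
  simp only [Nat.zero_le, Finset.filter_true]
  rw [Finset.sum_ite, Finset.filter_mem_eq_inter, Finset.inter_eq_right.2 hA,
    ← Finset.sdiff_eq_filter]
  have := Finset.card_sdiff_add_card_eq_card hA
  simp only [Finset.sum_const, mul_one, nsmul_eq_mul]
  push_cast [← this]
  ring

theorem height_insert {S A : Finset ℕ} {i : ℕ} (hi : i ∈ S) (hiA : i ∉ A) (j : ℕ) :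
    height S (insert i A) j = height S A j + if j ≤ i then 2 else 0 := by
  have h : ∀ x ∈ S.filter (j ≤ ·), (if x ∈ insert i A then (1 : ℤ) else -1) =
      (if x ∈ A then 1 else -1) + if x = i then 2 else 0 := by
    intro x _
    by_cases hx : x = i
    · subst hx; simp [hiA]
    · simp [hx]
  unfold height
  rw [Finset.sum_congr rfl h, Finset.sum_add_distrib, Finset.sum_ite_eq']
  simp [hi]

/-- The words with `a` left parentheses such that `i` is a left parenthesis whenever `i + 1` is one
and `i` is linked to `i + 1`. -/
noncomputable def words (S : Finset ℕ) (C : ℕ → Prop) (a : ℕ) : Finset (Finset ℕ) :=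
  open Classical in
  S.powerset.filter fun A => A.card = a ∧ ∀ i, C i → i + 1 ∈ A → i ∈ A

theorem mem_words {S : Finset ℕ} {C : ℕ → Prop} {a : ℕ} {A : Finset ℕ} :
    A ∈ words S C a ↔ A ⊆ S ∧ A.card = a ∧ ∀ i, C i → i + 1 ∈ A → i ∈ A := by
  simp [words]

/-- Every right parenthesis of the word is paired. -/
def IsBallot (S A : Finset ℕ) : Prop := ∀ i, 0 ≤ height S A i

/-- The position of the last unpaired right parenthesis. -/
theorem exists_last_min {S A : Finset ℕ} (h : ¬ IsBallot S A) :
    ∃ i, height S A i < 0 ∧ (∀ j, height S A i ≤ height S A j) ∧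
      ∀ j, i < j → height S A i < height S A j := by
  obtain ⟨n, hn⟩ : ∃ n, S ⊆ Finset.range n := S.exists_nat_subset_range
  obtain ⟨i₀, hi₀⟩ : ∃ i, height S A i < 0 := by simpa [IsBallot] using h
  obtain ⟨m, -, hm⟩ := (Finset.range (n + i₀ + 1)).exists_min_image (height S A) ⟨0, by simp⟩
  have hm' : ∀ j, height S A m ≤ height S A j := by
    intro j
    by_cases hj : j < n + i₀ + 1
    · exact hm j (by simpa using hj)
    · rw [height_of_le hn A (i := j) (by omega)]
      exact (hm i₀ (by simp)).trans hi₀.le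
  have hneg : height S A m < 0 := (hm' i₀).trans_lt hi₀
  have hlt : ∀ j, height S A j < 0 → j ≤ n := by
    intro j hj
    by_contra hc
    rw [height_of_le hn A (by omega)] at hj
    exact lt_irrefl _ hj
  classical
  -- The largest position of minimal height. Heights vanish from `n` on and the minimum is negative,
  -- so the search can be bounded by `n`.
  set i := Nat.findGreatest (fun j => height S A j = height S A m) n with hi
  have hieq : height S A i = height S A m :=
    Nat.findGreatest_spec (P := fun j => height S A j = height S A m) (hlt m hneg) rfl
  refine ⟨i, hieq ▸ hneg, fun j => hieq ▸ hm' j, fun j hj => ?_⟩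
  rw [hieq]
  refine lt_of_le_of_ne (hm' j) fun he => ?_
  have := Nat.le_findGreatest (P := fun j => height S A j = height S A m)
    (hlt j (he ▸ hneg)) he.symm
  omega

/-- The position of the first unpaired left parenthesis. -/
theorem exists_first_min {S B : Finset ℕ} (h : 0 < height S B 0) :
    ∃ i, (∀ j, height S B (i + 1) ≤ height S B j) ∧
      ∀ j, j ≤ i → height S B (i + 1) < height S B j := by
  obtain ⟨n, hn⟩ : ∃ n, S ⊆ Finset.range n := S.exists_nat_subset_range
  obtain ⟨m, -, hm⟩ := (Finset.range (n + 1)).exists_min_image (height S B) ⟨0, by simp⟩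
  have hm' : ∀ j, height S B m ≤ height S B j := by
    intro j
    by_cases hj : j < n + 1
    · exact hm j (by simpa using hj)
    · rw [height_of_le hn B (i := j) (by omega), ← height_of_le hn B (i := n) le_rfl]
      exact hm n (by simp)
  -- The least position of minimal height is not 0, because the height there is positive while far
  -- positions have height 0. Hence it is a successor `i + 1`, and `i` carries the left parenthesis
  -- in question.
  have hex : ∃ i, ∀ j, height S B i ≤ height S B j := ⟨m, hm'⟩
  classical
  have h0 : Nat.find hex ≠ 0 := by
    intro h0
    have := Nat.find_spec hex n
    rw [h0, height_of_le hn B le_rfl] at this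
    omega
  obtain ⟨i, hi⟩ := Nat.exists_eq_succ_of_ne_zero h0
  refine ⟨i, ?_, fun j hj => ?_⟩
  · have := Nat.find_spec hex
    rwa [hi] at this
  · have hs := Nat.find_spec hex
    rw [hi] at hs
    refine lt_of_le_of_ne (hs j) fun he => ?_
    have := Nat.find_min' hex (m := j) (fun x => he ▸ hs x)
    omega

open Classical in
/-- Reflection of the last unpaired right parenthesis: the words with `a` left parentheses that are
not ballot sequences are as many as the words with `a + 1` left parentheses. -/
theorem card_words_not_isBallot {S : Finset ℕ} {C : ℕ → Prop} {a : ℕ}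
    (hC : ∀ i, C i → i ∈ S ∧ i + 1 ∈ S) (ha : S.card ≤ 2 * a) :
    ((words S C a).filter fun A => ¬ IsBallot S A).card = (words S C (a + 1)).card := by
  -- The position `i` is the largest one of minimal height. After the flip, `i + 1` is the smallest
  -- position of minimal height, so the flipped position can be read off the new word.
  have key : ∀ A : Finset ℕ, ¬ IsBallot S A → ∃ i, i ∈ S ∧ i ∉ A ∧
      (∀ j, height S (insert i A) (i + 1) ≤ height S (insert i A) j) ∧
      (∀ j, j ≤ i → height S (insert i A) (i + 1) < height S (insert i A) j) ∧
      (∀ j, i < j → height S A i < height S A j) ∧ ∀ j, height S A i ≤ height S A j := by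
    intro A hA
    obtain ⟨i, h1, h2, h3⟩ := exists_last_min hA
    have hs := height_eq_succ_add S A i
    have h4 := h3 (i + 1) (by omega)
    have hiS : i ∈ S := by by_contra hc; simp [hc] at hs; omega
    have hiA : i ∉ A := by intro hc; simp [hc, hiS] at hs; omega
    simp only [hiS, hiA, if_true, if_false] at hs
    refine ⟨i, hiS, hiA, fun j => ?_, fun j hj => ?_, h3, h2⟩
    · rw [height_insert hiS hiA, height_insert hiS hiA]
      have := h2 j
      by_cases hj : j ≤ i
      · simp [hj]; omega
      · have := h3 j (by omega)
        simp [hj]; omega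
    · rw [height_insert hiS hiA, height_insert hiS hiA]
      have := h2 j
      simp [hj]; omega
  choose! f hfS hfA hf1 hf2 hf3 hf4 using key
  refine Finset.card_bij (fun A _ => insert (f A) A) ?_ ?_ ?_
  · intro A hA
    rw [Finset.mem_filter, mem_words] at hA
    obtain ⟨⟨hAS, hcard, hlink⟩, hb⟩ := hA
    rw [mem_words]
    refine ⟨Finset.insert_subset (hfS A hb) hAS, by rw [Finset.card_insert_of_notMem (hfA A hb),
      hcard], fun i hi h => ?_⟩
    rw [Finset.mem_insert] at h ⊢
    rcases h with h | h
    -- A right parenthesis at `i`, directly after the flipped one in reading order, would push the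
    -- height below its minimum.
    · by_contra hc
      push Not at hc
      have h1 := height_eq_succ_add S A i
      have h2 := hf4 A hb i
      rw [h] at h1
      rw [if_pos (hC i hi).1, if_neg hc.2] at h1
      omega
    · exact Or.inr (hlink i hi h)
  · intro A hA B hB hAB
    rw [Finset.mem_filter] at hA hB
    have h : f A = f B := by
      have a1 := hf1 A hA.2
      have a2 := hf2 A hA.2
      have b1 := hf1 B hB.2
      have b2 := hf2 B hB.2
      rw [hAB] at a1 a2
      rcases lt_trichotomy (f A) (f B) with h | h | h
      · exact absurd (b2 (f A + 1) (by omega)) (not_lt.2 (a1 _))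
      · exact h
      · exact absurd (a2 (f B + 1) (by omega)) (not_lt.2 (b1 _))
    have := congrArg (fun X => X.erase (f A)) hAB
    rwa [Finset.erase_insert (hfA A hA.2), h, Finset.erase_insert (hfA B hB.2)] at this
  · intro B hB
    rw [mem_words] at hB
    obtain ⟨hBS, hcard, hlink⟩ := hB
    -- The bound `ha` makes the total height 2(a+1) - |S| positive, so some left parenthesis is
    -- unpaired.
    have h0 := height_zero hBS
    obtain ⟨i, h1, h2⟩ := exists_first_min (S := S) (B := B) (by omega)
    have hs := height_eq_succ_add S B i
    have h3 := h2 i le_rfl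
    have hiS : i ∈ S := by by_contra hc; simp [hc] at hs; omega
    have hiB : i ∈ B := by by_contra hc; simp [hc, hiS] at hs; omega
    simp only [hiS, hiB, if_true] at hs
    have hins : insert i (B.erase i) = B := Finset.insert_erase hiB
    have hh : ∀ j, height S B j = height S (B.erase i) j + if j ≤ i then 2 else 0 := by
      intro j
      rw [← height_insert hiS (Finset.notMem_erase i B), hins]
    have hb : ¬ IsBallot S (B.erase i) := by
      intro hb
      have e1 := hb i
      have e2 := hh i
      obtain ⟨n, hn⟩ : ∃ n, S ⊆ Finset.range n := S.exists_nat_subset_range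
      have e3 := h1 n
      rw [height_of_le hn B le_rfl] at e3
      simp at e2
      omega
    have hf : f (B.erase i) = i := by
      have a1 := hf3 _ hb
      have a2 := hf4 _ hb
      rcases lt_trichotomy (f (B.erase i)) i with h | h | h
      · have e1 := h2 (f (B.erase i)) h.le
        have e2 := a1 i h
        have e3 := hh i
        have e4 := hh (f (B.erase i))
        simp [h.le] at e3 e4
        omega
      · exact h
      · have e1 := h1 (f (B.erase i))
        have e2 := a2 i
        have e3 := hh i
        have e4 := hh (f (B.erase i))
        rw [if_neg (by omega)] at e4
        simp at e3
        omega
    refine ⟨B.erase i, ?_, by simp only [hf, hins]⟩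
    rw [Finset.mem_filter, mem_words]
    refine ⟨⟨(Finset.erase_subset i B).trans hBS, by rw [Finset.card_erase_of_mem hiB, hcard]; rfl,
      fun j hj h => ?_⟩, hb⟩
    rw [Finset.mem_erase] at h ⊢
    refine ⟨?_, hlink j hj h.2⟩
    -- A left parenthesis at `j + 1` would make the height at `j + 2` smaller than the minimum,
    -- attained at `j + 1`.
    rintro rfl
    have e1 := height_eq_succ_add S B (j + 1)
    have e2 := h1 (j + 1 + 1)
    rw [if_pos (hC j hj).2, if_pos h.2] at e1
    omega

/-! ### Words with a condition between the first and the last letter -/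

/-- The links between positions of `S`. -/
def linksOn (S : Finset ℕ) (C : ℕ → Prop) (i : ℕ) : Prop := C i ∧ i ∈ S ∧ i + 1 ∈ S

open Classical in
/-- The words with a left parenthesis at `0` and a right one at the last position `e`. -/
theorem card_words_violating {S : Finset ℕ} {C : ℕ → Prop} {e : ℕ} (b : ℕ)
    (hS : S ⊆ Finset.range (e + 1)) (he : 0 < e) (h0 : 0 ∈ S)
    (hC : ∀ i, C i → i ∈ S ∧ i + 1 ∈ S) :
    ((words S C (b + 1)).filter fun A => 0 ∈ A ∧ e ∉ A).card =
      (words ((S.erase 0).erase e) (linksOn ((S.erase 0).erase e) C) b).card := by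
  -- The deleted letters take no condition with them: the link at `0` holds since `0` is left, and
  -- the link into `e` is void since `e` is right.
  refine Finset.card_bij (fun A _ => A.erase 0) ?_ ?_ ?_
  · intro A hA
    rw [Finset.mem_filter, mem_words] at hA
    obtain ⟨⟨hAS, hcard, hlink⟩, h0A, heA⟩ := hA
    rw [mem_words]
    refine ⟨fun x hx => ?_, by rw [Finset.card_erase_of_mem h0A, hcard]; rfl, fun i hi h => ?_⟩
    · have := hAS (Finset.mem_of_mem_erase hx)
      grind
    · have := hlink i hi.1 (Finset.mem_of_mem_erase h)
      have := hi.2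
      grind
  · intro A hA B hB hAB
    rw [Finset.mem_filter] at hA hB
    rw [← Finset.insert_erase hA.2.1, ← Finset.insert_erase hB.2.1, hAB]
  · intro B hB
    rw [mem_words] at hB
    obtain ⟨hBS, hcard, hlink⟩ := hB
    have h0B : 0 ∉ B := fun h => by simpa using hBS h
    have heB : e ∉ B := fun h => by simpa using hBS h
    refine ⟨insert 0 B, ?_, Finset.erase_insert h0B⟩
    rw [Finset.mem_filter, mem_words]
    refine ⟨⟨fun x hx => ?_, by rw [Finset.card_insert_of_notMem h0B, hcard], fun i hi h => ?_⟩,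
      by simp, by grind⟩
    · rcases Finset.mem_insert.1 hx with rfl | hx
      · exact h0
      · exact Finset.mem_of_mem_erase (Finset.mem_of_mem_erase (hBS hx))
    · have hi1 : i + 1 ∈ B := by simpa using h
      have hi2 := hBS hi1
      have hi3 := hC i hi
      by_cases hi0 : i = 0
      · simp [hi0]
      · refine Finset.mem_insert_of_mem (hlink i ⟨hi, ?_, hi2⟩ hi1)
        have : i + 1 < e + 1 := Finset.mem_range.1 (hS hi3.2)
        grind

/-- The largest right parenthesis `z` of the block linked to `0` exists, and the word up to that
parenthesis stays positive. -/
def IsExceptionalWord (S : Finset ℕ) (C : ℕ → Prop) (e : ℕ) (A : Finset ℕ) : Prop :=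
  ∃ z ∈ S, z ∉ A ∧ (∀ j < z, C j ∧ j ∈ A) ∧ ∀ i, z < i → i ≤ e → 1 ≤ height S A i

/-- Removing the outer positions `0` and `e` of `S` and turning the right parenthesis `z` into a
left one changes heights by one. -/
theorem height_erase_erase {S A B : Finset ℕ} {e z : ℕ} (hz : z < e) (heS : e ∈ S)
    (hzS : z ∈ S) (heA : e ∈ A) (hzA : z ∉ A)
    (hB : ∀ x, x ≠ 0 → x ≠ e → (x ∈ B ↔ x = z ∨ x ∈ A))
    (i : ℕ) (hi0 : 0 < i) (hie : i ≤ e) :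
    height S A i = height ((S.erase 0).erase e) B i + if i ≤ z then -1 else 1 := by
  have e1 : (S.filter (i ≤ ·)) = insert e (((S.erase 0).erase e).filter (i ≤ ·)) := by
    ext x; grind
  unfold height
  rw [e1, Finset.sum_insert (by simp), if_pos heA]
  have e2 : ∀ x ∈ ((S.erase 0).erase e).filter (i ≤ ·), (if x ∈ B then (1 : ℤ) else -1) =
      (if x ∈ A then 1 else -1) + if x = z then 2 else 0 := by
    intro x hx
    have := hB x (by grind) (by grind)
    by_cases hxz : x = z
    · subst hxz; simp [this, hzA]
    · simp [this, hxz]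
  rw [Finset.sum_congr rfl e2, Finset.sum_add_distrib, Finset.sum_ite_eq']
  by_cases hiz : i ≤ z
  · have : z ∈ ((S.erase 0).erase e).filter (i ≤ ·) := by grind
    rw [if_pos this, if_pos hiz]; ring
  · have : z ∉ ((S.erase 0).erase e).filter (i ≤ ·) := by grind
    rw [if_neg this, if_neg hiz]; ring

-- In an exceptional ballot word `e` is left, and the left parentheses `0, …, z - 1` form a linked
-- run ended by the right one at `z`. Make `z` left and delete `0` and `e`. Above `z` the heights
-- drop by one, which the bound `1 ≤ height` permits; at the positions from 1 to `z` they rise by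
-- one. Conversely `z` is recovered as the end of the run of left parentheses linked to `0`: a
-- linked left parenthesis at `z + 1` would have forced one at `z`.
open Classical in
theorem card_words_exceptional {S : Finset ℕ} {C : ℕ → Prop} {e : ℕ} (b : ℕ)
    (hS : S ⊆ Finset.range (e + 1)) (he : 0 < e) (h0 : 0 ∈ S) (heS : e ∈ S)
    (hC : ∀ i, C i → i ∈ S ∧ i + 1 ∈ S) (hne : ¬ ∀ j < e, C j) :
    ((words S C (b + 1)).filter fun A => IsBallot S A ∧ IsExceptionalWord S C e A).card =
      ((words ((S.erase 0).erase e) (linksOn ((S.erase 0).erase e) C) b).filter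
        fun B => IsBallot ((S.erase 0).erase e) B).card := by
  have hSle : ∀ x ∈ S, x ≤ e := fun x hx => by have := Finset.mem_range.1 (hS hx); omega
  set S' := (S.erase 0).erase e with hS'
  have hS'r : S' ⊆ Finset.range e := by
    intro x hx
    have := hSle x (by grind)
    grind
  have hlast : ∀ A : Finset ℕ, IsBallot S A → e ∈ A := by
    intro A hA
    by_contra hc
    have h1 := height_eq_succ_add S A e
    rw [height_of_le hS A le_rfl, if_pos heS, if_neg hc] at h1
    have := hA e
    omega
  choose! f hfS hfA hf1 hf2 using
    (fun A (h : IsExceptionalWord S C e A) => h)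
  have hfe : ∀ A, IsBallot S A → IsExceptionalWord S C e A → f A < e := by
    intro A hA hE
    have h1 := hSle _ (hfS A hE)
    have h2 := hlast A hA
    have h3 := hfA A hE
    rcases h1.lt_or_eq with h | h
    · exact h
    · exact absurd (h ▸ h2) h3
  refine Finset.card_bij (fun A _ => ((insert (f A) A).erase 0).erase e) ?_ ?_ ?_
  · intro A hA
    rw [Finset.mem_filter, mem_words] at hA
    obtain ⟨⟨hAS, hcard, hlink⟩, hb, hE⟩ := hA
    have hze := hfe A hb hE
    have heA := hlast A hb
    have h1 := hf1 A hE
    have h2 := hf2 A hE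
    have hzS := hfS A hE
    have hzA := hfA A hE
    generalize f A = z at *
    have h0i : 0 ∈ insert z A := by
      rcases Nat.eq_zero_or_pos z with h | h
      · simp [h]
      · exact Finset.mem_insert_of_mem (h1 0 h).2
    rw [Finset.mem_filter, mem_words]
    refine ⟨⟨fun x hx => ?_, ?_, fun i hi h => ?_⟩, fun i => ?_⟩
    · have : x ∈ S := by
        have : x ∈ insert z A := Finset.mem_of_mem_erase (Finset.mem_of_mem_erase hx)
        rcases Finset.mem_insert.1 this with rfl | h
        · exact hzS
        · exact hAS h
      grind
    · rw [Finset.card_erase_of_mem (by grind), Finset.card_erase_of_mem h0i,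
        Finset.card_insert_of_notMem hzA, hcard]
      rfl
    · have hi' := hi.2.1
      have : i ∈ A ∨ i = z := by
        have hm : i + 1 ∈ insert z A := Finset.mem_of_mem_erase (Finset.mem_of_mem_erase h)
        rcases Finset.mem_insert.1 hm with hm | hm
        · exact Or.inl (h1 i (by omega)).2
        · exact Or.inl (hlink i hi.1 hm)
      grind
    · by_cases hie : i ≤ e
      · have aux : ∀ i, 0 < i → i ≤ e → 0 ≤ height S' (((insert z A).erase 0).erase e) i := by
          intro i hi0 hie
          have := height_erase_erase hze heS hzS heA hzA
            (B := ((insert z A).erase 0).erase e) (by grind) i hi0 hie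
          rw [← hS'] at this
          have hbi := hb i
          split_ifs at this with hiz
          · omega
          · have := h2 i (by omega) hie
            omega
        rcases Nat.eq_zero_or_pos i with rfl | hi0
        · rw [height_eq_succ_add, if_neg (by simp [hS']), add_zero]
          exact aux 1 one_pos he
        · exact aux i hi0 hie
      · rw [height_of_le hS'r _ (by omega)]
  · intro A hA B hB hAB
    rw [Finset.mem_filter, mem_words] at hA hB
    obtain ⟨⟨hAS, -, hAl⟩, hAb, hAE⟩ := hA
    obtain ⟨⟨hBS, -, hBl⟩, hBb, hBE⟩ := hB
    have hAe := hfe A hAb hAE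
    have hBe := hfe B hBb hBE
    have a1 := hf1 A hAE
    have b1 := hf1 B hBE
    have a2 := hfA A hAE
    have b2 := hfA B hBE
    have a3 := hlast A hAb
    have b3 := hlast B hBb
    have key : ∀ x, x ≠ 0 → x ≠ e → ((x = f A ∨ x ∈ A) ↔ (x = f B ∨ x ∈ B)) := by
      intro x hx0 hxe
      have := congrArg (x ∈ ·) hAB
      simpa [hx0, hxe] using this
    have hf : f A = f B := by
      rcases lt_trichotomy (f A) (f B) with h | h | h
      · have h3 := (b1 (f A) h).1
        have h4 : f A + 1 = f B ∨ f A + 1 ∈ B := by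
          rcases Nat.lt_or_ge (f A + 1) (f B) with h' | h'
          · exact Or.inr (b1 _ h').2
          · exact Or.inl (by omega)
        rcases (key (f A + 1) (by omega) (by omega)).2 h4 with h5 | h5
        · omega
        · exact absurd (hAl _ h3 h5) a2
      · exact h
      · have h3 := (a1 (f B) h).1
        have h4 : f B + 1 = f A ∨ f B + 1 ∈ A := by
          rcases Nat.lt_or_ge (f B + 1) (f A) with h' | h'
          · exact Or.inr (a1 _ h').2
          · exact Or.inl (by omega)
        rcases (key (f B + 1) (by omega) (by omega)).1 h4 with h5 | h5
        · omega
        · exact absurd (hBl _ h3 h5) b2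
    rw [← hf] at key b1 b2
    ext x
    by_cases hxe : x = e
    · simp [hxe, a3, b3]
    by_cases hxz : x = f A
    · simp [hxz, a2, b2]
    by_cases hx0 : x = 0
    · have : 0 < f A := by omega
      simp [hx0, (a1 0 this).2, (b1 0 this).2]
    · simpa [hxz] using key x hx0 hxe
  · intro B hB
    rw [Finset.mem_filter, mem_words] at hB
    obtain ⟨⟨hBS, hcard, hlink⟩, hb⟩ := hB
    have h0B : 0 ∉ B := fun h => by simpa [hS'] using hBS h
    have heB : e ∉ B := fun h => by simpa [hS'] using hBS h
    -- The run of left parentheses linked to `0` stops at the least such `z`; this letter becomes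
    -- the right parenthesis.
    have hex : ∃ z, ¬ (C z ∧ z + 1 ∈ B) :=
      ⟨e, fun h => by have := hSle _ (hC e h.1).2; omega⟩
    have hz1 := Nat.find_spec hex
    have hz2 : ∀ j < Nat.find hex, C j ∧ j + 1 ∈ B := fun j hj => not_not.1 (Nat.find_min hex hj)
    generalize Nat.find hex = z at hz1 hz2
    have hzle : z ≤ e := by
      by_contra hc
      have := hSle _ (hC e (hz2 e (by omega)).1).2
      omega
    have hmem : ∀ j, 0 < j → j ≤ z → j ∈ B := by
      intro j h1 h2
      have := (hz2 (j - 1) (by omega)).2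
      rwa [Nat.sub_add_cancel h1] at this
    have hze : z < e := by
      rcases hzle.lt_or_eq with h | h
      · exact h
      · exact absurd (hmem e he h.ge) heB
    have hzB : z ∈ insert 0 B := by
      rcases Nat.eq_zero_or_pos z with h | h
      · simp [h]
      · exact Finset.mem_insert_of_mem (hmem z h le_rfl)
    have hzS : z ∈ S := by
      rcases Finset.mem_insert.1 hzB with rfl | h
      · exact h0
      · have := hBS h; grind
    obtain ⟨A, hAdef⟩ : ∃ A, A = insert e ((insert 0 B).erase z) := ⟨_, rfl⟩
    have hxA : ∀ x, x ∈ A ↔ x = e ∨ x ≠ z ∧ (x = 0 ∨ x ∈ B) := by simp [hAdef]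
    have hzA : z ∉ A := by simp [hxA, hze.ne]
    have heA : e ∈ A := by simp [hxA]
    have hBx : ∀ x, x ≠ 0 → x ≠ e → (x ∈ B ↔ x = z ∨ x ∈ A) := by
      intro x hx0 hxe
      by_cases hxz : x = z
      · subst hxz; simpa [hx0] using hzB
      · simp [hxA, hx0, hxe, hxz]
    have hBA : ((insert z A).erase 0).erase e = B := by
      ext x
      by_cases hx0 : x = 0
      · simp [hx0, h0B]
      by_cases hxe : x = e
      · simp [hxe, heB]
      simp [hBx x hx0 hxe, hx0, hxe]
    have hAS : A ⊆ S := by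
      intro x hx
      rcases (hxA x).1 hx with rfl | ⟨-, rfl | h⟩
      · exact heS
      · exact h0
      · exact Finset.mem_of_mem_erase (Finset.mem_of_mem_erase (hBS h))
    have hjA : ∀ j < z, j ∈ A := by
      intro j hj
      rw [hxA]
      rcases Nat.eq_zero_or_pos j with rfl | h
      · exact Or.inr ⟨hj.ne, Or.inl rfl⟩
      · exact Or.inr ⟨hj.ne, Or.inr (hmem j h hj.le)⟩
    have hhei : ∀ i, 0 < i → i ≤ e → height S A i = height S' B i + if i ≤ z then -1 else 1 :=
      height_erase_erase hze heS hzS heA hzA hBx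
    have hE : ∀ i, z < i → i ≤ e → 1 ≤ height S A i := by
      intro i h1 h2
      have := hhei i (by omega) h2
      rw [if_neg (by omega)] at this
      have := hb i
      omega
    have hzh : 0 ≤ height S A z := by
      have h1 := height_eq_succ_add S A z
      rw [if_pos hzS, if_neg hzA] at h1
      have := hE (z + 1) (by omega) (by omega)
      omega
    have hAb : IsBallot S A := by
      intro i
      by_cases hie : i ≤ e
      · by_cases hzi : z < i
        · have := hE i hzi hie
          omega
        · push Not at hzi
          refine Nat.decreasingInduction' (P := fun m => 0 ≤ height S A m) ?_ hzi hzh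
          intro m hm _ ih
          have h1 := height_eq_succ_add S A m
          have h2 := hjA m hm
          rw [if_pos (hAS h2), if_pos h2] at h1
          omega
      · rw [height_of_le hS _ (by omega)]
    have hAE : IsExceptionalWord S C e A :=
      ⟨z, hzS, hzA, fun j hj => ⟨(hz2 j hj).1, hjA j hj⟩, hE⟩
    have hAl : ∀ i, C i → i + 1 ∈ A → i ∈ A := by
      intro i hi h
      have hi2 := hC i hi
      by_cases hie : i = e
      · have := hSle _ hi2.2; omega
      -- The link into the new letter `e` needs a left parenthesis at `e - 1`. That position carries
      -- the first letter of the ballot word `B`, which is left, unless it is `0` or `z`; in these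
      -- cases all of `0, …, e` would be linked, against `hne`.
      by_cases hi1e : i + 1 = e
      · have hi0 : i ≠ 0 := by
          rintro rfl
          exact hne fun j hj => (by omega : j = 0) ▸ hi
        have hiz : i ≠ z := by
          rintro rfl
          refine hne fun j hj => ?_
          rcases Nat.lt_or_ge j i with h' | h'
          · exact (hz2 j h').1
          · exact (by omega : j = i) ▸ hi
        have hiS : i ∈ S' := by simp [hS', hi0, hie, hi2.1]
        have h1 := height_eq_succ_add S' B i
        rw [height_of_le hS'r B (i := i + 1) (by omega), if_pos hiS] at h1
        have h2 := hb i
        have h3 : i ∈ B := by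
          by_contra hc
          rw [if_neg hc] at h1
          omega
        exact (hxA i).2 (Or.inr ⟨hiz, Or.inr h3⟩)
      · obtain ⟨h1, h2⟩ := ((hxA _).1 h).resolve_left hi1e
        have h3 : i + 1 ∈ B := h2.resolve_left (by omega)
        have hiz : i ≠ z := by
          rintro rfl
          exact hz1 ⟨hi, h3⟩
        refine (hxA i).2 (Or.inr ⟨hiz, ?_⟩)
        by_cases hi0 : i = 0
        · exact Or.inl hi0
        · exact Or.inr (hlink i ⟨hi, by simp [hS', hi0, hie, hi2.1], hBS h3⟩ h3)
    have hfz : f A = z := by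
      have b1 := hf1 A hAE
      have b2 := hfA A hAE
      rcases lt_trichotomy (f A) z with h | h | h
      · exact absurd (hjA _ h) b2
      · exact h
      · exact absurd (b1 z h).2 hzA
    refine ⟨A, ?_, by simp only [hfz]; exact hBA⟩
    rw [Finset.mem_filter, mem_words]
    refine ⟨⟨hAS, ?_, hAl⟩, hAb, hAE⟩
    rw [hAdef, Finset.card_insert_of_notMem (by simp [heB, he.ne']), Finset.card_erase_of_mem hzB,
      Finset.card_insert_of_notMem h0B, hcard]
    rfl

open Classical in
/-- Reflection for words on a circle, where `e ∈ A` is required if `0 ∈ A`. -/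
theorem card_cyclic_words {S : Finset ℕ} {C : ℕ → Prop} {e a : ℕ}
    (hS : S ⊆ Finset.range (e + 1)) (he : 0 < e) (h0 : 0 ∈ S) (heS : e ∈ S)
    (hC : ∀ i, C i → i ∈ S ∧ i + 1 ∈ S) (hne : ¬ ∀ j < e, C j) (ha : S.card ≤ 2 * a) :
    ((words S C a).filter fun A => 0 ∈ A → e ∈ A).card =
      ((words S C (a + 1)).filter fun A => 0 ∈ A → e ∈ A).card +
      ((words S C a).filter fun A => IsBallot S A ∧ ¬ IsExceptionalWord S C e A).card := by
  -- Two letters and one left parenthesis disappear, so the bound required for reflection is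
  -- inherited by the shorter set.
  have hcard : ((S.erase 0).erase e).card + 2 = S.card := by
    rw [Finset.card_erase_of_mem (by simp [heS, he.ne']), Finset.card_erase_of_mem h0]
    have : 1 < S.card := Finset.one_lt_card.2 ⟨0, h0, e, heS, he.ne⟩
    omega
  obtain ⟨b, rfl⟩ : ∃ b, a = b + 1 := ⟨a - 1, by omega⟩
  have hviol : ∀ a, ((words S C a).filter fun A => 0 ∈ A → e ∈ A).card +
      ((words S C a).filter fun A => 0 ∈ A ∧ e ∉ A).card = (words S C a).card := by
    intro a
    rw [← Finset.card_filter_add_card_filter_not (s := words S C a) (fun A => 0 ∈ A → e ∈ A)]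
    simp only [Classical.not_imp]
  -- The violating words with b+1 and b+2 left parentheses are the words on the shorter set with b
  -- and b+1. By reflection there, their numbers differ by the number of ballot words on that set,
  -- hence of exceptional words.
  have e1 := hviol (b + 1)
  have e2 := hviol (b + 1 + 1)
  rw [card_words_violating _ hS he h0 hC] at e1 e2
  have e3 := card_words_not_isBallot hC ha
  have e4 := card_words_not_isBallot (S := (S.erase 0).erase e)
    (C := linksOn ((S.erase 0).erase e) C) (a := b) (fun i hi => hi.2) (by omega)
  have e5 : ((words S C (b + 1)).filter fun A => IsBallot S A ∧ IsExceptionalWord S C e A).card =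
      ((words ((S.erase 0).erase e) (linksOn ((S.erase 0).erase e) C) b).filter
        (IsBallot ((S.erase 0).erase e))).card := card_words_exceptional b hS he h0 heS hC hne
  have e6 := Finset.card_filter_add_card_filter_not (s := words S C (b + 1)) (IsBallot S)
  have e7 := Finset.card_filter_add_card_filter_not
    (s := words ((S.erase 0).erase e) (linksOn ((S.erase 0).erase e) C) b)
    (IsBallot ((S.erase 0).erase e))
  have e8 : ((words S C (b + 1)).filter fun A => IsBallot S A ∧ IsExceptionalWord S C e A).card +
      ((words S C (b + 1)).filter fun A => IsBallot S A ∧ ¬ IsExceptionalWord S C e A).card =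
      ((words S C (b + 1)).filter (IsBallot S)).card := by
    rw [← Finset.card_filter_add_card_filter_not
      (s := (words S C (b + 1)).filter (IsBallot S)) (IsExceptionalWord S C e),
      Finset.filter_filter, Finset.filter_filter]
  omega

/-! ### Chains of two vertical strips -/

/-- The row lengths of an `(n,k)`-restricted partition. -/
structure IsRestricted (n k : ℕ) (f : ℕ → ℕ) : Prop where
  antitone : Antitone f
  eq_zero : ∀ i, n ≤ i → f i = 0
  le_add : f 0 ≤ f (n - 1) + k

/-- The row lengths after adding one box in each row of `I`. -/
def addRows (l : ℕ → ℕ) (I : Finset ℕ) (i : ℕ) : ℕ := l i + if i ∈ I then 1 else 0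

open Classical in
/-- The sets of `p` rows such that adding a box in each of them to `l` leads to a restricted
partition from which `v` arises by adding a vertical strip. -/
noncomputable def midStrips (n k p : ℕ) (l v : ℕ → ℕ) : Finset (Finset ℕ) :=
  ((Finset.range n).powersetCard p).filter fun I =>
    IsRestricted n k (addRows l I) ∧ ∀ i, addRows l I i ≤ v i ∧ v i ≤ addRows l I i + 1

/-- The rows with exactly one box of `v / l`. -/
def singles (n : ℕ) (l v : ℕ → ℕ) : Finset ℕ := (Finset.range n).filter fun i => v i = l i + 1

/-- The rows with exactly two boxes of `v / l`. -/
def doubles (n : ℕ) (l v : ℕ → ℕ) : Finset ℕ := (Finset.range n).filter fun i => v i = l i + 2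

/-- Consecutive rows whose only boxes of `v / l` are in the same column. -/
def rowLink (n : ℕ) (l v : ℕ → ℕ) (i : ℕ) : Prop :=
  i ∈ singles n l v ∧ i + 1 ∈ singles n l v ∧ l i = l (i + 1)

/-- The last row and the first row are linked as well. -/
def IsCyclic (n k : ℕ) (l v : ℕ → ℕ) : Prop :=
  0 ∈ singles n l v ∧ n - 1 ∈ singles n l v ∧ l 0 = l (n - 1) + k

theorem mem_singles {n : ℕ} {l v : ℕ → ℕ} {i : ℕ} :
    i ∈ singles n l v ↔ i < n ∧ v i = l i + 1 := by simp [singles]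

theorem mem_doubles {n : ℕ} {l v : ℕ → ℕ} {i : ℕ} :
    i ∈ doubles n l v ↔ i < n ∧ v i = l i + 2 := by simp [doubles]

theorem mem_midStrips {n k p : ℕ} {l v : ℕ → ℕ} {I : Finset ℕ} :
    I ∈ midStrips n k p l v ↔ (I ⊆ Finset.range n ∧ I.card = p) ∧
      IsRestricted n k (addRows l I) ∧ ∀ i, addRows l I i ≤ v i ∧ v i ≤ addRows l I i + 1 := by
  simp [midStrips]

/-- A row with two boxes of `v / l` is used by both strips and a row without boxes by none, so only
the rows with one box leave a choice. -/
theorem inter_singles_union_doubles {n k p : ℕ} {l v : ℕ → ℕ} {I : Finset ℕ}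
    (hI : I ∈ midStrips n k p l v) : (I ∩ singles n l v) ∪ doubles n l v = I := by
  rw [mem_midStrips] at hI
  obtain ⟨⟨h1, -⟩, -, h2⟩ := hI
  ext i
  have := h2 i
  have h3 := @h1 i
  simp only [addRows, Finset.mem_range] at this h3
  simp only [Finset.mem_union, Finset.mem_inter, mem_singles, mem_doubles]
  by_cases hi : i ∈ I
  · simp only [hi, if_true, forall_true_left] at this h3
    simp only [hi, true_and, iff_true, h3]
    omega
  · simp only [hi, if_false] at this
    simp only [hi, false_and, false_or, iff_false]
    omega

/-- Monotonicity can fail only where two adjacent rows of `l` are equal and the lower one alone gets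
a box. As `v` is a partition, both rows then have exactly one box of `v / l`, so they are linked.
The bound by `k` is the same comparison between the last row, raised by `k`, and the first one,
which closes the rows to a circle. -/
theorem isRestricted_addRows {n k : ℕ} {l v : ℕ → ℕ} (hn : 2 ≤ n)
    (hl : IsRestricted n k l) (hv : IsRestricted n k v) (hlv : ∀ i, l i ≤ v i ∧ v i ≤ l i + 2)
    {A : Finset ℕ} (hA : A ⊆ singles n l v) (hlink : ∀ i, rowLink n l v i → i + 1 ∈ A → i ∈ A)
    (hcyc : IsCyclic n k l v → 0 ∈ A → n - 1 ∈ A) :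
    IsRestricted n k (addRows l (A ∪ doubles n l v)) where
  antitone := by
    refine antitone_nat_of_succ_le fun i => ?_
    have h1 := hl.antitone (Nat.le_succ i)
    have h2 := hv.antitone (Nat.le_succ i)
    have h3 := hlv i
    simp only [addRows, Finset.mem_union, mem_doubles]
    by_cases hi : i + 1 ∈ A ∨ i + 1 < n ∧ v (i + 1) = l (i + 1) + 2
    · rw [if_pos hi]
      rcases h1.lt_or_eq with h | h
      · simp only [Nat.succ_eq_add_one] at h; omega
      · simp only [Nat.succ_eq_add_one] at h h2
        suffices h : i ∈ A ∨ i < n ∧ v i = l i + 2 by rw [if_pos h]; omega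
        rcases hi with hi | hi
        · have h4 := mem_singles.1 (hA hi)
          by_cases h5 : v i = l i + 2
          · exact Or.inr ⟨by omega, h5⟩
          · exact Or.inl (hlink i ⟨mem_singles.2 ⟨by omega, by omega⟩, hA hi, h.symm⟩ hi)
        · exact Or.inr ⟨by omega, by omega⟩
    · rw [if_neg hi]
      simp only [Nat.succ_eq_add_one] at h1
      omega
  eq_zero := by
    intro i hi
    have h1 : i ∉ A := fun h => by have := mem_singles.1 (hA h); omega
    simp only [addRows, Finset.mem_union, mem_doubles, h1, hl.eq_zero i hi]
    rw [if_neg (by simp; omega)]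
  le_add := by
    have h1 := hl.le_add
    have h2 := hv.le_add
    have h3 := hlv 0
    have h4 := hlv (n - 1)
    simp only [addRows, Finset.mem_union, mem_doubles]
    by_cases h5 : n - 1 ∈ A ∨ n - 1 < n ∧ v (n - 1) = l (n - 1) + 2
    · rw [if_pos h5]
      split_ifs <;> omega
    · rw [if_neg h5]
      push Not at h5
      have h6 := h5.2 (by omega)
      by_cases h7 : l 0 = l (n - 1) + k
      · by_cases h8 : v 0 = l 0 + 2
        · omega
        · by_cases h9 : 0 ∈ A
          · have h10 := mem_singles.1 (hA h9)
            exact absurd (hcyc ⟨hA h9, mem_singles.2 ⟨by omega, by omega⟩, h7⟩ h9) h5.1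
          · rw [if_neg (by simp [h9, h8])]
            omega
      · split_ifs <;> omega

theorem mem_of_isRestricted_addRows {n k : ℕ} {l : ℕ → ℕ} {A D : Finset ℕ}
    (h : IsRestricted n k (addRows l (A ∪ D))) {i : ℕ} (hi : l i = l (i + 1))
    (hiD : i ∉ D) (hiA : i + 1 ∈ A) : i ∈ A := by
  by_contra hc
  have := h.antitone (Nat.le_succ i)
  simp [addRows, hiD, hc, hiA, hi] at this

/-- The doubled rows belong to the first strip in any case, hence the shift of its size by their
number. The predicate `Q` is trivial for the plain counts and selects the fusion words in the third
one. -/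
theorem card_midStrips_filter {n k : ℕ} {l v : ℕ → ℕ} (hn : 2 ≤ n)
    (hl : IsRestricted n k l) (hv : IsRestricted n k v) (hlv : ∀ i, l i ≤ v i ∧ v i ≤ l i + 2)
    (a : ℕ) (Q : Finset ℕ → Prop) [DecidablePred Q]
    [DecidablePred fun A : Finset ℕ => (IsCyclic n k l v → 0 ∈ A → n - 1 ∈ A) ∧ Q A] :
    ((midStrips n k (a + (doubles n l v).card) l v).filter
        fun I => Q (I ∩ singles n l v)).card =
      ((words (singles n l v) (rowLink n l v) a).filter
        fun A => (IsCyclic n k l v → 0 ∈ A → n - 1 ∈ A) ∧ Q A).card := by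
  have hdisj : Disjoint (singles n l v) (doubles n l v) := by
    rw [Finset.disjoint_left]
    intro i h1 h2
    rw [mem_singles] at h1
    rw [mem_doubles] at h2
    omega
  refine Finset.card_bij (fun I _ => I ∩ singles n l v) ?_ ?_ ?_
  · intro I hI
    rw [Finset.mem_filter] at hI
    have hu := inter_singles_union_doubles hI.1
    have hA : I ∩ singles n l v ⊆ singles n l v := Finset.inter_subset_right
    obtain ⟨hI, hQ⟩ := hI
    rw [mem_midStrips] at hI
    rw [Finset.mem_filter, mem_words]
    generalize I ∩ singles n l v = A at *
    subst hu
    refine ⟨⟨hA, ?_, fun i hi h => ?_⟩, fun hc h0 => ?_, hQ⟩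
    · have := hI.1.2
      rw [Finset.card_union_of_disjoint (hdisj.mono_left hA)] at this
      omega
    · exact mem_of_isRestricted_addRows hI.2.1 hi.2.2
        (Finset.disjoint_left.1 hdisj hi.1) h
    · by_contra hc'
      have h1 := hI.2.1.le_add
      have h2 := Finset.disjoint_left.1 hdisj hc.2.1
      have h3 := hc.2.2
      simp [addRows, h0, hc', h2] at h1
      omega
  · intro I hI J hJ h
    rw [Finset.mem_filter] at hI hJ
    rw [← inter_singles_union_doubles hI.1, ← inter_singles_union_doubles hJ.1]
    exact congrArg (· ∪ _) h
  · intro A hA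
    rw [Finset.mem_filter, mem_words] at hA
    obtain ⟨⟨hA, hcard, hlink⟩, hcyc, hQ⟩ := hA
    have hAi : (A ∪ doubles n l v) ∩ singles n l v = A := by
      rw [Finset.union_inter_distrib_right, Finset.inter_eq_left.2 hA,
        Finset.disjoint_iff_inter_eq_empty.1 hdisj.symm, Finset.union_empty]
    refine ⟨A ∪ doubles n l v, ?_, hAi⟩
    rw [Finset.mem_filter, mem_midStrips]
    simp only [hAi]
    refine ⟨⟨⟨?_, ?_⟩, isRestricted_addRows hn hl hv hlv hA hlink hcyc, fun i => ?_⟩, hQ⟩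
    · exact Finset.union_subset (hA.trans (Finset.filter_subset _ _)) (Finset.filter_subset _ _)
    · rw [Finset.card_union_of_disjoint (hdisj.mono_left hA), hcard]
    · have h1 := hlv i
      simp only [addRows, Finset.mem_union, mem_doubles]
      by_cases hi : i ∈ A
      · have := mem_singles.1 (hA hi)
        rw [if_pos (Or.inl hi)]
        omega
      · by_cases hd : v i = l i + 2
        · have : i < n := by
            by_contra hc
            have := hv.eq_zero i (by omega)
            omega
          rw [if_pos (Or.inr ⟨this, hd⟩)]
          omega
        · rw [if_neg (by simp [hi, hd])]
          omega

theorem sum_eq_add_card_singles {n : ℕ} {l v : ℕ → ℕ} (hlv : ∀ i, l i ≤ v i ∧ v i ≤ l i + 2) :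
    ∑ i ∈ Finset.range n, v i = ∑ i ∈ Finset.range n, l i +
      ((singles n l v).card + 2 * (doubles n l v).card) := by
  rw [singles, doubles, Finset.card_filter, Finset.card_filter, Finset.mul_sum,
    ← Finset.sum_add_distrib, ← Finset.sum_add_distrib]
  refine Finset.sum_congr rfl fun i _ => ?_
  have := hlv i
  split_ifs <;> omega

/-- The paths that are counted for a shape with two columns, as sets of rows of the first strip. -/
def IsFusionStrip (n k : ℕ) (l v : ℕ → ℕ) (I : Finset ℕ) : Prop :=
  IsBallot (singles n l v) (I ∩ singles n l v) ∧ ¬ (IsCyclic n k l v ∧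
    IsExceptionalWord (singles n l v) (rowLink n l v) (n - 1) (I ∩ singles n l v))

open Classical in
theorem card_midStrips_eq {n k p q : ℕ} {l v : ℕ → ℕ} (hn : 2 ≤ n) (hk : 1 ≤ k)
    (hl : IsRestricted n k l) (hv : IsRestricted n k v) (hqp : q ≤ p)
    (hsum : ∑ i ∈ Finset.range n, v i = ∑ i ∈ Finset.range n, l i + (p + q)) :
    (midStrips n k p l v).card = (midStrips n k (p + 1) l v).card +
      ((midStrips n k p l v).filter (IsFusionStrip n k l v)).card := by
  by_cases hlv : ∀ i, l i ≤ v i ∧ v i ≤ l i + 2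
  · have hc := sum_eq_add_card_singles (n := n) hlv
    obtain ⟨a, rfl⟩ : ∃ a, p = a + (doubles n l v).card := ⟨p - (doubles n l v).card, by omega⟩
    -- With d doubled rows there are p+q-2d letters and a = p-d, so the bound says q ≤ p.
    have ha : (singles n l v).card ≤ 2 * a := by omega
    have hC : ∀ i, rowLink n l v i → i ∈ singles n l v ∧ i + 1 ∈ singles n l v :=
      fun i hi => ⟨hi.1, hi.2.1⟩
    have e1 := card_midStrips_filter hn hl hv hlv a (fun _ => True)
    have e2 := card_midStrips_filter hn hl hv hlv (a + 1) (fun _ => True)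
    have e3 := card_midStrips_filter hn hl hv hlv a
      (fun A => IsBallot (singles n l v) A ∧ ¬ (IsCyclic n k l v ∧
        IsExceptionalWord (singles n l v) (rowLink n l v) (n - 1) A))
    have e3' : ((midStrips n k (a + (doubles n l v).card) l v).filter
        (IsFusionStrip n k l v)).card = _ := Eq.trans (by unfold IsFusionStrip; congr) e3
    rw [add_right_comm]
    simp only [Finset.filter_true, and_true] at e1 e2
    rw [e1, e2, e3']
    by_cases hcyc : IsCyclic n k l v
    · obtain ⟨e, rfl⟩ : ∃ e, n = e + 1 := ⟨n - 1, by omega⟩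
      simp only [hcyc, forall_true_left, true_and, Nat.add_sub_cancel]
      have hS : singles (e + 1) l v ⊆ Finset.range (e + 1) := Finset.filter_subset _ _
      have main := card_cyclic_words hS (by omega) hcyc.1 hcyc.2.1 hC ?_ ha
      · convert main using 3
        -- For ballot words the cyclic condition is automatic: the letter at `e` is read first, so
        -- it is left.
        refine Finset.filter_congr fun A hA => ⟨fun h => h.2, fun h => ⟨fun _ => ?_, h⟩⟩
        by_contra hc'
        have h1 := height_eq_succ_add (singles (e + 1) l v) A e
        rw [height_of_le hS A le_rfl, if_pos (by simpa using hcyc.2.1),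
          if_neg hc'] at h1
        have := h.1 e
        omega
      -- If all rows were linked, `l` would be constant on them, which contradicts `l 0 = l e + k`
      -- with k ≥ 1.
      · intro hall
        have : ∀ j, j ≤ e → l j = l 0 := by
          intro j
          induction j with
          | zero => simp
          | succ j ih => intro hj; rw [← (hall j hj).2.2, ih (by omega)]
        have h1 := this e le_rfl
        have h2 := hcyc.2.2
        simp only [Nat.add_sub_cancel] at h2
        omega
    · simp only [hcyc, false_imp_iff, true_and, Finset.filter_true, false_and, not_false_eq_true,
        and_true]
      have h1 := Finset.card_filter_add_card_filter_not
        (s := words (singles n l v) (rowLink n l v) a) (IsBallot (singles n l v))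
      rw [card_words_not_isBallot hC ha] at h1
      rw [← h1, add_comm]
  · have hempty : ∀ p, midStrips n k p l v = ∅ := by
      intro p
      rw [Finset.eq_empty_iff_forall_notMem]
      intro I hI
      refine hlv fun i => ?_
      have := (mem_midStrips.1 hI).2.2 i
      simp only [addRows] at this
      split_ifs at this <;> omega
    simp [hempty]

/-! ### Young diagrams by row lengths -/

theorem youngDiagram_ext {κ κ' : YoungDiagram} (h : ∀ i, κ.rowLen i = κ'.rowLen i) : κ = κ' := by
  ext ⟨i, j⟩
  rw [YoungDiagram.mem_cells, YoungDiagram.mem_cells, YoungDiagram.mem_iff_lt_rowLen,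
    YoungDiagram.mem_iff_lt_rowLen, h]

/-- The diagram with given row lengths. -/
def ofRows (n : ℕ) (f : ℕ → ℕ) (hf : Antitone f) : YoungDiagram where
  cells := (Finset.range n ×ˢ Finset.range (f 0)).filter fun x => x.2 < f x.1
  isLowerSet := by
    rintro ⟨i, j⟩ ⟨i', j'⟩ ⟨hi, hj⟩ h
    simp only at hi hj
    simp only [Finset.coe_filter, Finset.mem_product, Finset.mem_range, Set.mem_ofPred_eq] at h ⊢
    have := hf hi
    omega

theorem rowLen_ofRows {n : ℕ} {f : ℕ → ℕ} (hf : Antitone f) (h0 : ∀ i, n ≤ i → f i = 0) (i : ℕ) :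
    (ofRows n f hf).rowLen i = f i := by
  have : ∀ j, j < (ofRows n f hf).rowLen i ↔ j < f i := by
    intro j
    rw [← YoungDiagram.mem_iff_lt_rowLen, ← YoungDiagram.mem_cells]
    simp only [ofRows, Finset.mem_filter, Finset.mem_product, Finset.mem_range]
    refine ⟨fun h => h.2, fun h => ⟨⟨?_, h.trans_le (hf (Nat.zero_le i))⟩, h⟩⟩
    by_contra hc
    rw [h0 i (by omega)] at h
    omega
  exact le_antisymm (not_lt.1 fun h => lt_irrefl _ ((this _).1 h))
    (not_lt.1 fun h => lt_irrefl _ ((this _).2 h))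

theorem colLen_le_iff {κ : YoungDiagram} {j n : ℕ} :
    κ.colLen j ≤ n ↔ κ.rowLen n ≤ j := by
  rw [← not_lt, ← not_lt, ← YoungDiagram.mem_iff_lt_colLen, ← YoungDiagram.mem_iff_lt_rowLen]

theorem rowLen_eq_zero {κ : YoungDiagram} {n : ℕ} (h : κ.colLen 0 ≤ n) (i : ℕ) (hi : n ≤ i) :
    κ.rowLen i = 0 :=
  Nat.le_zero.1 ((κ.rowLen_anti n i hi).trans (colLen_le_iff.1 h))

theorem mem_restricted_iff {n k : ℕ} {κ : YoungDiagram} :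
    κ ∈ restricted n k ↔ IsRestricted n k κ.rowLen :=
  ⟨fun h => ⟨fun i j hij => κ.rowLen_anti i j hij, rowLen_eq_zero h.1, h.2⟩,
    fun h => ⟨colLen_le_iff.2 (h.eq_zero n le_rfl).le, h.le_add⟩⟩

theorem card_eq_sum_rowLen {κ : YoungDiagram} {n : ℕ} (h : κ.colLen 0 ≤ n) :
    κ.card = ∑ i ∈ Finset.range n, κ.rowLen i := by
  have : κ.cells = (Finset.range n).biUnion κ.row := by
    ext ⟨i, j⟩
    simp only [Finset.mem_biUnion, Finset.mem_range, YoungDiagram.mem_row_iff,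
      YoungDiagram.mem_cells]
    refine ⟨fun hx => ⟨i, ?_, hx, rfl⟩, fun ⟨_, _, hx, _⟩ => hx⟩
    have := YoungDiagram.mem_iff_lt_rowLen.1 hx
    by_contra hc
    rw [rowLen_eq_zero h i (by omega)] at this
    omega
  rw [YoungDiagram.card, this, Finset.card_biUnion]
  · exact Finset.sum_congr rfl fun i _ => (κ.rowLen_eq_card).symm
  · intro i _ j _ hij
    rw [Function.onFun, Finset.disjoint_left]
    intro x hx hy
    rw [YoungDiagram.mem_row_iff] at hx hy
    exact hij (hx.2.symm.trans hy.2)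

/-! ### Alternants and the Pieri rule -/

/-- The monomial `x ^ a`. -/
noncomputable def xpow {n : ℕ} (a : Fin n → ℕ) : MvPolynomial (Fin n) ℚ := ∏ i, X i ^ a i

theorem rename_xpow {n : ℕ} (a : Fin n → ℕ) (σ : Equiv.Perm (Fin n)) :
    rename σ (xpow a) = ∏ i, X (σ i) ^ a i := by
  simp [xpow]

theorem alternant_eq_sum (n : ℕ) (a : Fin n → ℕ) :
    alternant n a = ∑ σ : Equiv.Perm (Fin n),
      ((Equiv.Perm.sign σ : ℤ) : MvPolynomial (Fin n) ℚ) * rename σ (xpow a) := by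
  rw [alternant, Matrix.det_apply']
  simp [rename_xpow]

/-- The symmetric factor can be pulled inside each permuted monomial of the alternant, where each of
its squarefree monomials raises r exponents by one. -/
theorem esymm_mul_alternant (n r : ℕ) (a : Fin n → ℕ) :
    esymm (Fin n) ℚ r * alternant n a = ∑ I ∈ Finset.univ.powersetCard r,
      alternant n fun j => a j + if j ∈ I then 1 else 0 := by
  simp only [alternant_eq_sum]
  rw [Finset.mul_sum, Finset.sum_comm]
  refine Finset.sum_congr rfl fun σ _ => ?_
  rw [← Finset.mul_sum, mul_left_comm, ← rename_esymm _ _ r σ, ← map_mul, ← map_sum]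
  congr 2
  rw [esymm, Finset.sum_mul]
  refine Finset.sum_congr rfl fun I _ => ?_
  simp only [xpow, pow_add, Finset.prod_mul_distrib, pow_ite, pow_one, pow_zero]
  rw [Finset.prod_ite_mem, Finset.univ_inter, mul_comm]

theorem alternant_eq_zero {n : ℕ} {a : Fin n → ℕ} {i j : Fin n} (hij : i ≠ j) (h : a i = a j) :
    alternant n a = 0 :=
  Matrix.det_zero_of_column_eq hij fun l => by simp [h]

/-- The quotient of alternants `a_{f+δ} / a_δ`. -/
noncomputable def schurRows (n : ℕ) (f : ℕ → ℕ) : symmetricSubalgebra (Fin n) ℚ :=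
  (exists_schur n fun j => f j + delta n j).choose

theorem schurRows_spec (n : ℕ) (f : ℕ → ℕ) :
    (schurRows n f : MvPolynomial (Fin n) ℚ) * alternant n (delta n) =
      alternant n fun j => f j + delta n j :=
  (exists_schur n fun j => f j + delta n j).choose_spec

theorem schur_eq_schurRows (n : ℕ) (κ : YoungDiagram) : schur n κ = schurRows n κ.rowLen := rfl

theorem eq_schurRows {n : ℕ} {f : ℕ → ℕ} {p : symmetricSubalgebra (Fin n) ℚ}
    (h : (p : MvPolynomial (Fin n) ℚ) * alternant n (delta n) =
      alternant n fun j => f j + delta n j) : p = schurRows n f := by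
  rw [← schurRows_spec] at h
  exact Subtype.ext (mul_right_cancel₀ (alternant_delta_ne_zero n) h)

theorem schurRows_congr {n : ℕ} {f g : ℕ → ℕ} (h : ∀ i < n, f i = g i) :
    schurRows n f = schurRows n g := by
  refine eq_schurRows ?_
  rw [schurRows_spec]
  congr 1
  ext j
  rw [h j j.2]

/-- The elementary symmetric polynomials as elements of the algebra of symmetric polynomials. -/
noncomputable def elem (n r : ℕ) : symmetricSubalgebra (Fin n) ℚ :=
  ⟨esymm (Fin n) ℚ r, esymm_isSymmetric (Fin n) ℚ r⟩

/-- All r-subsets of rows occur, also those that do not lead to a partition; this is why `schurRows`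
accepts arbitrary row lengths. For antitone `f` the unwanted terms vanish by `schurRows_eq_zero`. -/
theorem elem_mul_schurRows (n r : ℕ) (f : ℕ → ℕ) :
    elem n r * schurRows n f =
      ∑ I ∈ (Finset.range n).powersetCard r, schurRows n (addRows f I) := by
  have hr : Finset.range n = Finset.univ.map (Fin.valEmbedding (n := n)) := by
    ext i; simp
  apply Subtype.ext
  apply mul_right_cancel₀ (alternant_delta_ne_zero n)
  rw [MulMemClass.coe_mul, mul_assoc, schurRows_spec, elem, esymm_mul_alternant, hr,
    Finset.powersetCard_map, Finset.sum_map, AddSubmonoidClass.coe_finsetSum, Finset.sum_mul]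
  refine Finset.sum_congr rfl fun I _ => ?_
  rw [schurRows_spec]
  congr 1
  ext j
  simp [addRows, Finset.mapEmbedding_apply, Fin.val_inj]
  ring

/-- After adding δ the exponents at `i` and `i + 1` agree, so the alternant has two equal columns.
-/
theorem schurRows_eq_zero {n i : ℕ} {f : ℕ → ℕ} (hi : i + 1 < n) (h : f i + 1 = f (i + 1)) :
    schurRows n f = 0 := by
  refine (eq_schurRows ?_).symm
  rw [alternant_eq_zero (a := fun j => f j + delta n j) (i := ⟨i, by omega⟩) (j := ⟨i + 1, hi⟩)]
  · simp
  · simp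
  · simp only [delta, Fin.val_rev]
    omega

theorem schurRows_zero (n : ℕ) : schurRows n (fun _ => 0) = 1 := by
  refine (eq_schurRows ?_).symm
  simp

/-- Raising all exponents by one multiplies each row of the alternant by its variable, hence the
determinant by x_1 ⋯ x_n. -/
theorem schurRows_add_one (n : ℕ) (f : ℕ → ℕ) :
    schurRows n (fun i => f i + 1) = schurRows n (fun _ => 1) * schurRows n f := by
  have key : ∀ a : Fin n → ℕ, alternant n (fun j => a j + 1) = (∏ i, X i) * alternant n a := by
    intro a
    rw [alternant, alternant, ← Matrix.det_mul_column]
    congr 1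
    ext1 i j
    simp [pow_succ, mul_comm]
  have h1 : ((schurRows n fun _ => 1) : MvPolynomial (Fin n) ℚ) = ∏ i, X i := by
    apply mul_right_cancel₀ (alternant_delta_ne_zero n)
    rw [schurRows_spec, ← key]
    congr 1
    ext j
    ring
  refine (eq_schurRows ?_).symm
  rw [MulMemClass.coe_mul, mul_assoc, schurRows_spec, h1, ← key]
  congr 1
  ext j
  ring

/-! ### Two columns -/

/-- The row lengths of the diagram with columns of lengths `a` and `b`. -/
def twoColumns (a b i : ℕ) : ℕ := (if i < a then 1 else 0) + if i < b then 1 else 0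

theorem eq_range_of_succ_mem {K : Finset ℕ} (h : ∀ i, i + 1 ∈ K → i ∈ K) :
    K = Finset.range K.card := by
  have hlow : ∀ i j, i ≤ j → j ∈ K → i ∈ K := by
    intro i j hij
    induction j, hij using Nat.le_induction with
    | base => exact id
    | succ j _ ih => exact fun hj => ih (h j hj)
  obtain ⟨m, hm⟩ : ∃ m, K = Finset.range m := by
    have hex : ∃ m, m ∉ K := Infinite.exists_notMem_finset K
    classical
    refine ⟨Nat.find hex, ?_⟩
    ext i
    rw [Finset.mem_range]
    constructor
    · intro hi
      by_contra hc
      exact Nat.find_spec hex (hlow _ i (by omega) hi)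
    · intro hi
      exact not_not.1 (Nat.find_min hex hi)
  rw [hm, Finset.card_range]

/-- A set of rows survives only if it consists of an initial segment of the rows below `p` and an
initial segment of the rows from `p` on; otherwise some row exceeds its predecessor by one and the
term vanishes. If the first segment has length `a`, the result has columns `p + q - a` and `a`. -/
theorem elem_mul_schurRows_column {n p : ℕ} (q : ℕ) (hp : p ≤ n) :
    elem n q * schurRows n (twoColumns p 0) =
      ∑ a ∈ (Finset.range (q + 1)).filter (fun a => a ≤ p ∧ p + q - a ≤ n),
        schurRows n (twoColumns a (p + q - a)) := by
  rw [elem_mul_schurRows]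
  set J : ℕ → Finset ℕ := fun a => Finset.range a ∪ Finset.Ico p (p + q - a) with hJ
  have hrows : ∀ a ∈ (Finset.range (q + 1)).filter (fun a => a ≤ p ∧ p + q - a ≤ n),
      schurRows n (twoColumns a (p + q - a)) = schurRows n (addRows (twoColumns p 0) (J a)) := by
    intro a ha
    simp only [Finset.mem_filter, Finset.mem_range] at ha
    refine schurRows_congr fun i _ => ?_
    simp only [twoColumns, addRows, hJ, Finset.mem_union, Finset.mem_range, Finset.mem_Ico]
    split_ifs <;> omega
  have hcard : ∀ a, a ≤ p → a ≤ q → (J a).card = q := by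
    intro a h1 h2
    rw [Finset.card_union_of_disjoint, Finset.card_range, Nat.card_Ico]
    · omega
    · rw [Finset.disjoint_left]
      intro x h3 h4
      rw [Finset.mem_range] at h3
      rw [Finset.mem_Ico] at h4
      omega
  rw [Finset.sum_congr rfl hrows]
  have hinj : Set.InjOn J ↑((Finset.range (q + 1)).filter (fun a => a ≤ p ∧ p + q - a ≤ n)) := by
    intro a ha b hb hab
    simp only [Finset.coe_filter, Finset.mem_range, Set.mem_ofPred_eq] at ha hb
    by_contra hne
    rcases Nat.lt_or_gt_of_ne hne with h | h
    · have : a ∈ J a := by rw [hab]; simp [hJ, h]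
      simp [hJ] at this
      omega
    · have : b ∈ J b := by rw [← hab]; simp [hJ, h]
      simp [hJ] at this
      omega
  rw [← Finset.sum_image (f := fun I => schurRows n (addRows (twoColumns p 0) I)) hinj]
  symm
  refine Finset.sum_subset ?_ ?_
  · intro I hI
    obtain ⟨a, ha, rfl⟩ := Finset.mem_image.1 hI
    simp only [Finset.mem_filter, Finset.mem_range] at ha
    rw [Finset.mem_powersetCard]
    refine ⟨?_, hcard a ha.2.1 (by omega)⟩
    intro x hx
    simp only [hJ, Finset.mem_union, Finset.mem_range, Finset.mem_Ico] at hx ⊢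
    omega
  · intro I hI hIJ
    rw [Finset.mem_powersetCard] at hI
    by_contra hne
    have hstep : ∀ i, i + 1 ∈ I → i + 1 ≠ p → i ∈ I := by
      intro i hi hip
      by_contra hc
      have := Finset.mem_range.1 (hI.1 hi)
      refine hne (schurRows_eq_zero this ?_)
      simp only [addRows, twoColumns, hi, hc, if_true, if_false]
      split_ifs <;> omega
    refine hIJ (Finset.mem_image.2 ?_)
    have h1 := eq_range_of_succ_mem (K := I.filter (· < p)) (by
      intro i hi
      rw [Finset.mem_filter] at hi ⊢
      exact ⟨hstep i hi.1 (by omega), by omega⟩)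
    have h2 := eq_range_of_succ_mem (K := (Finset.range n).filter (fun i => p + i ∈ I)) (by
      intro i hi
      rw [Finset.mem_filter, Finset.mem_range] at hi ⊢
      exact ⟨by omega, hstep (p + i) hi.2 (by omega)⟩)
    set a := (I.filter (· < p)).card
    set b := ((Finset.range n).filter (fun i => p + i ∈ I)).card
    have m1 : ∀ i, i < a ↔ i ∈ I ∧ i < p := by
      intro i
      rw [← Finset.mem_range, ← h1, Finset.mem_filter]
    have m2 : ∀ i, i < b ↔ p + i ∈ I := by
      intro i
      rw [← Finset.mem_range, ← h2, Finset.mem_filter, Finset.mem_range, and_iff_right_iff_imp]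
      intro hi
      have := Finset.mem_range.1 (hI.1 hi)
      omega
    have hap : a ≤ p := by
      by_contra hc
      have := (m1 p).1 (by omega)
      omega
    have hIab : I = Finset.range a ∪ Finset.Ico p (p + b) := by
      ext i
      simp only [Finset.mem_union, Finset.mem_range, Finset.mem_Ico]
      have e1 := m1 i
      have e2 := m2 (i - p)
      by_cases hip : i < p
      · simp only [hip, and_true] at e1
        rw [← e1]
        omega
      · rw [Nat.add_sub_cancel' (by omega)] at e2
        rw [← e2]
        omega
    have hq : a + b = q := by
      rw [← hI.2, hIab, Finset.card_union_of_disjoint, Finset.card_range, Nat.card_Ico]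
      · omega
      · rw [Finset.disjoint_left]
        intro x h3 h4
        rw [Finset.mem_range] at h3
        rw [Finset.mem_Ico] at h4
        omega
    have hpb : p + b ≤ n := by
      rcases Nat.eq_zero_or_pos b with hb | hb
      · omega
      · have := Finset.mem_range.1 (hI.1 ((m2 (b - 1)).1 (by omega)))
        omega
    refine ⟨a, ?_, ?_⟩
    · simp only [Finset.mem_filter, Finset.mem_range]
      omega
    · simp only [hJ]
      rw [hIab]
      congr 2
      omega

theorem schurRows_column {n p : ℕ} (hp : p ≤ n) : schurRows n (twoColumns p 0) = elem n p := by
  have h := elem_mul_schurRows_column (n := n) (p := 0) p (Nat.zero_le n)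
  have h0 : schurRows n (twoColumns 0 0) = 1 := by
    rw [← schurRows_zero]
    exact schurRows_congr fun i _ => by simp [twoColumns]
  rw [h0, mul_one] at h
  rw [h, Finset.sum_eq_single 0]
  · exact schurRows_congr fun i _ => by simp [twoColumns]
  · intro a ha ha0
    simp only [Finset.mem_filter] at ha
    omega
  · intro h
    simp only [Finset.mem_filter, Finset.mem_range] at h
    omega

theorem elem_eq_zero {n r : ℕ} (h : n < r) : elem n r = 0 := by
  apply Subtype.ext
  simp only [elem, esymm, ZeroMemClass.coe_zero]
  rw [Finset.powersetCard_eq_empty.2 (by simpa using h), Finset.sum_empty]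

/-- The dual Jacobi–Trudi formula for two columns. -/
theorem schurRows_twoColumns {n p q : ℕ} (hp : p ≤ n) (hqp : q + 1 ≤ p) :
    schurRows n (twoColumns (q + 1) p) = elem n p * elem n (q + 1) - elem n (p + 1) * elem n q := by
  have h1 := elem_mul_schurRows_column (q + 1) hp
  rw [schurRows_column hp] at h1
  -- Both products run over the same shapes, with a ≤ q+1 in the first and a ≤ q here, so that only
  -- a = q+1 remains in the difference. If p+1 > n, the product is zero and no shape with a ≤ q has
  -- at most n rows.
  have h2 : elem n (p + 1) * elem n q =
      ∑ a ∈ (Finset.range (q + 1)).filter (fun a => a ≤ p ∧ p + (q + 1) - a ≤ n),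
        schurRows n (twoColumns a (p + (q + 1) - a)) := by
    rcases Nat.lt_or_ge n (p + 1) with h | h
    · rw [elem_eq_zero h, zero_mul, Finset.filter_eq_empty_iff.2, Finset.sum_empty]
      intro a ha
      rw [Finset.mem_range] at ha
      omega
    · rw [mul_comm, ← schurRows_column h, elem_mul_schurRows_column q h]
      refine Finset.sum_congr ?_ fun a _ => ?_
      · ext a
        simp only [Finset.mem_filter, Finset.mem_range]
        omega
      · rw [add_right_comm, add_assoc]
  rw [mul_comm (elem n p), h1, h2, Finset.range_add_one (n := q + 1), Finset.filter_insert,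
    if_pos (by omega), Finset.sum_insert (by simp), Nat.add_sub_cancel, add_sub_cancel_right]

/-! ### Alternating functionals -/

/-- The lattice of translations by `c (1, …, 1) + N v`, where the coordinates of `v` sum to `0`. -/
def translations (n : ℕ) (N : ℤ) : AddSubgroup (Fin n → ℤ) where
  carrier := {d | ∃ (c : ℤ) (v : Fin n → ℤ), ∑ i, v i = 0 ∧ ∀ i, d i = c + N * v i}
  zero_mem' := ⟨0, 0, by simp, by simp⟩
  add_mem' := by
    rintro d d' ⟨c, v, hv, hd⟩ ⟨c', v', hv', hd'⟩
    refine ⟨c + c', v + v', by simp [Finset.sum_add_distrib, hv, hv'], fun i => ?_⟩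
    simp only [Pi.add_apply, hd, hd']
    ring
  neg_mem' := by
    rintro d ⟨c, v, hv, hd⟩
    refine ⟨-c, -v, by simp [hv], fun i => ?_⟩
    simp only [Pi.neg_apply, hd]
    ring

theorem comp_mem_translations {n : ℕ} {N : ℤ} {d : Fin n → ℤ} (σ : Equiv.Perm (Fin n)) :
    d ∘ σ ∈ translations n N ↔ d ∈ translations n N := by
  have key : ∀ (d : Fin n → ℤ) (σ : Equiv.Perm (Fin n)),
      d ∈ translations n N → d ∘ σ ∈ translations n N := by
    rintro d σ ⟨c, v, hv, hd⟩
    exact ⟨c, v ∘ σ, by rw [← hv]; exact Equiv.sum_comp σ v, fun i => hd (σ i)⟩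
  refine ⟨fun h => ?_, key d σ⟩
  simpa [Function.comp_assoc] using key _ σ⁻¹ h

open Classical in
/-- The signed number of permutations that take `b` to `m` up to a translation. -/
noncomputable def orbitSum {n : ℕ} (N : ℤ) (b m : Fin n → ℤ) : ℚ :=
  ∑ σ : Equiv.Perm (Fin n),
    ((Equiv.Perm.sign σ : ℤ) : ℚ) * if m - b ∘ σ ∈ translations n N then 1 else 0

theorem orbitSum_comp {n : ℕ} (N : ℤ) (b m : Fin n → ℤ) (σ : Equiv.Perm (Fin n)) :
    orbitSum N b (m ∘ σ) = ((Equiv.Perm.sign σ : ℤ) : ℚ) * orbitSum N b m := by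
  classical
  unfold orbitSum
  rw [Finset.mul_sum, ← Equiv.sum_comp (Equiv.mulRight σ)]
  refine Finset.sum_congr rfl fun τ _ => ?_
  have : m ∘ σ - b ∘ (Equiv.mulRight σ τ : Equiv.Perm (Fin n)) = (m - b ∘ τ) ∘ σ := by
    ext i; simp
  simp only [this, comp_mem_translations]
  simp only [Equiv.coe_mulRight, Equiv.Perm.sign_mul, Units.val_mul, Int.cast_mul]
  ring

theorem orbitSum_add {n : ℕ} {N : ℤ} {d : Fin n → ℤ} (hd : d ∈ translations n N)
    (b m : Fin n → ℤ) : orbitSum N b (m + d) = orbitSum N b m := by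
  classical
  unfold orbitSum
  refine Finset.sum_congr rfl fun τ _ => ?_
  have : m + d - b ∘ τ = (m - b ∘ τ) + d := by ring
  simp only [this, AddSubgroup.add_mem_cancel_right _ hd]

/-- The linear functional on polynomials with the values `orbitSum` on monomials. -/
noncomputable def orbitFunctional {n : ℕ} (N : ℤ) (b : Fin n → ℤ) :
    MvPolynomial (Fin n) ℚ →ₗ[ℚ] ℚ :=
  (basisMonomials (Fin n) ℚ).constr ℚ fun m => orbitSum N b fun i => (m i : ℤ)

theorem orbitFunctional_monomial {n : ℕ} (N : ℤ) (b : Fin n → ℤ) (m : Fin n →₀ ℕ) :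
    orbitFunctional N b (monomial m 1) = orbitSum N b fun i => (m i : ℤ) := by
  have := (basisMonomials (Fin n) ℚ).constr_basis ℚ
    (fun m => orbitSum N b fun i => (m i : ℤ)) m
  rwa [coe_basisMonomials] at this

theorem xpow_eq_monomial {n : ℕ} (a : Fin n → ℕ) :
    xpow a = monomial (Finsupp.equivFunOnFinite.symm a) 1 := by
  rw [monomial_eq, map_one, one_mul, Finsupp.prod_fintype _ _ (by simp)]
  rfl

theorem orbitFunctional_rename {n : ℕ} (N : ℤ) (b : Fin n → ℤ) (σ : Equiv.Perm (Fin n))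
    (p : MvPolynomial (Fin n) ℚ) :
    orbitFunctional N b (rename σ p) =
      ((Equiv.Perm.sign σ : ℤ) : ℚ) * orbitFunctional N b p := by
  have : (orbitFunctional N b).comp (rename σ).toLinearMap =
      ((Equiv.Perm.sign σ : ℤ) : ℚ) • orbitFunctional N b := by
    refine (basisMonomials (Fin n) ℚ).ext fun m => ?_
    simp only [coe_basisMonomials, LinearMap.comp_apply, AlgHom.toLinearMap_apply,
      rename_monomial, orbitFunctional_monomial, LinearMap.smul_apply, smul_eq_mul]
    have : (fun i => ((Finsupp.mapDomain σ m) i : ℤ)) = (fun i => (m i : ℤ)) ∘ ⇑σ⁻¹ := by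
      ext i
      rw [Finsupp.mapDomain_equiv_apply]
      rfl
    rw [this, orbitSum_comp, Equiv.Perm.sign_inv]
  exact LinearMap.congr_fun this p

theorem orbitFunctional_mul_xpow {n : ℕ} {N : ℤ} (b : Fin n → ℤ) {a a' : Fin n → ℕ}
    (h : (fun i => (a i : ℤ) - a' i) ∈ translations n N) (p : MvPolynomial (Fin n) ℚ) :
    orbitFunctional N b (p * xpow a) = orbitFunctional N b (p * xpow a') := by
  have : (orbitFunctional N b).comp (LinearMap.mulRight ℚ (xpow a)) =
      (orbitFunctional N b).comp (LinearMap.mulRight ℚ (xpow a')) := by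
    refine (basisMonomials (Fin n) ℚ).ext fun m => ?_
    simp only [coe_basisMonomials, LinearMap.comp_apply, LinearMap.mulRight_apply,
      xpow_eq_monomial, monomial_mul, mul_one, orbitFunctional_monomial]
    rw [← orbitSum_add h b fun i => ((m + Finsupp.equivFunOnFinite.symm a') i : ℤ)]
    congr 1
    ext i
    simp
  exact LinearMap.congr_fun this p

/-- As `g` is symmetric and the functional alternates, the n! terms of the alternant contribute
equally. -/
theorem orbitFunctional_mul_alternant {n : ℕ} (N : ℤ) (b : Fin n → ℤ)
    (g : symmetricSubalgebra (Fin n) ℚ) (a : Fin n → ℕ) :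
    orbitFunctional N b (g * alternant n a) = n.factorial * orbitFunctional N b (g * xpow a) := by
  have : ∀ σ : Equiv.Perm (Fin n),
      orbitFunctional N b (g * (((Equiv.Perm.sign σ : ℤ) : MvPolynomial (Fin n) ℚ) *
        rename σ (xpow a))) = orbitFunctional N b (g * xpow a) := by
    intro σ
    have hg : rename σ (g : MvPolynomial (Fin n) ℚ) = g := g.2 σ
    have h1 : (g : MvPolynomial (Fin n) ℚ) * (((Equiv.Perm.sign σ : ℤ) : MvPolynomial (Fin n) ℚ) *
        rename σ (xpow a)) = ((Equiv.Perm.sign σ : ℤ) : ℚ) •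
          rename σ ((g : MvPolynomial (Fin n) ℚ) * xpow a) := by
      rw [map_mul, hg, smul_eq_C_mul, map_intCast]
      ring
    rw [h1, map_smul, orbitFunctional_rename, smul_eq_mul, ← mul_assoc, ← Int.cast_mul,
      ← Units.val_mul, Int.units_mul_self]
    simp
  rw [alternant_eq_sum, Finset.mul_sum, map_sum, Finset.sum_congr rfl fun σ _ => this σ]
  simp [Fintype.card_perm]

/-- Paired with x^δ, a factor s_f only replaces δ by f+δ; this is s_f a_δ = a_{f+δ} after cancelling
n!. -/
theorem orbitFunctional_mul_schurRows {n : ℕ} (N : ℤ) (b : Fin n → ℤ)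
    (g : symmetricSubalgebra (Fin n) ℚ) (f : ℕ → ℕ) :
    orbitFunctional N b ((g * schurRows n f : symmetricSubalgebra (Fin n) ℚ) * xpow (delta n)) =
      orbitFunctional N b (g * xpow fun j => f j + delta n j) := by
  have hn : (n.factorial : ℚ) ≠ 0 := by exact_mod_cast n.factorial_ne_zero
  apply mul_left_cancel₀ hn
  rw [← orbitFunctional_mul_alternant, ← orbitFunctional_mul_alternant, MulMemClass.coe_mul,
    mul_assoc, schurRows_spec]

theorem rowLen_column (n i : ℕ) : (column n).rowLen i = if i < n then 1 else 0 := by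
  have : ∀ j, j < (column n).rowLen i ↔ i < n ∧ j = 0 := by
    intro j
    rw [← YoungDiagram.mem_iff_lt_rowLen, ← YoungDiagram.mem_cells]
    simp [column, eq_comm]
  have h0 := this 0
  have h1 := this 1
  split_ifs <;> omega

theorem schur_column (n : ℕ) : schur n (column n) = schurRows n fun _ => 1 := by
  rw [schur_eq_schurRows]
  exact schurRows_congr fun i hi => by rw [rowLen_column, if_pos hi]

theorem rename_xpow_eq {n : ℕ} (a : Fin n → ℕ) (σ : Equiv.Perm (Fin n)) :
    rename σ (xpow a) = xpow (a ∘ ⇑σ⁻¹) := by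
  rw [rename_xpow, xpow, ← Equiv.prod_comp σ fun i => X i ^ (a ∘ ⇑σ⁻¹) i]
  simp

/-- The functionals vanish on the fusion ideal: `f + δ` lies on a wall for a border diagram `f`. -/
theorem orbitFunctional_eq_zero {n k : ℕ} (hn : 2 ≤ n) (b : Fin n → ℤ)
    {g : symmetricSubalgebra (Fin n) ℚ} (hg : g ∈ fusionIdeal n k) :
    orbitFunctional ((n : ℤ) + k) b (g * xpow (delta n)) = 0 := by
  suffices h : ∀ h : symmetricSubalgebra (Fin n) ℚ, orbitFunctional ((n : ℤ) + k) b
      ((h * g : symmetricSubalgebra (Fin n) ℚ) * xpow (delta n)) = 0 by simpa using h 1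
  refine Submodule.span_induction (p := fun g _ => ∀ h : symmetricSubalgebra (Fin n) ℚ,
    orbitFunctional ((n : ℤ) + k) b
      ((h * g : symmetricSubalgebra (Fin n) ℚ) * xpow (delta n)) = 0) ?_ ?_ ?_ ?_ hg
  · rintro _ (⟨κ, hκ, rfl⟩ | rfl) h
    · rw [schur_eq_schurRows, orbitFunctional_mul_schurRows]
      -- For a border diagram the first and last exponents differ by (k+1)+(n-1) = n+k. Exchanging
      -- them is therefore a translation of the lattice, and the value equals its own negative.
      set τ : Equiv.Perm (Fin n) := Equiv.swap ⟨0, by omega⟩ ⟨n - 1, by omega⟩ with hτ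
      have hne : (⟨0, by omega⟩ : Fin n) ≠ ⟨n - 1, by omega⟩ := by
        rw [Ne, Fin.mk.injEq]; omega
      have h1 := orbitFunctional_rename ((n : ℤ) + k) b τ
        (h * xpow fun j => κ.rowLen j + delta n j)
      have hh : rename τ (h : MvPolynomial (Fin n) ℚ) = h := h.2 τ
      rw [map_mul, hh, rename_xpow_eq, hτ, Equiv.Perm.sign_swap hne, Equiv.swap_inv] at h1
      rw [orbitFunctional_mul_xpow (a' := fun j => κ.rowLen j + delta n j)] at h1
      · simp at h1
        linarith
      · refine ⟨0, Pi.single ⟨n - 1, by omega⟩ 1 - Pi.single ⟨0, by omega⟩ 1, by simp,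
          fun i => ?_⟩
        have hk := hκ.2
        have hb : (κ.rowLen 0 : ℤ) = κ.rowLen (n - 1) + (k + 1) := by exact_mod_cast hk
        by_cases hi0 : i = ⟨0, by omega⟩
        · subst hi0
          have hn1 : ((n - (n - 1 + 1) : ℕ) : ℤ) = 0 := by omega
          simp [delta, Fin.val_rev, hne, hb]
          omega
        · by_cases hi1 : i = ⟨n - 1, by omega⟩
          · subst hi1
            simp [delta, Fin.val_rev, hne.symm, hb]
            omega
          · simp [Equiv.swap_apply_of_ne_of_ne hi0 hi1, hi0, hi1]
    -- The factor s_{(1^n)} raises all exponents by one, a translation with `c = 1` and `v = 0`.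
    · rw [schur_column, mul_sub, mul_one, AddSubgroupClass.coe_sub, sub_mul, map_sub,
        orbitFunctional_mul_schurRows, sub_eq_zero]
      refine orbitFunctional_mul_xpow b ⟨1, 0, by simp, fun i => ?_⟩ _
      simp
  · simp
  · intro x y _ _ hx hy h
    rw [mul_add, AddMemClass.coe_add, add_mul, map_add, hx, hy, add_zero]
  · intro a x _ hx h
    rw [smul_eq_mul, ← mul_assoc]
    exact hx _

/-- Two points of the alcove that are conjugate under the affine Weyl group coincide. -/
theorem orbitSum_alcove {n k : ℕ} (hn : 2 ≤ n) {f g : ℕ → ℕ} (hf : Antitone f) (hg : Antitone g)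
    (hf1 : f (n - 1) = 0) (hg1 : g (n - 1) = 0) (hfk : f 0 ≤ k) (hgk : g 0 ≤ k) :
    orbitSum ((n : ℤ) + k) (fun j : Fin n => ((g j + delta n j : ℕ) : ℤ))
      (fun j : Fin n => ((f j + delta n j : ℕ) : ℤ)) = open Classical in
        if ∀ i < n, f i = g i then 1 else 0 := by
  have key : ∀ σ : Equiv.Perm (Fin n), (fun j : Fin n => ((f j + delta n j : ℕ) : ℤ)) -
      (fun j : Fin n => ((g j + delta n j : ℕ) : ℤ)) ∘ σ ∈ translations n ((n : ℤ) + k) ↔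
      σ = 1 ∧ ∀ i < n, f i = g i := by
    intro σ
    constructor
    · rintro ⟨c, v, hv, h⟩
      have hbound : ∀ {f : ℕ → ℕ}, Antitone f → f (n - 1) = 0 → f 0 ≤ k → ∀ i : Fin n,
          0 ≤ ((f i + delta n i : ℕ) : ℤ) ∧ ((f i + delta n i : ℕ) : ℤ) < n + k := by
        intro f hf hf1 hfk i
        have h1 := hf (Nat.zero_le (i : ℕ))
        have h2 := i.2
        simp only [delta, Fin.val_rev]
        omega
      have hdec : ∀ {f : ℕ → ℕ}, Antitone f → ∀ i j : Fin n, i < j →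
          ((f j + delta n j : ℕ) : ℤ) < ((f i + delta n i : ℕ) : ℤ) := by
        intro f hf i j hij
        have h1 := hf (show (i : ℕ) ≤ j from hij.le)
        have h2 := j.2
        have h3 : (i : ℕ) < j := hij
        simp only [delta, Fin.val_rev]
        omega
      -- All coordinates of both points lie in [0, n+k), so the translation parts at two places
      -- differ by less than 2(n+k).
      have hv1 : ∀ i j, v i ≤ v j + 1 := by
        intro i j
        by_contra hc
        have h1 := h i
        have h2 := h j
        simp only [Pi.sub_apply, Function.comp_apply] at h1 h2
        have a1 := hbound hf hf1 hfk i
        have a2 := hbound hf hf1 hfk j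
        have a3 := hbound hg hg1 hgk (σ i)
        have a4 := hbound hg hg1 hgk (σ j)
        have : ((n : ℤ) + k) * (v i - v j) ≥ ((n : ℤ) + k) * 2 :=
          mul_le_mul_of_nonneg_left (by omega) (by omega)
        rw [mul_sub] at this
        omega
      -- Integers with sum zero that exceed their minimum by at most one are all zero.
      have hv0 : ∀ i, v i = 0 := by
        obtain ⟨m, -, hm⟩ := Finset.univ.exists_min_image v ⟨(⟨0, by omega⟩ : Fin n), by simp⟩
        have hm' : ∀ i, v m ≤ v i := fun i => hm i (Finset.mem_univ i)
        have s1 : ∑ i : Fin n, v m ≤ ∑ i, v i := Finset.sum_le_sum fun i _ => hm' i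
        have s2 : ∑ i, v i < ∑ i : Fin n, (v m + 1) :=
          Finset.sum_lt_sum (fun i _ => hv1 i m) ⟨m, Finset.mem_univ m, by omega⟩
        rw [hv] at s1 s2
        simp only [Finset.sum_const, Finset.card_univ, Fintype.card_fin, nsmul_eq_mul] at s1 s2
        have hm0 : v m = 0 := by
          have t1 : v m ≤ 0 := by
            by_contra hc
            have : (0 : ℤ) < n * v m := mul_pos (by omega) (by omega)
            omega
          have t2 : 0 < v m + 1 := by
            by_contra hc
            have : (n : ℤ) * (v m + 1) ≤ 0 := mul_nonpos_of_nonneg_of_nonpos (by omega) (by omega)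
            omega
          omega
        have hnn : ∀ i ∈ Finset.univ, 0 ≤ v i := fun i _ => hm0 ▸ hm' i
        intro i
        exact (Finset.sum_eq_zero_iff_of_nonneg hnn).1 hv i (Finset.mem_univ i)
      have h' : ∀ i : Fin n, ((f i + delta n i : ℕ) : ℤ) =
          ((g (σ i) + delta n (σ i) : ℕ) : ℤ) + c := by
        intro i
        have := h i
        simp only [Pi.sub_apply, Function.comp_apply, hv0, mul_zero, add_zero] at this
        omega
      -- Both points are strictly decreasing and a common shift keeps the order, so σ is an order
      -- automorphism of `Fin n`, hence the identity. The vanishing last rows then give `c = 0`.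
      have hmono : StrictMono σ := by
        intro i j hij
        have h1 := hdec hf i j hij
        rw [h' i, h' j] at h1
        by_contra hc
        rcases (not_lt.1 hc).lt_or_eq with h2 | h2
        · have := hdec hg _ _ h2
          omega
        · rw [h2] at h1
          omega
      have hσ : σ = 1 := by
        ext i
        have : (⟨σ, hmono.le_iff_le⟩ : Fin n ≃o Fin n) = OrderIso.refl _ := Subsingleton.elim _ _
        exact congrArg Fin.val (DFunLike.congr_fun this i)
      refine ⟨hσ, fun i hi => ?_⟩
      have e1 := h' ⟨i, hi⟩
      have e2 := h' ⟨n - 1, by omega⟩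
      simp only [hσ, Equiv.Perm.coe_one, id_eq, hf1, hg1] at e1 e2
      omega
    · rintro ⟨rfl, h⟩
      convert (translations n ((n : ℤ) + k)).zero_mem using 1
      ext i
      simp [h i i.2]
  classical
  unfold orbitSum
  simp only [key]
  by_cases hfg : ∀ i < n, f i = g i
  · simp only [eq_true hfg, and_true, if_true]
    simp
  · simp only [hfg, and_false, if_false]
    simp

/-! ### The basis of the fusion algebra -/

/-- The class of `a_{f+δ} / a_δ` in the fusion algebra. -/
noncomputable def rowClass (n k : ℕ) (f : ℕ → ℕ) : FusionAlgebra n k :=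
  Ideal.Quotient.mk (fusionIdeal n k) (schurRows n f)

/-- The class of an elementary symmetric polynomial in the fusion algebra. -/
noncomputable def elemClass (n k r : ℕ) : FusionAlgebra n k :=
  Ideal.Quotient.mk (fusionIdeal n k) (elem n r)

theorem rowClass_congr {n k : ℕ} {f g : ℕ → ℕ} (h : ∀ i < n, f i = g i) :
    rowClass n k f = rowClass n k g := by
  rw [rowClass, schurRows_congr h, rowClass]

theorem rowClass_one (n k : ℕ) : rowClass n k (fun _ => 1) = 1 := by
  rw [rowClass, ← schur_column, ← sub_eq_zero, ← map_one (Ideal.Quotient.mk _), ← map_sub,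
    Ideal.Quotient.eq_zero_iff_mem]
  exact Ideal.subset_span (Or.inr rfl)

theorem rowClass_add (n k c : ℕ) (f : ℕ → ℕ) :
    rowClass n k (fun i => f i + c) = rowClass n k f := by
  induction c with
  | zero => rfl
  | succ c ih =>
    rw [← ih]
    have h := schurRows_add_one n fun i => f i + c
    simp only [add_assoc] at h
    rw [rowClass, h, map_mul]
    change rowClass n k (fun _ => 1) * _ = _
    rw [rowClass_one, one_mul]
    rfl

theorem rowClass_border {n k : ℕ} {f : ℕ → ℕ} (hf : Antitone f) (h0 : ∀ i, n ≤ i → f i = 0)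
    (h : f 0 = f (n - 1) + (k + 1)) : rowClass n k f = 0 := by
  rw [rowClass, Ideal.Quotient.eq_zero_iff_mem]
  refine Ideal.subset_span (Or.inl ⟨ofRows n f hf, ⟨?_, ?_⟩, ?_⟩)
  · rw [colLen_le_iff, rowLen_ofRows hf h0, h0 n le_rfl]
  · rw [rowLen_ofRows hf h0, rowLen_ofRows hf h0, h]
  · rw [schur_eq_schurRows]
    exact schurRows_congr fun i _ => rowLen_ofRows hf h0 i

open Classical in
/-- The Pieri rule in the fusion algebra. -/
theorem elemClass_mul_rowClass {n k : ℕ} (r : ℕ) {f : ℕ → ℕ} (hf : IsRestricted n k f) :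
    elemClass n k r * rowClass n k f =
      ∑ I ∈ ((Finset.range n).powersetCard r).filter fun I => IsRestricted n k (addRows f I),
        rowClass n k (addRows f I) := by
  rw [elemClass, rowClass, ← map_mul, elem_mul_schurRows, map_sum, Finset.sum_filter]
  refine Finset.sum_congr rfl fun I hI => ?_
  have hI := (Finset.mem_powersetCard.1 hI).1
  split_ifs with h
  · rfl
  change rowClass n k (addRows f I) = 0
  have h0 : ∀ i, n ≤ i → addRows f I i = 0 := by
    intro i hi
    have : i ∉ I := fun h => by have := Finset.mem_range.1 (hI h); omega
    simp [addRows, this, hf.eq_zero i hi]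
  -- If the result is a partition, its first row exceeds the bound by exactly one, since a strip
  -- adds at most one box there: a border diagram. Otherwise some row exceeds the one above it by
  -- exactly one, and two exponents coincide.
  by_cases hanti : Antitone (addRows f I)
  · refine rowClass_border hanti h0 ?_
    have h1 : ¬ addRows f I 0 ≤ addRows f I (n - 1) + k := fun h1 => h ⟨hanti, h0, h1⟩
    have h2 := hf.le_add
    simp only [addRows] at h1 ⊢
    split_ifs at h1 ⊢ <;> omega
  · obtain ⟨i, hi⟩ : ∃ i, addRows f I i < addRows f I (i + 1) := by
      by_contra hc
      push Not at hc
      exact hanti (antitone_nat_of_succ_le hc)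
    have h1 := hf.antitone (Nat.le_succ i)
    have h2 : i + 1 ∈ I := by
      by_contra hc
      simp only [addRows, hc, if_false] at hi
      split_ifs at hi <;> simp only [Nat.succ_eq_add_one] at h1 <;> omega
    rw [rowClass, schurRows_eq_zero (Finset.mem_range.1 (hI h2)), map_zero]
    simp only [addRows, h2, if_true, Nat.succ_eq_add_one] at hi h1 ⊢
    split_ifs at hi ⊢ <;> omega

theorem rowLen_dropColumns (c : ℕ) (κ : YoungDiagram) (i : ℕ) :
    (dropColumns c κ).rowLen i = κ.rowLen i - c := by
  have : ∀ j, j < (dropColumns c κ).rowLen i ↔ j + c < κ.rowLen i := by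
    intro j
    rw [← YoungDiagram.mem_iff_lt_rowLen, mem_dropColumns, YoungDiagram.mem_iff_lt_rowLen]
  have h1 := this (κ.rowLen i - c)
  have h2 := this ((dropColumns c κ).rowLen i)
  have h3 := this ((dropColumns c κ).rowLen i - 1)
  have h4 := this (κ.rowLen i - c - 1)
  omega

/-- A full column is multiplication by s_{(1^n)}, whose class is 1, so only the differences of row
lengths matter. -/
theorem rowClass_eq_reduce {n k : ℕ} {f : ℕ → ℕ} (hf : IsRestricted n k f)
    (κ : restricted n k) (hκ : ∀ i, κ.1.rowLen i = f i) :
    rowClass n k f = schurClass n k (reduce κ : reduced n k).1 := by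
  change _ = rowClass n k (dropColumns (κ.1.rowLen (n - 1)) κ.1).rowLen
  rw [← rowClass_add n k (f (n - 1)) (YoungDiagram.rowLen _)]
  refine rowClass_congr fun i hi => ?_
  have := hf.antitone (show i ≤ n - 1 by omega)
  rw [rowLen_dropColumns, hκ, hκ]
  omega

/-- The restricted diagram with given row lengths. -/
def IsRestricted.diagram {n k : ℕ} {f : ℕ → ℕ} (hf : IsRestricted n k f) : restricted n k :=
  ⟨ofRows n f hf.antitone, by
    rw [mem_restricted_iff, funext (rowLen_ofRows hf.antitone hf.eq_zero)]
    exact hf⟩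

theorem IsRestricted.rowLen_diagram {n k : ℕ} {f : ℕ → ℕ} (hf : IsRestricted n k f) (i : ℕ) :
    hf.diagram.1.rowLen i = f i := rowLen_ofRows hf.antitone hf.eq_zero i

theorem rowLen_of_mem_reduced {n k : ℕ} (hn : 2 ≤ n) {κ : YoungDiagram} (hκ : κ ∈ reduced n k) :
    IsRestricted n k κ.rowLen ∧ κ.rowLen (n - 1) = 0 ∧ κ.rowLen 0 ≤ k := by
  have h1 := rowLen_eq_zero hκ.1
  have h2 := hκ.2
  exact ⟨⟨fun i j hij => κ.rowLen_anti i j hij, fun i hi => h1 i (by omega), by omega⟩,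
    h1 _ le_rfl, h2⟩

-- The functional attached to κ+δ is dual to the class of κ among the reduced partitions: their
-- points lie in one alcove, so no two of them are conjugate.
open Classical in
theorem orbitFunctional_schur {n k : ℕ} (hn : 2 ≤ n) (κ κ' : reduced n k) :
    orbitFunctional ((n : ℤ) + k) (fun j : Fin n => ((κ.1.rowLen j + delta n j : ℕ) : ℤ))
      (schur n κ'.1 * xpow (delta n)) = if κ' = κ then 1 else 0 := by
  obtain ⟨h1, h2, h3⟩ := rowLen_of_mem_reduced hn κ.2
  obtain ⟨h1', h2', h3'⟩ := rowLen_of_mem_reduced hn κ'.2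
  have h := orbitFunctional_mul_schurRows ((n : ℤ) + k)
    (fun j : Fin n => ((κ.1.rowLen j + delta n j : ℕ) : ℤ)) 1 κ'.1.rowLen
  rw [one_mul, OneMemClass.coe_one, one_mul,
    xpow_eq_monomial (fun j : Fin n => κ'.1.rowLen j + delta n j), orbitFunctional_monomial] at h
  rw [schur_eq_schurRows, h]
  refine (orbitSum_alcove hn h1'.antitone h1.antitone h2' h2 h3' h3).trans ?_
  congr 1
  rw [eq_iff_iff, Subtype.ext_iff]
  refine ⟨fun h => youngDiagram_ext fun i => ?_, fun h i _ => by rw [h]⟩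
  rcases Nat.lt_or_ge i n with hi | hi
  · exact h i hi
  · rw [h1'.eq_zero i hi, h1.eq_zero i hi]

theorem linearIndependent_schurClass {n k : ℕ} (hn : 2 ≤ n) :
    LinearIndependent ℚ fun κ : reduced n k => schurClass n k κ := by
  classical
  rw [linearIndependent_iff']
  intro s c hc κ hκ
  have hmem : ∑ κ ∈ s, c κ • schur n κ ∈ fusionIdeal n k := by
    rw [← Ideal.Quotient.eq_zero_iff_mem, ← Ideal.Quotient.mkₐ_eq_mk ℚ, map_sum, ← hc]
    refine Finset.sum_congr rfl fun κ _ => ?_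
    rw [map_smul]
    rfl
  have h0 := orbitFunctional_eq_zero hn
    (fun j : Fin n => ((κ.1.rowLen j + delta n j : ℕ) : ℤ)) hmem
  rw [AddSubmonoidClass.coe_finsetSum, Finset.sum_mul, map_sum] at h0
  simp only [SetLike.val_smul, smul_mul_assoc, map_smul, orbitFunctional_schur hn κ, smul_eq_mul,
    mul_ite, mul_one, mul_zero, Finset.sum_ite_eq', hκ, if_true] at h0
  exact h0

/-- The span contains 1 and is stable under the elementary symmetric polynomials by the Pieri rule;
these generate all symmetric polynomials. -/
theorem span_schurClass {n k : ℕ} (hn : 2 ≤ n) :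
    ⊤ ≤ Submodule.span ℚ (Set.range fun κ : reduced n k => schurClass n k κ) := by
  set S := Submodule.span ℚ (Set.range fun κ : reduced n k => schurClass n k κ) with hS
  have hres : ∀ f, IsRestricted n k f → rowClass n k f ∈ S := by
    intro f hf
    rw [rowClass_eq_reduce hf hf.diagram hf.rowLen_diagram]
    exact Submodule.subset_span ⟨_, rfl⟩
  have helem : ∀ r, ∀ x ∈ S, elemClass n k r * x ∈ S := by
    intro r x hx
    refine Submodule.span_induction ?_ ?_ ?_ ?_ hx
    · rintro _ ⟨κ, rfl⟩
      change _ * rowClass n k κ.1.rowLen ∈ S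
      rw [elemClass_mul_rowClass r (rowLen_of_mem_reduced hn κ.2).1]
      refine Submodule.sum_mem _ fun I hI => hres _ ?_
      classical
      exact (Finset.mem_filter.1 hI).2
    · simp
    · intro x y _ _ hx hy
      rw [mul_add]
      exact S.add_mem hx hy
    · intro c x _ hx
      have h : elemClass n k r * c • x = c • (elemClass n k r * x) := Algebra.mul_smul_comm c _ x
      rw [h]
      exact S.smul_mem c hx
  have hall : ∀ P : MvPolynomial (Fin n) ℚ, ∀ x ∈ S,
      Ideal.Quotient.mk (fusionIdeal n k) (esymmAlgHom (Fin n) ℚ n P) * x ∈ S := by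
    intro P
    induction P using MvPolynomial.induction_on with
    | C c =>
      intro x hx
      rw [← MvPolynomial.algebraMap_eq, AlgHom.commutes, ← Ideal.Quotient.mkₐ_eq_mk ℚ,
        AlgHom.commutes, ← Algebra.smul_def]
      exact S.smul_mem c hx
    | add P Q hP hQ =>
      intro x hx
      rw [map_add, map_add, add_mul]
      exact S.add_mem (hP x hx) (hQ x hx)
    | mul_X P i hP =>
      intro x hx
      rw [map_mul, map_mul, mul_assoc]
      refine hP _ ?_
      have : esymmAlgHom (Fin n) ℚ n (X i) = elem n (i + 1) := by simp [esymmAlgHom, elem]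
      rw [this]
      exact helem _ x hx
  have hone : (1 : FusionAlgebra n k) ∈ S := by
    have := hres (fun _ => 0) ⟨fun _ _ _ => le_rfl, fun _ _ => rfl, by simp⟩
    rwa [rowClass, schurRows_zero, map_one] at this
  intro x _
  obtain ⟨g, rfl⟩ := Ideal.Quotient.mk_surjective x
  obtain ⟨P, rfl⟩ := esymmAlgHom_surjective (σ := Fin n) ℚ (n := n) (by simp) g
  simpa using hall P 1 hone

/-- The basis of the fusion algebra by the classes of Schur polynomials. -/
noncomputable def schurBasis {n : ℕ} (k : ℕ) (hn : 2 ≤ n) :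
    Module.Basis (reduced n k) ℚ (FusionAlgebra n k) :=
  Module.Basis.mk (linearIndependent_schurClass hn) (span_schurClass hn)

theorem schurBasis_apply {n k : ℕ} (hn : 2 ≤ n) (κ : reduced n k) :
    schurBasis k hn κ = schurClass n k κ := by
  rw [schurBasis, Module.Basis.mk_apply]

/-! ### Fusion coefficients -/

theorem basis_repr_sum_apply {ι α M : Type*} [AddCommGroup M] [Module ℚ M]
    (b : Module.Basis ι ℚ M) (s : Finset α) (f : α → M) (i : ι) :
    b.repr (∑ x ∈ s, f x) i = ∑ x ∈ s, b.repr (f x) i := by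
  rw [map_sum, Finsupp.finsetSum_apply]

theorem basis_repr_sub_apply {ι M : Type*} [AddCommGroup M] [Module ℚ M]
    (b : Module.Basis ι ℚ M) (x y : M) (i : ι) :
    b.repr (x - y) i = b.repr x i - b.repr y i := by
  rw [map_sub, Finsupp.sub_apply]

-- Reduction forgets only the number of full columns. For partitions of the same size with equal
-- reductions this number agrees, because each full column contributes n boxes.
open Classical in
theorem repr_rowClass {n k : ℕ} (hn : 2 ≤ n) (nu : restricted n k) {g : ℕ → ℕ}
    (hg : IsRestricted n k g)
    (hsum : ∑ i ∈ Finset.range n, g i = ∑ i ∈ Finset.range n, nu.1.rowLen i) :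
    (schurBasis k hn).repr (rowClass n k g) (reduce nu) = if g = nu.1.rowLen then 1 else 0 := by
  rw [rowClass_eq_reduce hg hg.diagram hg.rowLen_diagram, ← schurBasis_apply hn,
    Module.Basis.repr_self, Finsupp.single_apply]
  congr 1
  have hnu := mem_restricted_iff.1 nu.2
  rw [eq_iff_iff, Subtype.ext_iff]
  constructor
  · intro h
    have h1 : ∀ i, g i - g (n - 1) = nu.1.rowLen i - nu.1.rowLen (n - 1) := by
      intro i
      have := congrArg (fun κ => YoungDiagram.rowLen κ i) h
      simp only [reduce, rowLen_dropColumns, hg.rowLen_diagram] at this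
      exact this
    have h2 : ∀ i ∈ Finset.range n, g i + nu.1.rowLen (n - 1) =
        nu.1.rowLen i + g (n - 1) := by
      intro i hi
      rw [Finset.mem_range] at hi
      have a1 := hg.antitone (show i ≤ n - 1 by omega)
      have a2 := hnu.antitone (show i ≤ n - 1 by omega)
      have := h1 i
      omega
    have h3 := Finset.sum_congr rfl h2
    rw [Finset.sum_add_distrib, Finset.sum_add_distrib, hsum] at h3
    simp only [Finset.sum_const, Finset.card_range, smul_eq_mul] at h3
    have h4 : nu.1.rowLen (n - 1) = g (n - 1) :=
      Nat.eq_of_mul_eq_mul_left (by omega : 0 < n) (by omega)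
    funext i
    rcases Nat.lt_or_ge i n with hi | hi
    · have := h2 i (Finset.mem_range.2 hi)
      omega
    · rw [hg.eq_zero i hi, hnu.eq_zero i hi]
  · intro h
    have : hg.diagram = nu := Subtype.ext (youngDiagram_ext fun i => by
      rw [hg.rowLen_diagram, h])
    rw [this]

theorem sum_addRows {n : ℕ} {l : ℕ → ℕ} {I : Finset ℕ} (hI : I ⊆ Finset.range n) :
    ∑ i ∈ Finset.range n, addRows l I i = ∑ i ∈ Finset.range n, l i + I.card := by
  simp only [addRows]
  rw [Finset.sum_add_distrib, Finset.sum_ite_mem, Finset.inter_eq_right.2 hI]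
  simp

open Classical in
theorem card_filter_addRows_eq {n k q : ℕ} {g v : ℕ → ℕ} (hg : IsRestricted n k g)
    (hv : IsRestricted n k v)
    (hsum : ∑ i ∈ Finset.range n, v i = ∑ i ∈ Finset.range n, g i + q) :
    (((Finset.range n).powersetCard q).filter
      fun J => IsRestricted n k (addRows g J) ∧ addRows g J = v).card =
      if ∀ i, g i ≤ v i ∧ v i ≤ g i + 1 then 1 else 0 := by
  split_ifs with h
  · rw [Finset.card_eq_one]
    refine ⟨(Finset.range n).filter fun i => v i = g i + 1, ?_⟩
    have hJ : addRows g ((Finset.range n).filter fun i => v i = g i + 1) = v := by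
      funext i
      have h1 := h i
      have h2 := hg.eq_zero i
      have h3 := hv.eq_zero i
      simp only [addRows, Finset.mem_filter, Finset.mem_range]
      split_ifs <;> omega
    ext J
    rw [Finset.mem_filter, Finset.mem_powersetCard, Finset.mem_singleton]
    constructor
    · rintro ⟨⟨h1, -⟩, -, rfl⟩
      ext i
      have := @h1 i
      by_cases hi : i ∈ J <;> simp_all [addRows]
    · rintro rfl
      have h1 := sum_addRows (l := g)
        (Finset.filter_subset (fun i => v i = g i + 1) (Finset.range n))
      rw [hJ] at h1 ⊢
      exact ⟨⟨Finset.filter_subset _ _, by omega⟩, hv, rfl⟩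
  · rw [Finset.card_eq_zero, Finset.filter_eq_empty_iff]
    rintro J - ⟨-, rfl⟩
    refine h fun i => ?_
    simp only [addRows]
    split_ifs <;> omega

/-- In the twofold Pieri rule only the intermediate shape is free: the second strip consists of the
rows where ν exceeds it (`card_filter_addRows_eq`). -/
theorem repr_elemClass_mul {n k p q : ℕ} (hn : 2 ≤ n) (nu : restricted n k) {l : ℕ → ℕ}
    (hl : IsRestricted n k l)
    (hsum : ∑ i ∈ Finset.range n, nu.1.rowLen i = ∑ i ∈ Finset.range n, l i + (p + q)) :
    (schurBasis k hn).repr (elemClass n k q * (elemClass n k p * rowClass n k l)) (reduce nu) =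
      (midStrips n k p l nu.1.rowLen).card := by
  classical
  have hnu := mem_restricted_iff.1 nu.2
  rw [elemClass_mul_rowClass p hl, Finset.mul_sum, basis_repr_sum_apply]
  have hterm : ∀ I ∈ ((Finset.range n).powersetCard p).filter
      fun I => IsRestricted n k (addRows l I),
      (schurBasis k hn).repr (elemClass n k q * rowClass n k (addRows l I)) (reduce nu) =
      if ∀ i, addRows l I i ≤ nu.1.rowLen i ∧ nu.1.rowLen i ≤ addRows l I i + 1 then 1 else 0 := by
    intro I hI
    rw [Finset.mem_filter, Finset.mem_powersetCard] at hI
    have hs := sum_addRows (l := l) hI.1.1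
    have hs' : ∑ i ∈ Finset.range n, nu.1.rowLen i =
        ∑ i ∈ Finset.range n, addRows l I i + q := by omega
    have hc := card_filter_addRows_eq hI.2 hnu hs'
    rw [elemClass_mul_rowClass q hI.2, basis_repr_sum_apply, Finset.sum_congr rfl fun J hJ => repr_rowClass hn nu (Finset.mem_filter.1 hJ).2 (by
      rw [Finset.mem_filter, Finset.mem_powersetCard] at hJ
      rw [sum_addRows hJ.1.1, hs', hJ.1.2])]
    rw [Finset.sum_boole, Finset.filter_filter, hc]
    simp
  rw [Finset.sum_congr rfl hterm, Finset.sum_boole, Finset.filter_filter, midStrips]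

theorem rowLen_eq_twoColumns {mu : YoungDiagram} (h : mu.rowLen 0 ≤ 2) (i : ℕ) :
    mu.rowLen i = twoColumns (mu.colLen 1) (mu.colLen 0) i := by
  have h1 := mu.rowLen_anti 0 i (Nat.zero_le i)
  have h2 := @YoungDiagram.mem_iff_lt_colLen mu i 0
  have h3 := @YoungDiagram.mem_iff_lt_colLen mu i 1
  rw [YoungDiagram.mem_iff_lt_rowLen] at h2 h3
  simp only [twoColumns]
  split_ifs <;> omega

theorem card_eq_colLen_add {mu : YoungDiagram} (h : mu.rowLen 0 ≤ 2) :
    mu.card = mu.colLen 0 + mu.colLen 1 := by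
  have h1 := mu.colLen_anti 0 1 (Nat.zero_le 1)
  rw [card_eq_sum_rowLen le_rfl]
  simp only [rowLen_eq_twoColumns h, twoColumns]
  rw [Finset.sum_add_distrib, Finset.sum_boole, Finset.sum_boole]
  have : ∀ a ≤ mu.colLen 0, ((Finset.range (mu.colLen 0)).filter (· < a)) = Finset.range a := by
    intro a ha
    ext i
    simp only [Finset.mem_filter, Finset.mem_range]
    omega
  rw [this _ h1, this _ le_rfl, Finset.card_range, Finset.card_range, add_comm]
  simp

open Classical in
theorem fusionCoeff_eq_card {n k : ℕ} (hn : 2 ≤ n) (hk : 1 ≤ k) {lam mu : YoungDiagram}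
    (hlam : lam ∈ restricted n k) (nu : restricted n k) (hmu : mu.colLen 0 ≤ n)
    (hmu2 : mu.rowLen 0 ≤ 2) (hcard : nu.1.card = lam.card + mu.card) :
    fusionCoeff (schurBasis k hn) lam mu nu =
      ((midStrips n k (mu.colLen 0) lam.rowLen nu.1.rowLen).filter
        (IsFusionStrip n k lam.rowLen nu.1.rowLen)).card := by
  have hl := mem_restricted_iff.1 hlam
  have hv := mem_restricted_iff.1 nu.2
  have hqp := mu.colLen_anti 0 1 (Nat.zero_le 1)
  have hsum : ∑ i ∈ Finset.range n, nu.1.rowLen i =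
      ∑ i ∈ Finset.range n, lam.rowLen i + (mu.colLen 0 + mu.colLen 1) := by
    rw [← card_eq_sum_rowLen nu.2.1, ← card_eq_sum_rowLen hlam.1, hcard, card_eq_colLen_add hmu2]
  have hmain := card_midStrips_eq hn hk hl hv hqp hsum
  rw [fusionCoeff, if_pos hcard]
  have hsch : schurClass n k mu = rowClass n k (twoColumns (mu.colLen 1) (mu.colLen 0)) :=
    rowClass_congr fun i _ => rowLen_eq_twoColumns hmu2 i
  have hlamc : schurClass n k lam = rowClass n k lam.rowLen := rfl
  have e1 := repr_elemClass_mul hn nu hl hsum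
  rw [hsch, hlamc]
  rcases h : mu.colLen 1 with _ | q
  · rw [h] at hsum e1
    have h0 : rowClass n k (twoColumns 0 (mu.colLen 0)) = elemClass n k (mu.colLen 0) := by
      rw [elemClass, ← schurRows_column hmu]
      exact rowClass_congr fun i _ => by simp [twoColumns]
    have hz : elemClass n k 0 = 1 := by
      rw [elemClass, ← schurRows_column (Nat.zero_le n), ← map_one (Ideal.Quotient.mk _),
        ← schurRows_zero]
      exact rowClass_congr fun i _ => by simp [twoColumns]
    -- For an empty second column nothing is subtracted, in accordance with the fact that p+1 boxes
    -- do not fit into `ν / λ`.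
    have hempty : midStrips n k (mu.colLen 0 + 1) lam.rowLen nu.1.rowLen = ∅ := by
      rw [Finset.eq_empty_iff_forall_notMem]
      intro I hI
      rw [mem_midStrips] at hI
      have h1 := sum_addRows (l := lam.rowLen) hI.1.1
      have h2 : ∑ i ∈ Finset.range n, addRows lam.rowLen I i ≤
          ∑ i ∈ Finset.range n, nu.1.rowLen i := Finset.sum_le_sum fun i _ => (hI.2.2 i).1
      omega
    rw [hz, one_mul] at e1
    have hcomm : rowClass n k lam.rowLen * elemClass n k (mu.colLen 0) =
        elemClass n k (mu.colLen 0) * rowClass n k lam.rowLen := by ring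
    rw [h0, hcomm, e1, hmain, hempty]
    simp
  · rw [h] at hsum e1 hqp
    have e2 := repr_elemClass_mul (p := mu.colLen 0 + 1) (q := q) hn nu hl (by omega)
    have h0 : rowClass n k (twoColumns (q + 1) (mu.colLen 0)) =
        elemClass n k (mu.colLen 0) * elemClass n k (q + 1) -
          elemClass n k (mu.colLen 0 + 1) * elemClass n k q := by
      rw [rowClass, schurRows_twoColumns hmu hqp, map_sub, map_mul, map_mul]
      rfl
    have h1 : rowClass n k lam.rowLen * rowClass n k (twoColumns (q + 1) (mu.colLen 0)) =
        elemClass n k (q + 1) * (elemClass n k (mu.colLen 0) * rowClass n k lam.rowLen) -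
          elemClass n k q * (elemClass n k (mu.colLen 0 + 1) * rowClass n k lam.rowLen) := by
      rw [h0]
      ring
    rw [h1, basis_repr_sub_apply, e1, e2, hmain]
    push_cast
    ring

/-! ### Paths as chains of vertical strips -/

theorem rowLen_of_cells_eq_insert {κ κ' : YoungDiagram} {c : ℕ × ℕ} (hc : c ∉ κ.cells)
    (h : κ'.cells = insert c κ.cells) :
    (∀ r, κ'.rowLen r = κ.rowLen r + if r = c.1 then 1 else 0) ∧ c.2 = κ.rowLen c.1 := by
  obtain ⟨i, j⟩ := c
  have hmem : ∀ r s, s < κ'.rowLen r ↔ (r = i ∧ s = j) ∨ s < κ.rowLen r := by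
    intro r s
    rw [← YoungDiagram.mem_iff_lt_rowLen, ← YoungDiagram.mem_iff_lt_rowLen,
      ← YoungDiagram.mem_cells, h, Finset.mem_insert, Prod.mk.injEq, YoungDiagram.mem_cells]
  rw [YoungDiagram.mem_cells, YoungDiagram.mem_iff_lt_rowLen] at hc
  have hj : j = κ.rowLen i := by
    by_contra hne
    have h1 := (hmem i j).2 (Or.inl ⟨rfl, rfl⟩)
    have h2 := (hmem i (κ.rowLen i)).1 (by omega)
    omega
  refine ⟨fun r => ?_, hj⟩
  have h1 := hmem r (κ.rowLen r)
  have h2 := hmem r (κ'.rowLen r)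
  have h3 := hmem r (κ.rowLen r + 1)
  have h4 := hmem r (κ.rowLen r - 1)
  have h5 : r = i → κ.rowLen r = κ.rowLen i := fun h => by rw [h]
  simp only
  split_ifs <;> omega

theorem box_spec (P : LatticePath) (t : Fin P.length) :
    (∀ r, (P.toFun t.succ).rowLen r =
      (P.toFun t.castSucc).rowLen r + if r = (box P t).1 then 1 else 0) ∧
      (box P t).2 = (P.toFun t.castSucc).rowLen (box P t).1 :=
  rowLen_of_cells_eq_insert (Exists.choose_spec (P.step t)).1 (Exists.choose_spec (P.step t)).2

theorem rowLen_path (P : LatticePath) (r : ℕ) (i : Fin (P.length + 1)) :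
    (P.toFun i).rowLen r = P.head.rowLen r +
      (Finset.univ.filter fun t : Fin P.length => (t : ℕ) < i ∧ (box P t).1 = r).card := by
  induction i using Fin.induction with
  | zero => simp [RelSeries.head]
  | succ i ih =>
    rw [(box_spec P i).1, ih, add_assoc]
    congr 1
    split_ifs with h
    · have : (Finset.univ.filter fun t : Fin P.length => (t : ℕ) < i.succ ∧ (box P t).1 = r) =
          insert i (Finset.univ.filter fun t : Fin P.length =>
            (t : ℕ) < i.castSucc ∧ (box P t).1 = r) := by
        ext t
        simp only [Finset.mem_filter, Finset.mem_univ, true_and, Finset.mem_insert, Fin.val_succ,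
          Fin.val_castSucc, Fin.ext_iff]
        constructor
        · rintro ⟨h1, h2⟩
          by_cases h3 : (t : ℕ) = i
          · exact Or.inl h3
          · exact Or.inr ⟨by omega, h2⟩
        · rintro (h1 | ⟨h1, h2⟩)
          · rw [Fin.ext h1]
            exact ⟨by omega, h.symm⟩
          · exact ⟨by omega, h2⟩
      rw [this, Finset.card_insert_of_notMem (by simp)]
    · rw [add_zero]
      congr 1
      ext t
      simp only [Finset.mem_filter, Finset.mem_univ, true_and, Fin.val_succ, Fin.val_castSucc]
      refine ⟨fun ⟨h1, h2⟩ => ⟨by omega, h2⟩, fun ⟨h1, h2⟩ => ⟨?_, h2⟩⟩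
      have : (t : ℕ) ≠ i := fun h3 => h (by rw [← h2, Fin.ext h3])
      omega

/-- The rows of the boxes of the first `p` steps. -/
noncomputable def firstRows (P : LatticePath) (p : ℕ) : Finset ℕ :=
  (Finset.univ.filter fun t : Fin P.length => (t : ℕ) < p).image fun t => (box P t).1

/-- The rows of the boxes after the first `p` steps. -/
noncomputable def secondRows (P : LatticePath) (p : ℕ) : Finset ℕ :=
  (Finset.univ.filter fun t : Fin P.length => p ≤ (t : ℕ)).image fun t => (box P t).1

/-- The path adds boxes to `l` in the rows of `I` from top to bottom in the first `p` steps, and in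
the rows of `J` from top to bottom in the last `q` steps. -/
structure IsStripPath (P : LatticePath) (p q : ℕ) (l : ℕ → ℕ) (I J : Finset ℕ) : Prop where
  length : P.length = p + q
  first : ∀ t : Fin P.length, (t : ℕ) < p → (box P t).1 ∈ I ∧ (box P t).2 = l (box P t).1
  second : ∀ t : Fin P.length, p ≤ (t : ℕ) →
    (box P t).1 ∈ J ∧ (box P t).2 = addRows l I (box P t).1
  exists_first : ∀ r ∈ I, ∃ t : Fin P.length, (t : ℕ) < p ∧ (box P t).1 = r
  exists_second : ∀ r ∈ J, ∃ t : Fin P.length, p ≤ (t : ℕ) ∧ (box P t).1 = r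
  lt_row : ∀ s t : Fin P.length, s < t → ((t : ℕ) < p ∨ p ≤ (s : ℕ)) → (box P s).1 < (box P t).1
  mid : ∀ i : Fin (P.length + 1), (i : ℕ) = p → ∀ r, (P.toFun i).rowLen r = addRows l I r
  last : ∀ r, P.last.rowLen r = addRows (addRows l I) J r

/-- A later box in the same or a higher row would lie further to the right, hence have a larger
label. So decreasing labels mean that the rows are used strictly from top to bottom, each at most
once. -/
theorem isStripPath_of_decreasing {P : LatticePath} {p q : ℕ} (hlen : P.length = p + q)
    (hdec : ∀ s t : Fin P.length, s < t → ((t : ℕ) < p ∨ p ≤ (s : ℕ)) → label P t < label P s) :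
    IsStripPath P p q P.head.rowLen (firstRows P p) (secondRows P p) := by
  have hlt : ∀ s t : Fin P.length, s < t → ((t : ℕ) < p ∨ p ≤ (s : ℕ)) →
      (box P s).1 < (box P t).1 := by
    intro s t hst h
    by_contra hc
    have h1 := hdec s t hst h
    have hs := (box_spec P s).2
    have ht := (box_spec P t).2
    have h2 := (P.toFun t.castSucc).rowLen_anti _ _ (not_lt.1 hc)
    have h3 : (P.toFun s.castSucc).rowLen (box P s).1 <
        (P.toFun t.castSucc).rowLen (box P s).1 := by
      rw [rowLen_path, rowLen_path, Nat.add_lt_add_iff_left]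
      refine Finset.card_lt_card ?_
      rw [Finset.ssubset_iff_of_subset]
      · exact ⟨s, by simpa using hst, by simp⟩
      · intro w
        simp only [Finset.mem_filter, Finset.mem_univ, true_and, Fin.val_castSucc]
        have : (s : ℕ) < t := hst
        exact fun ⟨h1, h2⟩ => ⟨by omega, h2⟩
    simp only [label] at h1
    omega
  have hinj : ∀ s t : Fin P.length, ((s : ℕ) < p ↔ (t : ℕ) < p) → (box P s).1 = (box P t).1 →
      s = t := by
    intro s t h1 h2
    rcases lt_trichotomy s t with h | h | h
    · have := hlt s t h (by omega); omega
    · exact h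
    · have := hlt t s h (by omega); omega
  have hfirst : ∀ (r i : ℕ), i ≤ p →
      (Finset.univ.filter fun t : Fin P.length => (t : ℕ) < i ∧ (box P t).1 = r).card ≤ 1 := by
    intro r i hi
    rw [Finset.card_le_one]
    intro s hs t ht
    simp only [Finset.mem_filter, Finset.mem_univ, true_and] at hs ht
    exact hinj s t (by omega) (by omega)
  have hp : ∀ (r : ℕ), (Finset.univ.filter fun t : Fin P.length =>
      (t : ℕ) < p ∧ (box P t).1 = r).card = if r ∈ firstRows P p then 1 else 0 := by
    intro r
    split_ifs with h
    · refine le_antisymm (hfirst r p le_rfl) (Finset.card_pos.2 ?_)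
      simpa [firstRows, Finset.Nonempty] using h
    · rw [Finset.card_eq_zero, Finset.filter_eq_empty_iff]
      intro t _ ht
      exact h (Finset.mem_image.2 ⟨t, by simpa using ht.1, ht.2⟩)
  have hsplit : ∀ (r i : ℕ), p ≤ i →
      (Finset.univ.filter fun t : Fin P.length => (t : ℕ) < i ∧ (box P t).1 = r).card =
      (if r ∈ firstRows P p then 1 else 0) + (Finset.univ.filter fun t : Fin P.length =>
        (p ≤ (t : ℕ) ∧ (t : ℕ) < i) ∧ (box P t).1 = r).card := by
    intro r i hi
    rw [← hp, ← Finset.card_union_of_disjoint]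
    · congr 1
      ext t
      simp only [Finset.mem_filter, Finset.mem_univ, true_and, Finset.mem_union]
      omega
    · rw [Finset.disjoint_left]
      intro t h1 h2
      simp only [Finset.mem_filter, Finset.mem_univ, true_and] at h1 h2
      omega
  refine ⟨hlen, fun t ht => ⟨?_, ?_⟩, fun t ht => ⟨?_, ?_⟩, fun r hr => ?_, fun r hr => ?_, hlt,
    fun i hi r => ?_, fun r => ?_⟩
  · exact Finset.mem_image.2 ⟨t, by simpa using ht, rfl⟩
  · rw [(box_spec P t).2, rowLen_path, Nat.add_eq_left, Finset.card_eq_zero,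
      Finset.filter_eq_empty_iff]
    rintro s - ⟨h1, h2⟩
    rw [Fin.val_castSucc] at h1
    have := hlt s t h1 (Or.inl ht)
    omega
  · exact Finset.mem_image.2 ⟨t, by simpa using ht, rfl⟩
  · rw [(box_spec P t).2, rowLen_path, Fin.val_castSucc, hsplit _ _ ht, addRows, Nat.add_left_cancel_iff,
      Nat.add_eq_left, Finset.card_eq_zero, Finset.filter_eq_empty_iff]
    rintro s - ⟨h1, h2⟩
    have := hlt s t h1.2 (Or.inr h1.1)
    omega
  · simpa [firstRows] using hr
  · simpa [secondRows] using hr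
  · rw [rowLen_path, hi, hp, addRows]
  · have hpl : p ≤ ((Fin.last P.length : Fin (P.length + 1)) : ℕ) := by simp; omega
    rw [RelSeries.last, rowLen_path, hsplit _ _ hpl, addRows, addRows, add_assoc]
    congr 2
    split_ifs with h
    · refine le_antisymm (Finset.card_le_one.2 ?_) (Finset.card_pos.2 ?_)
      · intro s hs t ht
        simp only [Finset.mem_filter, Finset.mem_univ, true_and] at hs ht
        exact hinj s t (by omega) (by omega)
      · obtain ⟨t, h1, h2⟩ := Finset.mem_image.1 h
        simp only [Finset.mem_filter, Finset.mem_univ, true_and] at h1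
        exact ⟨t, by simp [h1, h2]⟩
    · rw [Finset.card_eq_zero, Finset.filter_eq_empty_iff]
      intro t _ ht
      exact h (Finset.mem_image.2 ⟨t, by simpa using ht.1.1, ht.2⟩)

/-- The number of elements of `K` below `r`. -/
def rank (K : Finset ℕ) (r : ℕ) : ℕ := (K.filter (· < r)).card

theorem rank_lt {K : Finset ℕ} {r r' : ℕ} (hr : r ∈ K) (h : r < r') : rank K r < rank K r' := by
  refine Finset.card_lt_card ?_
  rw [Finset.ssubset_iff_of_subset]
  · exact ⟨r, by simp [hr, h], by simp⟩
  · intro x hx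
    simp only [Finset.mem_filter] at hx ⊢
    exact ⟨hx.1, by omega⟩

theorem rank_inj {K : Finset ℕ} {r r' : ℕ} (hr : r ∈ K) (hr' : r' ∈ K)
    (h : rank K r = rank K r') : r = r' := by
  rcases lt_trichotomy r r' with h1 | h1 | h1
  · have := rank_lt hr h1; omega
  · exact h1
  · have := rank_lt hr' h1; omega

theorem rank_lt_card {K : Finset ℕ} {r : ℕ} (hr : r ∈ K) : rank K r < K.card := by
  refine Finset.card_lt_card ?_
  rw [Finset.ssubset_iff_of_subset (Finset.filter_subset _ _)]
  exact ⟨r, hr, by simp⟩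

theorem exists_rank_eq {K : Finset ℕ} {t : ℕ} (ht : t < K.card) : ∃ r ∈ K, rank K r = t := by
  have : K.image (rank K) = Finset.range K.card := by
    refine Finset.eq_of_subset_of_card_le ?_ ?_
    · intro x hx
      obtain ⟨r, hr, rfl⟩ := Finset.mem_image.1 hx
      exact Finset.mem_range.2 (rank_lt_card hr)
    · rw [Finset.card_range, Finset.card_image_of_injOn fun r hr r' hr' h => rank_inj hr hr' h]
  have h := Finset.mem_range.2 ht
  rw [← this] at h
  simpa using h

namespace IsStripPath

variable {P : LatticePath} {p q : ℕ} {l : ℕ → ℕ} {I J : Finset ℕ}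

/-- Steps of a strip are ordered by row, so the number of a step is the number of rows of the strip
above its box; this recovers the path from the set of rows. -/
theorem rank_first (h : IsStripPath P p q l I J) (t : Fin P.length) (ht : (t : ℕ) < p) :
    rank I (box P t).1 = t := by
  have : I.filter (· < (box P t).1) =
      (Finset.univ.filter fun s : Fin P.length => s < t).image fun s => (box P s).1 := by
    ext r
    simp only [Finset.mem_filter, Finset.mem_image, Finset.mem_univ, true_and]
    constructor
    · rintro ⟨h1, h2⟩
      obtain ⟨s, hs, rfl⟩ := h.exists_first r h1
      refine ⟨s, ?_, rfl⟩
      by_contra hc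
      rcases (not_lt.1 hc).lt_or_eq with h3 | h3
      · have := h.lt_row t s h3 (Or.inl hs); omega
      · rw [h3] at h2; omega
    · rintro ⟨s, hs, rfl⟩
      have : (s : ℕ) < t := hs
      exact ⟨(h.first s (by omega)).1, h.lt_row s t hs (Or.inl ht)⟩
  rw [rank, this, Finset.card_image_of_injOn]
  · rw [show (Finset.univ.filter fun s : Fin P.length => s < t) = Finset.Iio t by ext; simp,
      Fin.card_Iio]
  · intro s hs s' hs' heq
    simp only [Finset.coe_filter, Finset.mem_univ, true_and, Set.mem_ofPred_eq] at hs hs'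
    have h1 : (s : ℕ) < t := hs
    have h2 : (s' : ℕ) < t := hs'
    rcases lt_trichotomy s s' with h3 | h3 | h3
    · have := h.lt_row s s' h3 (Or.inl (by omega)); simp only at heq; omega
    · exact h3
    · have := h.lt_row s' s h3 (Or.inl (by omega)); simp only at heq; omega

theorem rank_second (h : IsStripPath P p q l I J) (t : Fin P.length) (ht : p ≤ (t : ℕ)) :
    rank J (box P t).1 + p = t := by
  have : J.filter (· < (box P t).1) =
      (Finset.univ.filter fun s : Fin P.length => p ≤ (s : ℕ) ∧ (s : ℕ) < t).image
        fun s => (box P s).1 := by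
    ext r
    simp only [Finset.mem_filter, Finset.mem_image, Finset.mem_univ, true_and]
    constructor
    · rintro ⟨h1, h2⟩
      obtain ⟨s, hs, rfl⟩ := h.exists_second r h1
      refine ⟨s, ⟨hs, ?_⟩, rfl⟩
      by_contra hc
      rcases (not_lt.1 hc).lt_or_eq with h3 | h3
      · have := h.lt_row t s h3 (Or.inr ht); omega
      · rw [Fin.ext h3] at h2; omega
    · rintro ⟨s, hs, rfl⟩
      exact ⟨(h.second s hs.1).1, h.lt_row s t hs.2 (Or.inr hs.1)⟩
  rw [rank, this, Finset.card_image_of_injOn]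
  · have : (Finset.univ.filter fun s : Fin P.length => p ≤ (s : ℕ) ∧ (s : ℕ) < t).card =
        (Finset.Ico p t).card := by
      rw [← Finset.card_map Fin.valEmbedding]
      congr 1
      ext i
      simp only [Finset.mem_map, Finset.mem_filter, Finset.mem_univ, true_and,
        Fin.valEmbedding_apply, Finset.mem_Ico]
      constructor
      · rintro ⟨s, hs, rfl⟩; exact hs
      · intro hi; exact ⟨⟨i, by omega⟩, hi, rfl⟩
    rw [this, Nat.card_Ico]
    omega
  · intro s hs s' hs' heq
    simp only [Finset.coe_filter, Finset.mem_univ, true_and, Set.mem_ofPred_eq] at hs hs'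
    rcases lt_trichotomy s s' with h3 | h3 | h3
    · have := h.lt_row s s' h3 (Or.inr hs.1); simp only at heq; omega
    · exact h3
    · have := h.lt_row s' s h3 (Or.inr hs'.1); simp only at heq; omega

theorem card_first (h : IsStripPath P p q l I J) : I.card = p := by
  have e : (Finset.univ.filter fun t : Fin P.length => (t : ℕ) < p).image (fun t => (box P t).1)
      = I := by
    ext r
    simp only [Finset.mem_image, Finset.mem_filter, Finset.mem_univ, true_and]
    exact ⟨fun ⟨t, h1, h2⟩ => h2 ▸ (h.first t h1).1, h.exists_first r⟩
  rw [← e, Finset.card_image_of_injOn, ← Finset.card_map Fin.valEmbedding]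
  · have : (Finset.univ.filter fun t : Fin P.length => (t : ℕ) < p).map Fin.valEmbedding =
        Finset.range p := by
      have := h.length
      ext i
      simp only [Finset.mem_map, Finset.mem_filter, Finset.mem_univ, true_and,
        Fin.valEmbedding_apply, Finset.mem_range]
      constructor
      · rintro ⟨s, hs, rfl⟩; exact hs
      · intro hi; exact ⟨⟨i, by omega⟩, hi, rfl⟩
    rw [this, Finset.card_range]
  · intro s hs t ht heq
    simp only [Finset.coe_filter, Finset.mem_univ, true_and, Set.mem_ofPred_eq] at hs ht heq
    have h1 := h.rank_first s hs
    have h2 := h.rank_first t ht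
    rw [heq] at h1
    exact Fin.ext (by omega)

theorem card_second (h : IsStripPath P p q l I J) : J.card = q := by
  have e : (Finset.univ.filter fun t : Fin P.length => p ≤ (t : ℕ)).image (fun t => (box P t).1)
      = J := by
    ext r
    simp only [Finset.mem_image, Finset.mem_filter, Finset.mem_univ, true_and]
    exact ⟨fun ⟨t, h1, h2⟩ => h2 ▸ (h.second t h1).1, h.exists_second r⟩
  rw [← e, Finset.card_image_of_injOn, ← Finset.card_map Fin.valEmbedding]
  · have : (Finset.univ.filter fun t : Fin P.length => p ≤ (t : ℕ)).map Fin.valEmbedding =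
        Finset.Ico p (p + q) := by
      have := h.length
      ext i
      simp only [Finset.mem_map, Finset.mem_filter, Finset.mem_univ, true_and,
        Fin.valEmbedding_apply, Finset.mem_Ico]
      constructor
      · rintro ⟨s, hs, rfl⟩; exact ⟨hs, by omega⟩
      · intro hi; exact ⟨⟨i, by omega⟩, hi.1, rfl⟩
    rw [this, Nat.card_Ico]
    omega
  · intro s hs t ht heq
    simp only [Finset.coe_filter, Finset.mem_univ, true_and, Set.mem_ofPred_eq] at hs ht heq
    have h1 := h.rank_second s hs
    have h2 := h.rank_second t ht
    rw [heq] at h1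
    exact Fin.ext (by omega)

/-- A path is determined by its initial partition and the rows of its two strips. -/
theorem eq_of_head_eq {P' : LatticePath} (h : IsStripPath P p q l I J)
    (h' : IsStripPath P' p q l I J) (hhead : P.head = P'.head) : P = P' := by
  have hlen : P.length = P'.length := h.length.trans h'.length.symm
  have hrow : ∀ (t : ℕ) (ht : t < P.length) (ht' : t < P'.length),
      (box P ⟨t, ht⟩).1 = (box P' ⟨t, ht'⟩).1 := by
    intro t ht ht'
    rcases Nat.lt_or_ge t p with hp | hp
    · refine rank_inj (h.first _ hp).1 (h'.first _ hp).1 ?_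
      rw [h.rank_first _ hp, h'.rank_first _ hp]
    · refine rank_inj (h.second _ hp).1 (h'.second _ hp).1 ?_
      have := h.rank_second ⟨t, ht⟩ hp
      have := h'.rank_second ⟨t, ht'⟩ hp
      simp only at *
      omega
  have hfun : ∀ (i : ℕ) (hi : i < P.length + 1) (hi' : i < P'.length + 1),
      P.toFun ⟨i, hi⟩ = P'.toFun ⟨i, hi'⟩ := by
    intro i hi hi'
    refine youngDiagram_ext fun r => ?_
    rw [rowLen_path, rowLen_path, hhead]
    congr 1
    refine Finset.card_bij (fun t _ => ⟨t, by omega⟩) ?_ ?_ ?_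
    · intro t ht
      simp only [Finset.mem_filter, Finset.mem_univ, true_and] at ht ⊢
      exact ⟨ht.1, by rw [← hrow t t.2 (by omega)]; exact ht.2⟩
    · intro s _ t _ hst
      exact Fin.ext (by simpa using hst)
    · intro t ht
      simp only [Finset.mem_filter, Finset.mem_univ, true_and] at ht
      exact ⟨⟨t, by omega⟩, by
        simp only [Finset.mem_filter, Finset.mem_univ, true_and]
        exact ⟨ht.1, by rw [hrow t (by omega) t.2]; exact ht.2⟩, rfl⟩
  obtain ⟨m, f, hf⟩ := P
  obtain ⟨m', f', hf'⟩ := P'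
  simp only at hlen hfun
  subst hlen
  have : f = f' := funext fun i => hfun i i.2 i.2
  subst this
  rfl

end IsStripPath

/-! ### Construction of a path from two strips -/

theorem cells_eq_insert {κ κ' : YoungDiagram} {r : ℕ}
    (h : ∀ x, κ'.rowLen x = κ.rowLen x + if x = r then 1 else 0) :
    κ'.cells = insert (r, κ.rowLen r) κ.cells := by
  ext ⟨i, j⟩
  rw [Finset.mem_insert, YoungDiagram.mem_cells, YoungDiagram.mem_cells,
    YoungDiagram.mem_iff_lt_rowLen, YoungDiagram.mem_iff_lt_rowLen, Prod.mk.injEq, h]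
  by_cases hi : i = r
  · subst hi
    simp only [if_true, true_and]
    omega
  · simp [hi]

/-- Filling a vertical strip from the top keeps partitions: when a row has its box, all higher rows
of the strip have theirs, and a row outside the strip was already long enough for the final shape.
-/
theorem antitone_addRows_rank {g : ℕ → ℕ} {K : Finset ℕ} (hg : Antitone g)
    (hK : Antitone (addRows g K)) (i : ℕ) :
    Antitone (addRows g (K.filter fun r => rank K r < i)) := by
  intro x y hxy
  have h1 := hg hxy
  have h2 := hK hxy
  simp only [addRows, Finset.mem_filter] at *
  rcases hxy.eq_or_lt with rfl | hlt
  · exact le_rfl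
  by_cases hx : x ∈ K
  · have := rank_lt hx hlt
    simp only [hx, true_and, if_true] at *
    split_ifs at * <;> omega
  · simp only [hx, false_and, if_false] at *
    by_cases hy : y ∈ K
    · simp only [hy, true_and, if_true] at *
      split_ifs <;> omega
    · simp only [hy, false_and, if_false]
      omega

theorem addRows_rank_succ {g : ℕ → ℕ} {K : Finset ℕ} {r : ℕ} (hr : r ∈ K) (x : ℕ) :
    addRows g (K.filter fun s => rank K s < rank K r + 1) x =
      addRows g (K.filter fun s => rank K s < rank K r) x + if x = r then 1 else 0 := by
  simp only [addRows, Finset.mem_filter]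
  by_cases hx : x ∈ K
  · by_cases hxr : x = r
    · subst hxr; simp [hx]
    · have : rank K x ≠ rank K r := fun h => hxr (rank_inj hx hr h)
      simp only [hx, true_and, hxr, if_false, add_zero]
      congr 2
      rw [eq_iff_iff]
      omega
  · have hxr : x ≠ r := fun h => hx (h ▸ hr)
    simp [hx, hxr]

theorem filter_rank_eq_self {K : Finset ℕ} {i : ℕ} (h : K.card ≤ i) :
    (K.filter fun r => rank K r < i) = K :=
  Finset.filter_true_of_mem fun _ hr => (rank_lt_card hr).trans_le h

theorem addRows_empty (g : ℕ → ℕ) : addRows g ∅ = g := by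
  funext i
  simp [addRows]

theorem addRows_apply_zero {n : ℕ} {g : ℕ → ℕ} {K : Finset ℕ} (hg : ∀ i, n ≤ i → g i = 0)
    (hK : K ⊆ Finset.range n) (i : ℕ) (hi : n ≤ i) : addRows g K i = 0 := by
  have : i ∉ K := fun h => by have := Finset.mem_range.1 (hK h); omega
  simp [addRows, this, hg i hi]

/-- The row lengths of the `i`-th partition of the path that adds boxes in the rows of `I` and then
in those of `J`. -/
def pathRows (p : ℕ) (l : ℕ → ℕ) (I J : Finset ℕ) (i : ℕ) : ℕ → ℕ :=
  addRows (addRows l (I.filter fun r => rank I r < i)) (J.filter fun r => rank J r < i - p)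

/-- The truncated difference `i - p` is zero here, so no row of `J` has been used yet. -/
theorem pathRows_of_le {p : ℕ} {l : ℕ → ℕ} {I J : Finset ℕ} {i : ℕ} (hi : i ≤ p) :
    pathRows p l I J i = addRows l (I.filter fun r => rank I r < i) := by
  rw [pathRows, Nat.sub_eq_zero_of_le hi]
  simp [addRows_empty]

theorem pathRows_of_ge {p : ℕ} {l : ℕ → ℕ} {I J : Finset ℕ} {i : ℕ} (hI : I.card = p)
    (hi : p ≤ i) :
    pathRows p l I J i = addRows (addRows l I) (J.filter fun r => rank J r < i - p) := by
  rw [pathRows, filter_rank_eq_self (by omega)]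

theorem pathRows_zero (p : ℕ) (l : ℕ → ℕ) (I J : Finset ℕ) : pathRows p l I J 0 = l := by
  rw [pathRows_of_le (Nat.zero_le p)]
  simp [addRows_empty]

theorem antitone_pathRows {p : ℕ} {l : ℕ → ℕ} {I J : Finset ℕ} (hI : I.card = p)
    (h0 : Antitone l) (h1 : Antitone (addRows l I)) (h2 : Antitone (addRows (addRows l I) J))
    (i : ℕ) : Antitone (pathRows p l I J i) := by
  rcases le_total i p with hi | hi
  · rw [pathRows_of_le hi]
    exact antitone_addRows_rank h0 h1 i
  · rw [pathRows_of_ge hI hi]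
    exact antitone_addRows_rank h1 h2 _

theorem pathRows_succ {p q : ℕ} {l : ℕ → ℕ} {I J : Finset ℕ} (hI : I.card = p) (hJ : J.card = q)
    {t : ℕ} (ht : t < p + q) :
    ∃ r, (∀ x, pathRows p l I J (t + 1) x = pathRows p l I J t x + if x = r then 1 else 0) ∧
      (t < p → r ∈ I ∧ rank I r = t ∧ pathRows p l I J t r = l r) ∧
      (p ≤ t → r ∈ J ∧ rank J r = t - p ∧ pathRows p l I J t r = addRows l I r) := by
  rcases Nat.lt_or_ge t p with htp | htp
  · obtain ⟨r, hr, rfl⟩ := exists_rank_eq (hI.symm ▸ htp : t < I.card)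
    refine ⟨r, fun x => ?_, fun _ => ⟨hr, rfl, ?_⟩, fun h => by omega⟩
    · rw [pathRows_of_le htp, pathRows_of_le htp.le, addRows_rank_succ hr]
    · rw [pathRows_of_le htp.le]
      simp [addRows]
  · obtain ⟨r, hr, hrt⟩ := exists_rank_eq (by omega : t - p < J.card)
    refine ⟨r, fun x => ?_, fun h => by omega, fun _ => ⟨hr, hrt, ?_⟩⟩
    · rw [pathRows_of_ge hI htp, pathRows_of_ge hI (by omega), ← hrt,
        show t + 1 - p = rank J r + 1 by omega, addRows_rank_succ hr]
    · rw [pathRows_of_ge hI htp, ← hrt]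
      simp [addRows]

/-- The second strip is forced by ν, and the boxes of each strip are added in the order of their
ranks. Labels then decrease, because rows increase while row lengths do not. -/
theorem exists_restrictedPath {n k p q : ℕ} {lam nu : YoungDiagram} (hlam : lam ∈ restricted n k)
    (hnu : nu ∈ restricted n k) {I : Finset ℕ} (hI : I ∈ midStrips n k p lam.rowLen nu.rowLen)
    (hsum : ∑ i ∈ Finset.range n, nu.rowLen i = ∑ i ∈ Finset.range n, lam.rowLen i + (p + q)) :
    ∃ P ∈ restrictedPaths n k p q, P.head = lam ∧ P.last = nu ∧ firstRows P p = I := by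
  rw [mem_midStrips] at hI
  obtain ⟨⟨hIn, hIp⟩, hmid, hIv⟩ := hI
  have hl := mem_restricted_iff.1 hlam
  have hv := mem_restricted_iff.1 hnu
  set l := lam.rowLen
  set J : Finset ℕ := (Finset.range n).filter fun i => nu.rowLen i = addRows l I i + 1 with hJ
  have hJn : J ⊆ Finset.range n := Finset.filter_subset _ _
  have hJv : addRows (addRows l I) J = nu.rowLen := by
    funext i
    have h1 := hIv i
    have h2 := hmid.eq_zero i
    have h3 := hv.eq_zero i
    rw [addRows, hJ]
    simp only [Finset.mem_filter, Finset.mem_range]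
    split_ifs <;> omega
  have hJq : J.card = q := by
    have h1 := sum_addRows (l := addRows l I) hJn
    have h2 := sum_addRows (l := l) hIn
    rw [hJv] at h1
    omega
  have hanti := antitone_pathRows (J := J) hIp hl.antitone hmid.antitone
    (by rw [hJv]; exact hv.antitone)
  have hzero : ∀ i r, n ≤ r → pathRows p l I J i r = 0 := fun i =>
    addRows_apply_zero (addRows_apply_zero hl.eq_zero ((Finset.filter_subset _ _).trans hIn))
      ((Finset.filter_subset _ _).trans hJn)
  set D : ℕ → YoungDiagram := fun i => ofRows n (pathRows p l I J i) (hanti i) with hD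
  have hDr : ∀ i r, (D i).rowLen r = pathRows p l I J i r := fun i r =>
    rowLen_ofRows (hanti i) (hzero i) r
  obtain ⟨P, hPlen, hPD⟩ : ∃ P : LatticePath, ∃ h : P.length = p + q,
      ∀ i : Fin (P.length + 1), P.toFun i = D i := by
    refine ⟨⟨p + q, fun i => D i, fun t => ?_⟩, rfl, fun _ => rfl⟩
    obtain ⟨r, hr, -⟩ := pathRows_succ (l := l) hIp hJq t.2
    refine ⟨(r, (D t).rowLen r), ?_, cells_eq_insert fun x => ?_⟩
    · rw [YoungDiagram.mem_cells, YoungDiagram.mem_iff_lt_rowLen]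
      simp
    · rw [hDr, Fin.val_succ, hr]
      simp [hDr]
  have hbox : ∀ t : Fin P.length,
      ((t : ℕ) < p → (box P t).1 ∈ I ∧ rank I (box P t).1 = t ∧ (box P t).2 = l (box P t).1) ∧
      (p ≤ (t : ℕ) → (box P t).1 ∈ J ∧ rank J (box P t).1 = t - p ∧
        (box P t).2 = addRows l I (box P t).1) := by
    intro t
    obtain ⟨r, h1, h2, h3⟩ := pathRows_succ (l := l) hIp hJq (by rw [← hPlen]; exact t.2)
    obtain ⟨h4, h5⟩ := box_spec P t
    have h6 := h4 r
    rw [hPD, hPD, hDr, hDr, Fin.val_succ, h1] at h6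
    have hr : r = (box P t).1 := by
      by_contra hc
      simp [hc] at h6
    rw [hPD, hDr, ← hr, Fin.val_castSucc] at h5
    rw [← hr, h5]
    exact ⟨h2, h3⟩
  have hhead : P.head = lam := youngDiagram_ext fun r => by
    rw [RelSeries.head, hPD, hDr, Fin.val_zero, pathRows_zero]
  have hlast : P.last = nu := youngDiagram_ext fun r => by
    rw [RelSeries.last, hPD, hDr, Fin.val_last, hPlen, pathRows_of_ge hIp (by omega),
      Nat.add_sub_cancel_left, filter_rank_eq_self hJq.le, hJv]
  refine ⟨P, ⟨hPlen, fun s t hst h => ?_, fun i hi => ?_⟩, hhead, hlast, ?_⟩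
  · have hst' : (s : ℕ) < t := hst
    rcases h with h | h
    · obtain ⟨s1, s2, s3⟩ := (hbox s).1 (by omega)
      obtain ⟨t1, t2, t3⟩ := (hbox t).1 h
      have hlt : (box P s).1 < (box P t).1 := by
        by_contra hc
        rcases (not_lt.1 hc).lt_or_eq with h | h
        · have := rank_lt t1 h; omega
        · rw [h] at t2; omega
      have := hl.antitone hlt.le
      simp only [label, s3, t3]
      omega
    · obtain ⟨s1, s2, s3⟩ := (hbox s).2 h
      obtain ⟨t1, t2, t3⟩ := (hbox t).2 (by omega)
      have hlt : (box P s).1 < (box P t).1 := by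
        by_contra hc
        rcases (not_lt.1 hc).lt_or_eq with h | h
        · have := rank_lt t1 h; omega
        · rw [h] at t2; omega
      have := hmid.antitone hlt.le
      simp only [label, s3, t3]
      omega
  · rcases hi with hi | hi | hi
    · have : i = 0 := Fin.ext hi
      subst this
      change P.head ∈ _
      rwa [hhead]
    · rw [mem_restricted_iff, hPD, funext (hDr i), hi, pathRows_of_le le_rfl,
        filter_rank_eq_self hIp.le]
      exact hmid
    · have : i = Fin.last _ := Fin.ext (by rw [hi, Fin.val_last, hPlen])
      subst this
      change P.last ∈ _
      rwa [hlast]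
  · ext r
    simp only [firstRows, Finset.mem_image, Finset.mem_filter, Finset.mem_univ, true_and]
    constructor
    · rintro ⟨t, ht, rfl⟩
      exact ((hbox t).1 ht).1
    · intro hr
      have h1 := rank_lt_card hr
      refine ⟨⟨rank I r, by omega⟩, by simp only; omega, ?_⟩
      obtain ⟨h2, h3, -⟩ := (hbox ⟨rank I r, by omega⟩).1 (by simp only; omega)
      exact rank_inj h2 hr h3

/-! ### Column strict tableaux and ballot words -/

/-- The label of the box that is added to the row `x` of `f`. -/
def rowLabel (f : ℕ → ℕ) (x : ℕ) : ℤ := (f x : ℤ) - x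

theorem rowLabel_strictAnti {f : ℕ → ℕ} (hf : Antitone f) : StrictAnti (rowLabel f) := by
  intro x y hxy
  have := hf hxy.le
  simp only [rowLabel]
  omega

theorem rowLabel_addRows (f : ℕ → ℕ) (I : Finset ℕ) (x : ℕ) :
    rowLabel (addRows f I) x = rowLabel f x + if x ∈ I then 1 else 0 := by
  simp only [rowLabel, addRows]
  split_ifs <;> push_cast <;> ring

/-- The number of elements of `K` that are at least `i`. -/
def corank (K : Finset ℕ) (i : ℕ) : ℕ := (K.filter (i ≤ ·)).card

theorem rank_add_corank (K : Finset ℕ) (i : ℕ) : rank K i + corank K i = K.card := by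
  rw [← Finset.card_filter_add_card_filter_not (s := K) (· < i)]
  simp only [not_lt]
  rfl

/-- Rows in both strips cancel in the difference, so heights may be computed from all rows of the
strips instead of the single ones. -/
theorem height_eq_corank {n : ℕ} {l v : ℕ → ℕ} {I J : Finset ℕ} (hI : I ⊆ Finset.range n)
    (hJ : J ⊆ Finset.range n) (hv : ∀ i, v i = addRows (addRows l I) J i) (i : ℕ) :
    height (singles n l v) (I ∩ singles n l v) i = (corank I i : ℤ) - corank J i := by
  have key : ∀ K : Finset ℕ, K ⊆ Finset.range n → (corank K i : ℤ) =
      ∑ j ∈ Finset.range n, if i ≤ j ∧ j ∈ K then 1 else 0 := by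
    intro K hK
    rw [Finset.sum_boole, corank]
    congr 2
    ext j
    have := @hK j
    simp only [Finset.mem_filter]
    tauto
  rw [key I hI, key J hJ, ← Finset.sum_sub_distrib, height, Finset.sum_filter, singles,
    Finset.sum_filter]
  refine Finset.sum_congr rfl fun j hj => ?_
  rw [Finset.mem_range] at hj
  have h1 := hv j
  simp only [addRows] at h1
  by_cases h2 : j ∈ I <;> by_cases h3 : j ∈ J <;> by_cases h4 : i ≤ j <;>
    simp [h1, h2, h3, h4, hj]

theorem mem_singles_iff_xor {n : ℕ} {l v : ℕ → ℕ} {I J : Finset ℕ} (hI : I ⊆ Finset.range n)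
    (hJ : J ⊆ Finset.range n) (hv : ∀ i, v i = addRows (addRows l I) J i) (i : ℕ) :
    i ∈ singles n l v ↔ (i ∈ I ∧ i ∉ J) ∨ (i ∉ I ∧ i ∈ J) := by
  have h1 := hv i
  have h2 := @hI i
  have h3 := @hJ i
  rw [Finset.mem_range] at h2 h3
  rw [mem_singles, h1]
  simp only [addRows]
  by_cases h4 : i ∈ I <;> by_cases h5 : i ∈ J <;> simp_all

namespace IsStripPath

variable {P : LatticePath} {p q : ℕ} {l : ℕ → ℕ} {I J : Finset ℕ}

theorem label_first (h : IsStripPath P p q l I J) (t : Fin P.length) (ht : (t : ℕ) < p) :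
    label P t = rowLabel l (box P t).1 := by
  rw [label, rowLabel, (h.first t ht).2]

theorem label_second (h : IsStripPath P p q l I J) (t : Fin P.length) (ht : p ≤ (t : ℕ)) :
    label P t = rowLabel (addRows l I) (box P t).1 := by
  rw [label, rowLabel, (h.second t ht).2]

theorem label_lt (h : IsStripPath P p q l I J) (hl : Antitone l) (hm : Antitone (addRows l I))
    (s t : Fin P.length) (hst : s < t) (hp : (t : ℕ) < p ∨ p ≤ (s : ℕ)) :
    label P t < label P s := by
  have h1 := h.lt_row s t hst hp
  have hst' : (s : ℕ) < t := hst
  rcases hp with hp | hp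
  · rw [h.label_first t hp, h.label_first s (by omega)]
    exact rowLabel_strictAnti hl h1
  · rw [h.label_second t (by omega), h.label_second s hp]
    exact rowLabel_strictAnti hm h1

theorem corank_first (h : IsStripPath P p q l I J) (t : Fin P.length) (ht : (t : ℕ) < p) :
    corank I (box P t).1 + t = p := by
  have h1 := rank_add_corank I (box P t).1
  rw [h.rank_first t ht, h.card_first] at h1
  omega

theorem corank_second (h : IsStripPath P p q l I J) (t : Fin P.length) (ht : p ≤ (t : ℕ)) :
    corank J (box P t).1 + t = p + q := by
  have h1 := rank_add_corank J (box P t).1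
  have h2 := h.rank_second t ht
  rw [h.card_second] at h1
  omega

/-- Strictness along columns is automatic, as labels decrease along each strip. What remains
compares, in tableau row `r`, the steps with `r` successors in their strips. -/
theorem fits_iff {mu : YoungDiagram} (hmu : mu.rowLen 0 ≤ 2)
    (h : IsStripPath P (mu.colLen 0) (mu.colLen 1) l I J) (hl : Antitone l)
    (hm : Antitone (addRows l I)) :
    Fits mu P ↔ ∀ r < mu.colLen 1, ∀ s t : Fin P.length, (s : ℕ) = mu.colLen 0 - 1 - r →
      (t : ℕ) = mu.colLen 0 + mu.colLen 1 - 1 - r → label P s ≤ label P t := by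
  have hqp := mu.colLen_anti 0 1 (Nat.zero_le 1)
  have hlen := h.length
  have hc : ∀ r c, (r, c) ∈ mu → c < 2 := fun r c hrc =>
    (YoungDiagram.mem_iff_lt_rowLen.1 (mu.up_left_mem (Nat.zero_le r) le_rfl hrc)).trans_le hmu
  constructor
  · rintro ⟨h1, -⟩ r hr s t hs ht
    have := h1 r 0 (YoungDiagram.mem_iff_lt_colLen.2 hr)
    simp only [tableau, if_true, zero_add, one_ne_zero, if_false] at this
    rw [dif_pos (by omega), dif_pos (by omega)] at this
    convert this
  · intro H
    refine ⟨fun r c hrc => ?_, fun r c hrc => ?_⟩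
    · obtain rfl : c = 0 := by have := hc r (c + 1) hrc; omega
      have hr := YoungDiagram.mem_iff_lt_colLen.1 hrc
      simp only [zero_add] at hr
      simp only [tableau, if_true, zero_add, one_ne_zero, if_false]
      rw [dif_pos (by omega), dif_pos (by omega)]
      exact H r hr _ _ rfl rfl
    · have hr := YoungDiagram.mem_iff_lt_colLen.1 hrc
      obtain rfl | rfl : c = 0 ∨ c = 1 := by have := hc _ _ hrc; omega
      · simp only [tableau, if_true]
        rw [dif_pos (by omega), dif_pos (by omega)]
        exact h.label_lt hl hm _ _ (by rw [Fin.lt_def]; simp only; omega) (by simp only; omega)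
      · simp only [tableau, one_ne_zero, if_false]
        rw [dif_pos (by omega), dif_pos (by omega)]
        exact h.label_lt hl hm _ _ (by rw [Fin.lt_def]; simp only; omega) (by simp only; omega)

/-- Counted from the bottom, each row of `J` must not lie below the row of `I` with the same number;
this is the ballot condition. If a row of `J` is also in `I`, its second label is one larger and the
comparison of labels does not decide the order of the rows. This does no harm: a height can become
negative only at a row of `J` outside `I`. -/
theorem fits_iff_isBallot {n : ℕ} {v : ℕ → ℕ} {mu : YoungDiagram} (hmu : mu.rowLen 0 ≤ 2)
    (h : IsStripPath P (mu.colLen 0) (mu.colLen 1) l I J) (hl : Antitone l)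
    (hm : Antitone (addRows l I)) (hI : I ⊆ Finset.range n) (hJ : J ⊆ Finset.range n)
    (hv : ∀ i, v i = addRows (addRows l I) J i) :
    Fits mu P ↔ IsBallot (singles n l v) (I ∩ singles n l v) := by
  have hqp := mu.colLen_anti 0 1 (Nat.zero_le 1)
  have hlen := h.length
  have hS : singles n l v ⊆ Finset.range n := Finset.filter_subset _ _
  rw [h.fits_iff hmu hl hm]
  constructor
  · intro H
    have hind : ∀ i, i ≤ n → 0 ≤ height (singles n l v) (I ∩ singles n l v) i := by
      intro i hi
      refine Nat.decreasingInduction'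
        (P := fun i => 0 ≤ height (singles n l v) (I ∩ singles n l v) i) ?_ hi ?_
      · intro i _ _ ih
        have hs := height_eq_succ_add (singles n l v) (I ∩ singles n l v) i
        by_cases hiS : i ∈ singles n l v
        · by_cases hiI : i ∈ I
          · simp only [hiS, hiI, Finset.mem_inter, and_self, if_true] at hs
            omega
          · have hiJ : i ∈ J := by
              have := (mem_singles_iff_xor hI hJ hv i).1 hiS
              tauto
            obtain ⟨t, ht, hti⟩ := h.exists_second i hiJ
            have c1 := h.corank_second t ht
            rw [hti] at c1
            have hslt : mu.colLen 0 + mu.colLen 1 - 1 - t < P.length := by omega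
            have hs' : mu.colLen 0 - 1 - (mu.colLen 0 + mu.colLen 1 - 1 - t) < P.length := by omega
            -- The number `mu.colLen 0 + mu.colLen 1 - 1 - t` is the tableau row of the letter `t`;
            -- the other step is the entry of the first column in that row.
            have h1 := H (mu.colLen 0 + mu.colLen 1 - 1 - t) (by omega) ⟨_, hs'⟩ t rfl (by omega)
            have hsp : mu.colLen 0 - 1 - (mu.colLen 0 + mu.colLen 1 - 1 - (t : ℕ)) <
              mu.colLen 0 := by omega
            rw [h.label_first _ hsp, h.label_second t ht, hti, rowLabel_addRows, if_neg hiI,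
              add_zero] at h1
            have h2 : i ≤ (box P ⟨_, hs'⟩).1 := (rowLabel_strictAnti hl).le_iff_ge.1 h1
            have c2 := h.corank_first ⟨_, hs'⟩ hsp
            have c3 : corank I (box P ⟨_, hs'⟩).1 ≤ corank I i := by
              refine Finset.card_le_card fun x hx => ?_
              rw [Finset.mem_filter] at hx ⊢
              exact ⟨hx.1, h2.trans hx.2⟩
            rw [height_eq_corank hI hJ hv]
            simp only at c2
            omega
        · simp only [hiS, if_false] at hs
          omega
      · rw [height_of_le hS _ le_rfl]
    intro i
    rcases le_total i n with hi | hi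
    · exact hind i hi
    · rw [height_of_le hS _ hi]
  · intro H r hr s t hs ht
    have c1 := h.corank_first s (by omega)
    have c2 := h.corank_second t (by omega)
    have h1 := H (box P t).1
    rw [height_eq_corank hI hJ hv] at h1
    rw [h.label_first s (by omega), h.label_second t (by omega), rowLabel_addRows]
    have h2 : (box P t).1 ≤ (box P s).1 := by
      by_contra hc
      have h3 : corank I (box P t).1 < corank I (box P s).1 := by
        refine Finset.card_lt_card ?_
        rw [Finset.ssubset_iff_of_subset]
        · exact ⟨(box P s).1, by simp [(h.first s (by omega)).1], by simp; omega⟩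
        · intro x hx
          rw [Finset.mem_filter] at hx ⊢
          exact ⟨hx.1, by omega⟩
      omega
    have h3 := (rowLabel_strictAnti hl).le_iff_ge.2 h2
    split_ifs <;> omega

end IsStripPath

/-! ### Pairing of parentheses in terms of rows -/

theorem corank_eq_succ_add (K : Finset ℕ) (i : ℕ) :
    corank K i = corank K (i + 1) + if i ∈ K then 1 else 0 := by
  have h : K.filter (i ≤ ·) = K.filter (i + 1 ≤ ·) ∪ K.filter (· = i) := by
    ext x
    simp only [Finset.mem_filter, Finset.mem_union, ← and_or_left]
    exact and_congr_right fun _ => by omega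
  have hd : Disjoint (K.filter (i + 1 ≤ ·)) (K.filter (· = i)) := by
    rw [Finset.disjoint_filter]
    intro x _ h1 h2
    omega
  rw [corank, h, Finset.card_union_of_disjoint hd, Finset.filter_eq', corank]
  split_ifs <;> simp

theorem corank_eq_zero {n : ℕ} {K : Finset ℕ} (hK : K ⊆ Finset.range n) {i : ℕ} (hi : n ≤ i) :
    corank K i = 0 := by
  rw [corank, Finset.card_eq_zero, Finset.filter_eq_empty_iff]
  intro x hx
  have := Finset.mem_range.1 (hK hx)
  omega

/-- The number of left parentheses after the one of the row `y` with labels less than `b`. -/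
def leftCount (l : ℕ → ℕ) (I : Finset ℕ) (y : ℕ) (b : ℤ) : ℕ :=
  (I.filter fun x => rowLabel l y < rowLabel l x ∧ rowLabel l x < b).card

/-- The number of right parentheses after the left one of the row `y` with labels less than `b`. -/
def rightCount (l : ℕ → ℕ) (I J : Finset ℕ) (y : ℕ) (b : ℤ) : ℕ :=
  (J.filter fun x => rowLabel l y ≤ rowLabel (addRows l I) x ∧
    rowLabel (addRows l I) x < b).card

/-- The left parenthesis of the row `y` is matched with the right one of the row `z`. -/
def RowPaired (l : ℕ → ℕ) (I J : Finset ℕ) (y z : ℕ) : Prop :=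
  rowLabel l y ≤ rowLabel (addRows l I) z ∧
  leftCount l I y (rowLabel (addRows l I) z + 1) =
    rightCount l I J y (rowLabel (addRows l I) z) ∧
  (∀ x ∈ I, rowLabel l y < rowLabel l x → rowLabel l x ≤ rowLabel (addRows l I) z →
    rightCount l I J y (rowLabel l x) ≤ leftCount l I y (rowLabel l x)) ∧
  ∀ x ∈ J, rowLabel l y ≤ rowLabel (addRows l I) x →
    rowLabel (addRows l I) x < rowLabel (addRows l I) z →
    rightCount l I J y (rowLabel (addRows l I) x) ≤
      leftCount l I y (rowLabel (addRows l I) x + 1)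

namespace IsStripPath

variable {P : LatticePath} {p q : ℕ} {l : ℕ → ℕ} {I J : Finset ℕ}

theorem first_inj (h : IsStripPath P p q l I J) {s t : Fin P.length} (hs : (s : ℕ) < p)
    (ht : (t : ℕ) < p) (heq : (box P s).1 = (box P t).1) : s = t := by
  have h1 := h.rank_first s hs
  have h2 := h.rank_first t ht
  rw [heq] at h1
  exact Fin.ext (by omega)

theorem second_inj (h : IsStripPath P p q l I J) {s t : Fin P.length} (hs : p ≤ (s : ℕ))
    (ht : p ≤ (t : ℕ)) (heq : (box P s).1 = (box P t).1) : s = t := by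
  have h1 := h.rank_second s hs
  have h2 := h.rank_second t ht
  rw [heq] at h1
  exact Fin.ext (by omega)

theorem card_first_filter (h : IsStripPath P p q l I J) (Q : Fin P.length → Prop)
    [DecidablePred Q] (R : ℕ → Prop) [DecidablePred R]
    (hQR : ∀ u : Fin P.length, (u : ℕ) < p → (Q u ↔ R (box P u).1)) :
    (Finset.univ.filter fun u : Fin P.length => (u : ℕ) < p ∧ Q u).card = (I.filter R).card := by
  refine Finset.card_bij (fun u _ => (box P u).1) ?_ ?_ ?_
  · intro u hu
    simp only [Finset.mem_filter, Finset.mem_univ, true_and] at hu ⊢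
    exact ⟨(h.first u hu.1).1, (hQR u hu.1).1 hu.2⟩
  · intro s hs t ht heq
    simp only [Finset.mem_filter, Finset.mem_univ, true_and] at hs ht
    exact h.first_inj hs.1 ht.1 heq
  · intro r hr
    rw [Finset.mem_filter] at hr
    obtain ⟨u, hu, rfl⟩ := h.exists_first r hr.1
    exact ⟨u, by simpa [hu] using (hQR u hu).2 hr.2, rfl⟩

theorem card_second_filter (h : IsStripPath P p q l I J) (Q : Fin P.length → Prop)
    [DecidablePred Q] (R : ℕ → Prop) [DecidablePred R]
    (hQR : ∀ u : Fin P.length, p ≤ (u : ℕ) → (Q u ↔ R (box P u).1)) :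
    (Finset.univ.filter fun u : Fin P.length => p ≤ (u : ℕ) ∧ Q u).card = (J.filter R).card := by
  refine Finset.card_bij (fun u _ => (box P u).1) ?_ ?_ ?_
  · intro u hu
    simp only [Finset.mem_filter, Finset.mem_univ, true_and] at hu ⊢
    exact ⟨(h.second u hu.1).1, (hQR u hu.1).1 hu.2⟩
  · intro s hs t ht heq
    simp only [Finset.mem_filter, Finset.mem_univ, true_and] at hs ht
    exact h.second_inj hs.1 ht.1 heq
  · intro r hr
    rw [Finset.mem_filter] at hr
    obtain ⟨u, hu, rfl⟩ := h.exists_second r hr.1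
    exact ⟨u, by simpa [hu] using (hQR u hu).2 hr.2, rfl⟩

/-- Ties are broken by the step number, so the left parenthesis comes first: hence `≤` here and `<`
in `before_second_first`. -/
theorem before_first_second {s t : Fin P.length} (hs : (s : ℕ) < p)
    (ht : p ≤ (t : ℕ)) : Before P s t ↔ label P s ≤ label P t := by
  have : s < t := by rw [Fin.lt_def]; omega
  rw [Before, le_iff_lt_or_eq]
  tauto

theorem before_second_first {s t : Fin P.length} (hs : p ≤ (s : ℕ))
    (ht : (t : ℕ) < p) : Before P s t ↔ label P s < label P t := by
  have : ¬ s < t := by rw [Fin.lt_def]; omega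
  rw [Before]
  tauto

theorem before_same (h : IsStripPath P p q l I J) (hl : Antitone l) (hm : Antitone (addRows l I))
    {s t : Fin P.length} (hst : (s : ℕ) < p ↔ (t : ℕ) < p) :
    Before P s t ↔ label P s < label P t := by
  rw [Before]
  constructor
  · rintro (h1 | ⟨h1, h2⟩)
    · exact h1
    · have := h.label_lt hl hm s t h2 (by omega)
      omega
  · exact Or.inl

/-- The `+ 1` lets in the left parentheses whose label equals that of the right one `t`. -/
theorem leftBetween_second (h : IsStripPath P p q l I J) (hl : Antitone l)
    (hm : Antitone (addRows l I)) {s t : Fin P.length} (hs : (s : ℕ) < p)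
    (ht : p ≤ (t : ℕ)) : leftBetween P p s t =
      leftCount l I (box P s).1 (rowLabel (addRows l I) (box P t).1 + 1) := by
  classical
  rw [leftBetween, leftCount]
  refine h.card_first_filter _ _ fun u hu => ?_
  rw [h.before_same hl hm (by omega), before_first_second hu ht, h.label_first s hs,
    h.label_first u hu, h.label_second t ht, Int.lt_add_one_iff]

theorem leftBetween_first (h : IsStripPath P p q l I J) (hl : Antitone l)
    (hm : Antitone (addRows l I)) {s t : Fin P.length} (hs : (s : ℕ) < p)
    (ht : (t : ℕ) < p) : leftBetween P p s t =
      leftCount l I (box P s).1 (rowLabel l (box P t).1) := by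
  classical
  rw [leftBetween, leftCount]
  refine h.card_first_filter _ _ fun u hu => ?_
  rw [h.before_same hl hm (by omega), h.before_same hl hm (by omega), h.label_first s hs,
    h.label_first u hu, h.label_first t ht]

theorem rightBetween_second (h : IsStripPath P p q l I J) (hl : Antitone l)
    (hm : Antitone (addRows l I)) {s t : Fin P.length} (hs : (s : ℕ) < p)
    (ht : p ≤ (t : ℕ)) : rightBetween P p s t =
      rightCount l I J (box P s).1 (rowLabel (addRows l I) (box P t).1) := by
  classical
  rw [rightBetween, rightCount]
  refine h.card_second_filter _ _ fun u hu => ?_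
  rw [before_first_second hs hu, h.before_same hl hm (by omega), h.label_first s hs,
    h.label_second u hu, h.label_second t ht]

theorem rightBetween_first (h : IsStripPath P p q l I J) {s t : Fin P.length} (hs : (s : ℕ) < p)
    (ht : (t : ℕ) < p) : rightBetween P p s t =
      rightCount l I J (box P s).1 (rowLabel l (box P t).1) := by
  classical
  rw [rightBetween, rightCount]
  refine h.card_second_filter _ _ fun u hu => ?_
  rw [before_first_second hs hu, before_second_first hu ht, h.label_first s hs,
    h.label_second u hu, h.label_first t ht]

theorem paired_iff (h : IsStripPath P p q l I J) (hl : Antitone l) (hm : Antitone (addRows l I))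
    {s t : Fin P.length} (hs : (s : ℕ) < p) (ht : p ≤ (t : ℕ)) :
    Paired P p s t ↔ RowPaired l I J (box P s).1 (box P t).1 := by
  rw [Paired, RowPaired, before_first_second hs ht, h.leftBetween_second hl hm hs ht,
    h.rightBetween_second hl hm hs ht, h.label_first s hs, h.label_second t ht]
  simp only [hs, ht, true_and]
  refine and_congr_right fun _ => and_congr_right fun _ => ⟨fun H => ⟨?_, ?_⟩, fun H u => ?_⟩
  · intro x hx h1 h2
    obtain ⟨u, hu, rfl⟩ := h.exists_first x hx
    have := H u
    rw [h.before_same hl hm (by omega), before_first_second hu ht, h.label_first s hs,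
      h.label_first u hu, h.label_second t ht, h.rightBetween_first hs hu,
      h.leftBetween_first hl hm hs hu] at this
    exact this h1 h2
  · intro x hx h1 h2
    obtain ⟨u, hu, rfl⟩ := h.exists_second x hx
    have := H u
    rw [before_first_second hs hu, h.before_same hl hm (by omega), h.label_first s hs,
      h.label_second u hu, h.label_second t ht, h.rightBetween_second hl hm hs hu,
      h.leftBetween_second hl hm hs hu] at this
    exact this h1 h2
  · rcases Nat.lt_or_ge (u : ℕ) p with hu | hu
    · rw [h.before_same hl hm (by omega), before_first_second hu ht, h.label_first s hs,
        h.label_first u hu, h.label_second t ht, h.rightBetween_first hs hu,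
        h.leftBetween_first hl hm hs hu]
      exact H.1 _ (h.first u hu).1
    · rw [before_first_second hs hu, h.before_same hl hm (by omega), h.label_first s hs,
        h.label_second u hu, h.label_second t ht, h.rightBetween_second hl hm hs hu,
        h.leftBetween_second hl hm hs hu]
      exact H.2 _ (h.second u hu).1

end IsStripPath

/-! ### Exceptional pairs of strips -/

/-- Vertical strips in the rows `I` and `J` lead from `l` to `v`. -/
structure IsStripPair (n : ℕ) (l v : ℕ → ℕ) (I J : Finset ℕ) : Prop where
  start : Antitone l
  mid : Antitone (addRows l I)
  final : Antitone v
  first : I ⊆ Finset.range n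
  second : J ⊆ Finset.range n
  eq : ∀ i, v i = addRows (addRows l I) J i

/-- A row with a box of one of the strips in the last column of `v`. -/
def MeetsLastColumn (l v : ℕ → ℕ) (I J : Finset ℕ) (x : ℕ) : Prop :=
  (x ∈ I ∧ l x + 1 = v 0) ∨ (x ∈ J ∧ addRows l I x + 1 = v 0)

/-- The conditions on an exceptional path in terms of the rows of its two strips. -/
def IsExceptionalPair (n k : ℕ) (l v : ℕ → ℕ) (I J : Finset ℕ) : Prop :=
  v 0 = v (n - 1) + k ∧ Xor (0 ∈ I) (0 ∈ J) ∧ n - 1 ∈ I ∧ n - 1 ∉ J ∧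
    ∃ z y, (z ∈ J ∧ addRows l I z + 1 = v 0 ∧ ∀ x ∈ J, addRows l I x + 1 = v 0 → z ≤ x) ∧
      (MeetsLastColumn l v I J y ∧ ∀ x, MeetsLastColumn l v I J x → x ≤ y) ∧
      (∀ w ∈ I, rowLabel l w = (v 0 : ℤ) - 2 - y → ¬ RowPaired l I J w z) ∧
      ((∀ t ∈ J, ¬ RowPaired l I J (n - 1) t) ∨ RowPaired l I J (n - 1) z)

namespace IsStripPair

variable {n k : ℕ} {l v : ℕ → ℕ} {I J : Finset ℕ}

theorem final_eq (h : IsStripPair n l v I J) (x : ℕ) :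
    v x = l x + (if x ∈ I then 1 else 0) + if x ∈ J then 1 else 0 := h.eq x

theorem height_eq (h : IsStripPair n l v I J) (i : ℕ) :
    height (singles n l v) (I ∩ singles n l v) i = (corank I i : ℤ) - corank J i :=
  height_eq_corank h.first h.second h.eq i

theorem corank_le (h : IsStripPair n l v I J)
    (hb : IsBallot (singles n l v) (I ∩ singles n l v)) (i : ℕ) : corank J i ≤ corank I i := by
  have := hb i
  rw [h.height_eq] at this
  omega

/-! The letter of the bottom row. -/

/-- No letter has a smaller label than the left parenthesis of row `n - 1`, so the lower bound in
`rightCount` is void, and what counts are the rows of `J` below `x`. -/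
theorem rightCount_bottom_second (h : IsStripPair n l v I J) (x : ℕ) :
    rightCount l I J (n - 1) (rowLabel (addRows l I) x) = corank J (x + 1) := by
  rw [rightCount, corank]
  congr 1
  refine Finset.filter_congr fun w hw => ?_
  have hw' := Finset.mem_range.1 (h.second hw)
  have h1 := (rowLabel_strictAnti h.mid).lt_iff_gt (a := w) (b := x)
  have h2 := (rowLabel_strictAnti h.start).le_iff_ge (a := n - 1) (b := w)
  have h3 := rowLabel_addRows l I w
  have h4 : rowLabel l (n - 1) ≤ rowLabel l w := h2.2 (by omega)
  rw [h1]
  split_ifs at h3 <;> constructor <;> intro <;> omega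

theorem rightCount_bottom_first_le (h : IsStripPair n l v I J) (x : ℕ) :
    rightCount l I J (n - 1) (rowLabel l x) ≤ corank J (x + 1) := by
  refine Finset.card_le_card fun w hw => ?_
  rw [Finset.mem_filter] at hw ⊢
  refine ⟨hw.1, ?_⟩
  have h1 := (rowLabel_strictAnti h.start).lt_iff_gt (a := w) (b := x)
  have h3 := rowLabel_addRows l I w
  have : rowLabel l w < rowLabel l x := by split_ifs at h3 <;> omega
  exact h1.1 this

/-- For a row `w` of `J` below `x`, the inequality `v w ≤ v x = l x + 1` keeps the second label of
`w` under the first label of `x`, even if `w` is in both strips. -/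
theorem le_rightCount_bottom_first (h : IsStripPair n l v I J) {x : ℕ} (hxI : x ∈ I)
    (hxJ : x ∉ J) : corank J (x + 1) ≤ rightCount l I J (n - 1) (rowLabel l x) := by
  refine Finset.card_le_card fun w hw => ?_
  rw [Finset.mem_filter] at hw ⊢
  have hw' := Finset.mem_range.1 (h.second hw.1)
  have h2 := (rowLabel_strictAnti h.start).le_iff_ge (a := n - 1) (b := w)
  have h3 := rowLabel_addRows l I w
  have h4 : rowLabel l (n - 1) ≤ rowLabel l w := h2.2 (by omega)
  refine ⟨hw.1, by split_ifs at h3 <;> omega, ?_⟩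
  have h5 := h.final_eq w
  have h6 := h.final_eq x
  have h7 := h.final (show x ≤ w by omega)
  rw [if_pos hw.1] at h5
  rw [if_pos hxI, if_neg hxJ] at h6
  simp only [rowLabel] at h3 ⊢
  split_ifs at h3 h5 <;> omega

/-- The `+ 1` is the bottom letter itself, which `leftCount` leaves out. -/
theorem leftCount_bottom_add_one (h : IsStripPair n l v I J) (hI : n - 1 ∈ I) {x : ℕ}
    (hx : x < n - 1) : leftCount l I (n - 1) (rowLabel l x) + 1 = corank I (x + 1) := by
  have hα := rowLabel_strictAnti h.start
  have : I.filter (x + 1 ≤ ·) = insert (n - 1)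
      (I.filter fun w => rowLabel l (n - 1) < rowLabel l w ∧ rowLabel l w < rowLabel l x) := by
    ext w
    rw [Finset.mem_insert, Finset.mem_filter, Finset.mem_filter, hα.lt_iff_gt, hα.lt_iff_gt]
    constructor
    · rintro ⟨h1, h2⟩
      have := Finset.mem_range.1 (h.first h1)
      rcases eq_or_ne w (n - 1) with h3 | h3
      · exact Or.inl h3
      · exact Or.inr ⟨h1, by omega, by omega⟩
    · rintro (rfl | h1)
      · exact ⟨hI, hx⟩
      · exact ⟨h1.1, h1.2.2⟩
  rw [corank, this, Finset.card_insert_of_notMem (by simp), leftCount]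

theorem leftCount_bottom_second (h : IsStripPair n l v I J) (hI : n - 1 ∈ I) {x : ℕ}
    (hx : x < n - 1) (hxI : x ∉ I) :
    leftCount l I (n - 1) (rowLabel (addRows l I) x + 1) + 1 = corank I (x + 1) := by
  rw [← h.leftCount_bottom_add_one hI hx, rowLabel_addRows, if_neg hxI, add_zero, leftCount,
    leftCount]
  congr 2
  refine Finset.filter_congr fun w hw => ?_
  rw [Int.lt_add_one_iff, le_iff_lt_or_eq, (rowLabel_strictAnti h.start).injective.eq_iff]
  have : w ≠ x := fun e => hxI (e ▸ hw)
  tauto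

theorem corank_le_leftCount_bottom_second (h : IsStripPair n l v I J) (hI : n - 1 ∈ I) {x : ℕ}
    (hx : x < n - 1) :
    corank I x ≤ leftCount l I (n - 1) (rowLabel (addRows l I) x + 1) + 1 := by
  by_cases hxI : x ∈ I
  · have h1 := h.leftCount_bottom_add_one hI hx
    have h2 := corank_eq_succ_add I x
    rw [if_pos hxI] at h2
    have h3 : leftCount l I (n - 1) (rowLabel l x) <
        leftCount l I (n - 1) (rowLabel (addRows l I) x + 1) := by
      rw [rowLabel_addRows, if_pos hxI]
      refine Finset.card_lt_card ?_
      rw [Finset.ssubset_iff_of_subset]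
      · refine ⟨x, ?_, by simp⟩
        rw [Finset.mem_filter]
        exact ⟨hxI, rowLabel_strictAnti h.start hx, by omega⟩
      · intro w hw
        rw [Finset.mem_filter] at hw ⊢
        exact ⟨hw.1, hw.2.1, by omega⟩
    omega
  · rw [h.leftCount_bottom_second hI hx hxI, corank_eq_succ_add, if_neg hxI, add_zero]

/-- The bottom letter is only paired with a row where the height vanishes for the first time. -/
theorem corank_of_rowPaired_bottom (h : IsStripPair n l v I J) (hI : n - 1 ∈ I) {t : ℕ}
    (ht : t < n - 1) (hp : RowPaired l I J (n - 1) t) :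
    (t ∉ I → corank I (t + 1) = corank J (t + 1) + 1) ∧
      (t ∈ I → corank I (t + 1) ≤ corank J (t + 1)) := by
  have h1 := hp.2.1
  rw [h.rightCount_bottom_second] at h1
  refine ⟨fun htI => ?_, fun htI => ?_⟩
  · have := h.leftCount_bottom_second hI ht htI
    omega
  · have h2 := h.corank_le_leftCount_bottom_second hI ht
    have h3 := corank_eq_succ_add I t
    rw [if_pos htI] at h3
    omega

theorem rowPaired_bottom (h : IsStripPair n l v I J) (hI : n - 1 ∈ I) (hJ : n - 1 ∉ J) {i : ℕ}
    (hi : i < n - 1) (hiI : i ∉ I) (h1 : corank I (i + 1) = corank J (i + 1) + 1)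
    (h2 : ∀ j, i < j → j ≤ n - 1 → corank J j + 1 ≤ corank I j) : RowPaired l I J (n - 1) i := by
  have hα := rowLabel_strictAnti h.start
  refine ⟨?_, ?_, fun x hx hx1 hx2 => ?_, fun x hx hx1 hx2 => ?_⟩
  · rw [rowLabel_addRows, if_neg hiI, add_zero]
    exact hα.antitone hi.le
  · rw [h.rightCount_bottom_second]
    have := h.leftCount_bottom_second hI hi hiI
    omega
  · rw [rowLabel_addRows, if_neg hiI, add_zero, hα.le_iff_ge] at hx2
    rw [hα.lt_iff_gt] at hx1
    have h3 := h.rightCount_bottom_first_le x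
    have h4 := h.leftCount_bottom_add_one hI hx1
    have h5 := h2 (x + 1) (by omega) (by omega)
    omega
  · rw [(rowLabel_strictAnti h.mid).lt_iff_gt] at hx2
    have hxn := Finset.mem_range.1 (h.second hx)
    have hne : x ≠ n - 1 := fun e => hJ (e ▸ hx)
    rw [h.rightCount_bottom_second]
    have h3 := h.corank_le_leftCount_bottom_second hI (x := x) (by omega)
    have h4 := h2 (x + 1) (by omega) (by omega)
    have h5 := corank_eq_succ_add I x
    omega

/-- Suppose the height vanishes below `z`, and take the lowest row `i` where it does. Then `i` is a
single right parenthesis and closes the bottom letter, so the bottom letter is not unpaired. If it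
were paired with `z`, the height would be 1 at `z + 1`, and the balance inside the pair would keep
it positive from there down to `i`. -/
theorem one_le_height (h : IsStripPair n l v I J)
    (hb : IsBallot (singles n l v) (I ∩ singles n l v)) (hI : n - 1 ∈ I) (hJ : n - 1 ∉ J) {z : ℕ}
    (hzJ : z ∈ J) (hzI : z ∉ I)
    (hp : (∀ t ∈ J, ¬ RowPaired l I J (n - 1) t) ∨ RowPaired l I J (n - 1) z) :
    ∀ i, z < i → i ≤ n - 1 → corank J i + 1 ≤ corank I i := by
  have hn : n - 1 < n := Finset.mem_range.1 (h.first hI)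
  have hzn := Finset.mem_range.1 (h.second hzJ)
  have hz : z ≠ n - 1 := fun e => hJ (e ▸ hzJ)
  by_contra hc
  push Not at hc
  have hex : ∃ i, i ≤ n - 1 ∧ z < i ∧ corank I i < corank J i + 1 := by
    obtain ⟨i, h1, h2, h3⟩ := hc
    exact ⟨i, h2, h1, h3⟩
  classical
  set i := Nat.findGreatest (fun i => z < i ∧ corank I i < corank J i + 1) (n - 1) with hi
  obtain ⟨i0, hi0, hi0'⟩ := hex
  have hspec : z < i ∧ corank I i < corank J i + 1 :=
    Nat.findGreatest_spec (P := fun i => z < i ∧ corank I i < corank J i + 1) hi0 hi0'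
  have hle : i ≤ n - 1 := Nat.findGreatest_le _
  have hgt : ∀ j, i < j → j ≤ n - 1 → corank J j + 1 ≤ corank I j := by
    intro j h1 h2
    have := Nat.findGreatest_is_greatest h1 h2
    omega
  have hbot : corank I (n - 1) = 1 ∧ corank J (n - 1) = 0 := by
    rw [corank_eq_succ_add, corank_eq_succ_add J, corank_eq_zero h.first (by omega),
      corank_eq_zero h.second (by omega)]
    simp [hI, hJ]
  have hne : i ≠ n - 1 := by
    intro e
    rw [e] at hspec
    omega
  have c1 := h.corank_le hb i
  have c2 := hgt (i + 1) (by omega) (by omega)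
  have c3 := corank_eq_succ_add I i
  have c4 := corank_eq_succ_add J i
  have hiI : i ∉ I := by
    intro hc
    rw [if_pos hc] at c3
    split_ifs at c4 <;> omega
  have hiJ : i ∈ J := by
    by_contra hc
    rw [if_neg hc] at c4
    split_ifs at c3; omega
  rw [if_neg hiI] at c3
  rw [if_pos hiJ] at c4
  have hpi := h.rowPaired_bottom hI hJ (by omega) hiI (by omega) hgt
  rcases hp with hp | hp
  · exact hp i hiJ hpi
  · have hz1 := (h.corank_of_rowPaired_bottom hI (by omega) hp).1 hzI
    -- Going down, a positive height can become zero only past a single left parenthesis `j`; the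
    -- balance condition at that letter excludes this.
    have hstep : ∀ j, z + 1 ≤ j → j ≤ i → corank J j + 1 ≤ corank I j := by
      intro j hj
      induction j, hj using Nat.le_induction with
      | base => intro; omega
      | succ j hj ih =>
        intro hji
        have d0 := ih (by omega)
        by_contra hcon
        have d1 := h.corank_le hb (j + 1)
        have d2 := corank_eq_succ_add I j
        have d3 := corank_eq_succ_add J j
        have hjI : j ∈ I := by
          by_contra hc
          rw [if_neg hc] at d2
          omega
        have hjJ : j ∉ J := by
          intro hc
          rw [if_pos hc] at d3
          split_ifs at d2; omega
        have d4 := hp.2.2.1 j hjI (rowLabel_strictAnti h.start (by omega)) (by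
          rw [rowLabel_addRows, if_neg hzI, add_zero]
          exact (rowLabel_strictAnti h.start).antitone (by omega))
        have d5 := h.le_rightCount_bottom_first hjI hjJ
        have d6 := h.leftCount_bottom_add_one hI (x := j) (by omega)
        omega
    have := hstep i (by omega) le_rfl
    omega

/-! ### Letters of the last column -/

theorem final_eq_of_meetsLastColumn (h : IsStripPair n l v I J) {x : ℕ}
    (hx : MeetsLastColumn l v I J x) : v x = v 0 := by
  have h1 := h.final_eq x
  have h2 := h.final (Nat.zero_le x)
  rcases hx with ⟨h3, h4⟩ | ⟨h3, h4⟩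
  · rw [if_pos h3] at h1
    split_ifs at h1 <;> omega
  · rw [if_pos h3] at h1
    rw [addRows] at h4
    omega

/-- If the rows `z, …, y` of the last column receive boxes from both strips, then the outermost
letters of these rows are paired. -/
theorem rowPaired_of_double (h : IsStripPair n l v I J) (h0 : v 0 = l 0 + 1) {z y : ℕ}
    (hz : z ∈ J) (hzc : addRows l I z + 1 = v 0)
    (hzmin : ∀ x ∈ J, addRows l I x + 1 = v 0 → z ≤ x) (hzI : z ∈ I)
    (hy : MeetsLastColumn l v I J y) (hymax : ∀ x, MeetsLastColumn l v I J x → x ≤ y) :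
    y ∈ I ∧ rowLabel l y = (v 0 : ℤ) - 2 - y ∧ RowPaired l I J y z := by
  have hzy : z ≤ y := hymax z (Or.inr ⟨hz, hzc⟩)
  have hvy := h.final_eq_of_meetsLastColumn hy
  -- Row `z` gets two boxes and ends at `l 0 + 1`, so the rows from `z` to `y` start at length at
  -- most `l 0 - 1` and also need both.
  have hblock : ∀ x, z ≤ x → x ≤ y → x ∈ I ∧ x ∈ J ∧ l x + 1 = l 0 := by
    intro x hx1 hx2
    have e1 := h.final_eq x
    have e2 := h.final hx2
    have e3 := h.start hx1
    rw [addRows, if_pos hzI] at hzc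
    refine ⟨?_, ?_, ?_⟩
    · by_contra hc
      rw [if_neg hc] at e1
      split_ifs at e1 <;> omega
    · by_contra hc
      rw [if_neg hc] at e1
      split_ifs at e1 <;> omega
    · split_ifs at e1 <;> omega
  have habove : ∀ x, x < z → x ∉ J := by
    intro x hx hxJ
    have e1 := h.final_eq x
    have e2 := h.final (show x ≤ y by omega)
    have e3 := h.final (Nat.zero_le x)
    rw [if_pos hxJ] at e1
    have := hzmin x hxJ (by rw [addRows]; omega)
    omega
  have hα : ∀ x, z ≤ x → x ≤ y → rowLabel l x = (l 0 : ℤ) - 1 - x := by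
    intro x hx1 hx2
    have := (hblock x hx1 hx2).2.2
    rw [rowLabel]
    omega
  have hβ : ∀ x, z ≤ x → x ≤ y → rowLabel (addRows l I) x = (l 0 : ℤ) - x := by
    intro x hx1 hx2
    rw [rowLabel_addRows, if_pos (hblock x hx1 hx2).1, hα x hx1 hx2]
    ring
  have hleft : ∀ x ∈ I, rowLabel l y < rowLabel l x → rowLabel l x ≤ (l 0 : ℤ) - z →
      z ≤ x ∧ x < y := by
    intro x hx h1 h2
    rw [(rowLabel_strictAnti h.start).lt_iff_gt] at h1
    refine ⟨?_, h1⟩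
    by_contra hc
    have e1 := h.final_eq x
    have e2 := h.final (show x ≤ y by omega)
    rw [if_neg (habove x (by omega)), if_pos hx] at e1
    rw [rowLabel] at h2
    omega
  have hright : ∀ x ∈ J, rowLabel l y ≤ rowLabel (addRows l I) x → z ≤ x → x ≤ y := by
    intro x hx h1 h2
    by_contra hc
    rw [hα y hzy le_rfl, rowLabel] at h1
    have e1 := h.mid h2
    refine hc (hymax x (Or.inr ⟨hx, ?_⟩))
    omega
  -- Row `x` of the block has left label `l 0 - 1 - x` and right label `l 0 - x`. Writing L and R
  -- for the two letters, the block reads L_y, L_{y-1}, R_y, L_{y-2}, R_{y-1}, …, L_z, R_{z+1}, R_z,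
  -- and its first and last letters match.
  have hR : ∀ (c : ℕ), z ≤ c → c ≤ y → rightCount l I J y ((l 0 : ℤ) - c) ≤ y - c := by
    intro c hc1 hc2
    rw [← Nat.card_Ioc]
    refine Finset.card_le_card fun x hx => ?_
    rw [Finset.mem_filter] at hx
    rw [← hβ c hc1 hc2, (rowLabel_strictAnti h.mid).lt_iff_gt] at hx
    rw [Finset.mem_Ioc]
    exact ⟨hx.2.2, hright x hx.1 hx.2.1 (by omega)⟩
  have hL : ∀ (c : ℕ), z ≤ c → c ≤ y → y - c ≤ leftCount l I y ((l 0 : ℤ) - c + 1) := by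
    intro c hc1 hc2
    rw [← Nat.card_Ico]
    refine Finset.card_le_card fun x hx => ?_
    rw [Finset.mem_Ico] at hx
    rw [Finset.mem_filter, hα x (by omega) (by omega), hα y hzy le_rfl]
    exact ⟨(hblock x (by omega) (by omega)).1, by omega, by omega⟩
  refine ⟨(hblock y hzy le_rfl).1, by rw [hα y hzy le_rfl]; omega, ?_, ?_, ?_, ?_⟩
  · rw [hα y hzy le_rfl, hβ z le_rfl hzy]
    omega
  · rw [hβ z le_rfl hzy]
    refine le_antisymm ?_ ((hR z le_rfl hzy).trans (hL z le_rfl hzy))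
    have h1 : leftCount l I y ((l 0 : ℤ) - z + 1) ≤ y - z := by
      rw [← Nat.card_Ico]
      refine Finset.card_le_card fun x hx => ?_
      rw [Finset.mem_filter] at hx
      rw [Finset.mem_Ico]
      exact hleft x hx.1 hx.2.1 (by omega)
    refine h1.trans ?_
    rw [← Nat.card_Ioc]
    refine Finset.card_le_card fun x hx => ?_
    rw [Finset.mem_Ioc] at hx
    rw [Finset.mem_filter, hβ x (by omega) (by omega), hα y hzy le_rfl]
    exact ⟨(hblock x (by omega) (by omega)).2.1, by omega, by omega⟩
  · intro x hx h1 h2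
    rw [hβ z le_rfl hzy] at h2
    obtain ⟨h3, h4⟩ := hleft x hx h1 h2
    have e1 := hR (x + 1) (by omega) (by omega)
    have e2 : y - (x + 1) ≤ leftCount l I y (rowLabel l x) := by
      rw [Nat.sub_add_eq, ← Nat.card_Ioo]
      refine Finset.card_le_card fun w hw => ?_
      rw [Finset.mem_Ioo] at hw
      rw [Finset.mem_filter, hα w (by omega) (by omega), hα y hzy le_rfl, hα x h3 h4.le]
      exact ⟨(hblock w (by omega) (by omega)).1, by omega, by omega⟩
    have e3 : rowLabel l x = (l 0 : ℤ) - (x + 1 : ℕ) := by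
      rw [hα x h3 h4.le]
      push_cast
      ring
    rw [e3] at e2 ⊢
    omega
  · intro x hx h1 h2
    rw [(rowLabel_strictAnti h.mid).lt_iff_gt] at h2
    have h3 := hright x hx h1 (by omega)
    have e1 := hR x (by omega) h3
    have e2 := hL x (by omega) h3
    rw [hβ x (by omega) h3]
    omega

/-- If the rows `0, …, z` of the last column receive one box each, and the last of these comes from
the second strip, then it is not paired with the letter before those of the last column. -/
theorem not_rowPaired_of_single (h : IsStripPair n l v I J) (h0 : v 0 = l 0 + 1) {z y w : ℕ}
    (hzI : z ∉ I) (hz : z ∈ J) (hl : l z = l 0)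
    (hy : MeetsLastColumn l v I J y) (hymax : ∀ x, MeetsLastColumn l v I J x → x ≤ y)
    (hw : w ∈ I) (hwl : rowLabel l w = (v 0 : ℤ) - 2 - y) : ¬ RowPaired l I J w z := by
  intro hp
  have hα := rowLabel_strictAnti h.start
  have hzy : z ≤ y := hymax z (Or.inr ⟨hz, by rw [addRows, if_neg hzI]; omega⟩)
  have hvy := h.final_eq_of_meetsLastColumn hy
  -- In this case a letter of `I` with label one less than that of row `y` would lie in the last
  -- column below `y`, which is the lowest row there. Otherwise the letter is the left parenthesis
  -- of row `y` itself, in the column before.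
  by_cases hly : l y = l 0
  · have h1 : rowLabel l w < rowLabel l y := by rw [hwl, rowLabel]; omega
    rw [hα.lt_iff_gt] at h1
    have h2 := h.start h1.le
    have h3 := hymax w (Or.inl ⟨hw, by rw [rowLabel] at hwl; omega⟩)
    omega
  have hly1 : l y + 1 = l 0 := by
    have e1 := h.final_eq y
    have e2 := h.start (Nat.zero_le y)
    split_ifs at e1 <;> omega
  have hwy : w = y := hα.injective (by rw [hwl, rowLabel]; omega)
  subst hwy
  -- Let `c` be the last row with `l c = l 0`; then z ≤ c < y, and the rows after `c` up to `y` get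
  -- boxes from both strips.
  have hex : ∃ x, l x ≠ l 0 := ⟨w, hly⟩
  classical
  obtain ⟨m, hm⟩ : ∃ m, m = Nat.find hex := ⟨_, rfl⟩
  have hm1 : l m ≠ l 0 := hm ▸ Nat.find_spec hex
  have hm2 : ∀ x < m, l x = l 0 := fun x hx => by
    have := Nat.find_min hex (m := x) (by omega)
    tauto
  have hmw : m ≤ w := hm ▸ Nat.find_min' hex hly
  have hzm : z < m := by
    by_contra hc
    have e1 := h.start (not_lt.1 hc)
    have e2 := h.start (Nat.zero_le m)
    omega
  obtain ⟨c, rfl⟩ : ∃ c, m = c + 1 := ⟨m - 1, by omega⟩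
  have hlc := hm2 c (by omega)
  have hblock : ∀ x, c < x → x ≤ w → x ∈ I ∧ x ∈ J ∧ l x + 1 = l 0 := by
    intro x hx1 hx2
    have e1 := h.final_eq x
    have e2 := h.final hx2
    have e3 := h.start (show c + 1 ≤ x by omega)
    have e4 := h.start (Nat.zero_le (c + 1))
    refine ⟨?_, ?_, ?_⟩
    · by_contra hc
      rw [if_neg hc] at e1
      split_ifs at e1 <;> omega
    · by_contra hc
      rw [if_neg hc] at e1
      split_ifs at e1 <;> omega
    · split_ifs at e1 <;> omega
  have hαw : rowLabel l w = (l 0 : ℤ) - 1 - w := by rw [rowLabel]; omega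
  have hαc : rowLabel l c = (l 0 : ℤ) - c := by rw [rowLabel]; omega
  have hβz : rowLabel (addRows l I) z = (l 0 : ℤ) - z := by
    rw [rowLabel_addRows, if_neg hzI, rowLabel]; omega
  -- Before the letter of row `c` at least `w - c` right parentheses follow that of `w`, but by `hL`
  -- at most `w - c - 1` left ones. So the letter of `w` is closed before row `c` is reached and
  -- cannot match the letter of `z`.
  have hR : w - c ≤ rightCount l I J w ((l 0 : ℤ) - c) := by
    rw [← Nat.card_Ioc]
    refine Finset.card_le_card fun x hx => ?_
    rw [Finset.mem_Ioc] at hx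
    obtain ⟨b1, b2, b3⟩ := hblock x hx.1 hx.2
    rw [Finset.mem_filter, hαw, rowLabel_addRows, if_pos b1, rowLabel]
    exact ⟨b2, by omega, by omega⟩
  have hL : leftCount l I w (rowLabel l c) ≤ w - c - 1 := by
    rw [← Nat.card_Ioo]
    refine Finset.card_le_card fun x hx => ?_
    rw [Finset.mem_filter, hα.lt_iff_gt, hα.lt_iff_gt] at hx
    rw [Finset.mem_Ioo]
    omega
  by_cases hcI : c ∈ I
  · have := hp.2.2.1 c hcI (hα (by omega)) (by rw [hαc, hβz]; omega)
    rw [hαc] at this hL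
    omega
  · have hcJ : c ∈ J := by
      by_contra hcJ
      have e1 := h.final_eq c
      have e2 := h.final (show c ≤ w by omega)
      rw [if_neg hcI, if_neg hcJ] at e1
      omega
    have hβc : rowLabel (addRows l I) c = (l 0 : ℤ) - c := by
      rw [rowLabel_addRows, if_neg hcI, hαc, add_zero]
    have hL' : leftCount l I w ((l 0 : ℤ) - c + 1) ≤ leftCount l I w (rowLabel l c) := by
      refine Finset.card_le_card fun x hx => ?_
      rw [Finset.mem_filter] at hx ⊢
      refine ⟨hx.1, hx.2.1, ?_⟩
      have e1 : x ≠ c := fun e => hcI (e ▸ hx.1)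
      have e2 : rowLabel l x ≠ rowLabel l c := fun e => e1 (hα.injective e)
      omega
    rcases eq_or_ne c z with hcz | hcz
    · have := hp.2.1
      rw [← hcz, hβc] at this
      omega
    · have := hp.2.2.2 c hcJ (by rw [hβc, hαw]; omega) (by rw [hβc, hβz]; omega)
      rw [hβc] at this
      omega

/-- An edge diagram with one box in row 0 and one in row `n - 1` is the cyclic case. The letter with
label a₁ - 1 is paired with `a` when the row `z` of `a` has two boxes and not when it has one, so
that condition means `z ∉ I`. Then rows 0 to `z` have one box each, all in the last column, and
those above `z` come from the first strip. The condition on the bottom letter amounts to positive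
heights below `z`. -/
theorem isExceptionalPair_iff (h : IsStripPair n l v I J) (hn : 2 ≤ n)
    (hb : IsBallot (singles n l v) (I ∩ singles n l v)) :
    IsExceptionalPair n k l v I J ↔ IsCyclic n k l v ∧
      IsExceptionalWord (singles n l v) (rowLink n l v) (n - 1) (I ∩ singles n l v) := by
  have hxor := mem_singles_iff_xor h.first h.second h.eq
  constructor
  · rintro ⟨hk, hx0, hbI, hbJ, z, y, ⟨hzJ, hzc, hzmin⟩, ⟨hy, hymax⟩, hthree, hfour⟩
    have h0S : 0 ∈ singles n l v := (hxor 0).2 (by rw [Xor] at hx0; tauto)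
    have hbS : n - 1 ∈ singles n l v := (hxor _).2 (Or.inl ⟨hbI, hbJ⟩)
    have h0 := (mem_singles.1 h0S).2
    have hb1 := (mem_singles.1 hbS).2
    refine ⟨⟨h0S, hbS, by omega⟩, ?_⟩
    by_cases hzI : z ∈ I
    · obtain ⟨e1, e2, e3⟩ := h.rowPaired_of_double h0 hzJ hzc hzmin hzI hy hymax
      exact absurd e3 (hthree y e1 e2)
    have hlz : l z = l 0 := by
      rw [addRows, if_neg hzI] at hzc
      omega
    have hzn := Finset.mem_range.1 (h.second hzJ)
    have hle : ∀ j ≤ z, l j = l 0 ∧ j ∈ singles n l v := by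
      intro j hj
      have e1 := h.start hj
      have e2 := h.start (Nat.zero_le j)
      have e3 := h.final hj
      have e4 := h.final (Nat.zero_le j)
      have e5 := h.final_eq z
      rw [if_neg hzI, if_pos hzJ] at e5
      exact ⟨by omega, mem_singles.2 ⟨by omega, by omega⟩⟩
    refine ⟨z, (hle z le_rfl).2, by simp [hzI], fun j hj => ?_, fun i h1 h2 => ?_⟩
    · have e1 := hle j hj.le
      have e2 := hle (j + 1) hj
      refine ⟨⟨e1.2, e2.2, by omega⟩, Finset.mem_inter.2 ⟨?_, e1.2⟩⟩
      by_contra hjI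
      have hjJ : j ∈ J := by
        have := (hxor j).1 e1.2
        tauto
      have := hzmin j hjJ (by rw [addRows, if_neg hjI]; omega)
      omega
    · have := h.one_le_height hb hbI hbJ hzJ hzI hfour i h1 h2
      rw [h.height_eq]
      omega
  · rintro ⟨⟨h0S, hbS, hk⟩, z, hzS, hzA, hlink, hheight⟩
    have h0 := (mem_singles.1 h0S).2
    have hb1 := (mem_singles.1 hbS).2
    have hzI : z ∉ I := fun hc => hzA (Finset.mem_inter.2 ⟨hc, hzS⟩)
    have hzJ : z ∈ J := by
      have := (hxor z).1 hzS
      tauto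
    have hbI : n - 1 ∈ I := by
      by_contra hc
      have e1 := h.corank_le hb (n - 1)
      have hJ' : n - 1 ∈ J := by
        have := (hxor (n - 1)).1 hbS
        tauto
      rw [corank_eq_succ_add, corank_eq_succ_add I, corank_eq_zero h.first (by omega),
        corank_eq_zero h.second (by omega), if_neg hc, if_pos hJ'] at e1
      omega
    have hbJ : n - 1 ∉ J := by
      have := (hxor (n - 1)).1 hbS
      tauto
    have hll : ∀ j ≤ z, l j = l 0 := by
      intro j
      induction j with
      | zero => simp
      | succ j ih =>
        intro hj
        have := (hlink j hj).1.2.2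
        have := ih (by omega)
        omega
    have hlz := hll z le_rfl
    have hsmall : ∀ x < z, x ∉ J := by
      intro x hx hxJ
      have e1 := Finset.mem_inter.1 (hlink x hx).2
      have := (hxor x).1 e1.2
      tauto
    have hzc : addRows l I z + 1 = v 0 := by rw [addRows, if_neg hzI]; omega
    obtain ⟨y, hy, hymax⟩ : ∃ y, MeetsLastColumn l v I J y ∧
        ∀ x, MeetsLastColumn l v I J x → x ≤ y := by
      classical
      have hlt : ∀ x, MeetsLastColumn l v I J x → x ≤ n := by
        rintro x (⟨hx, -⟩ | ⟨hx, -⟩)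
        · exact (Finset.mem_range.1 (h.first hx)).le
        · exact (Finset.mem_range.1 (h.second hx)).le
      have hz : MeetsLastColumn l v I J z := Or.inr ⟨hzJ, hzc⟩
      exact ⟨Nat.findGreatest (MeetsLastColumn l v I J) n, Nat.findGreatest_spec (hlt z hz) hz,
        fun x hx => Nat.le_findGreatest (hlt x hx) hx⟩
    refine ⟨by omega, ?_, hbI, hbJ, z, y, ⟨hzJ, hzc, fun x hx _ => ?_⟩, ⟨hy, hymax⟩,
      fun w hw hwl => h.not_rowPaired_of_single h0 hzI hzJ hlz hy hymax hw hwl, ?_⟩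
    · have := (hxor 0).1 h0S
      rw [Xor]
      tauto
    · by_contra hc
      exact hsmall x (by omega) hx
    · by_cases hp : RowPaired l I J (n - 1) z
      · exact Or.inr hp
      refine Or.inl fun t ht hpt => ?_
      have htn := Finset.mem_range.1 (h.second ht)
      have htb : t ≠ n - 1 := fun e => hbJ (e ▸ ht)
      have htz : t ≠ z := fun e => hp (e ▸ hpt)
      have hzt : z < t := by
        by_contra hc
        exact hsmall t (by omega) ht
      obtain ⟨e1, e2⟩ := h.corank_of_rowPaired_bottom hbI (by omega) hpt
      have e3 := hheight t hzt (by omega)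
      have e4 := hheight (t + 1) (by omega) (by omega)
      rw [h.height_eq] at e3 e4
      by_cases htI : t ∈ I
      · have := e2 htI
        omega
      · have := e1 htI
        rw [corank_eq_succ_add, corank_eq_succ_add J, if_neg htI, if_pos ht] at e3
        push_cast at e3
        omega

end IsStripPair

/-! ### The path model -/

namespace IsStripPath

variable {P : LatticePath} {p q n k : ℕ} {l v : ℕ → ℕ} {I J : Finset ℕ}

theorem firstMeetsRow_iff (h : IsStripPath P p q l I J) (i : ℕ) : FirstMeetsRow P p i ↔ i ∈ I :=
  ⟨fun ⟨t, h1, h2⟩ => h2 ▸ (h.first t h1).1, h.exists_first i⟩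

theorem secondMeetsRow_iff (h : IsStripPath P p q l I J) (i : ℕ) :
    SecondMeetsRow P p i ↔ i ∈ J :=
  ⟨fun ⟨t, h1, h2⟩ => h2 ▸ (h.second t h1).1, h.exists_second i⟩

theorem inLastColumn_first (h : IsStripPath P p q l I J) (hv : P.last.rowLen 0 = v 0)
    {t : Fin P.length} (ht : (t : ℕ) < p) : InLastColumn P t ↔ l (box P t).1 + 1 = v 0 := by
  rw [InLastColumn, hv, (h.first t ht).2]

theorem inLastColumn_second (h : IsStripPath P p q l I J) (hv : P.last.rowLen 0 = v 0)
    {t : Fin P.length} (ht : p ≤ (t : ℕ)) :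
    InLastColumn P t ↔ addRows l I (box P t).1 + 1 = v 0 := by
  rw [InLastColumn, hv, (h.second t ht).2]

theorem meetsLastColumn_iff (h : IsStripPath P p q l I J) (hv : P.last.rowLen 0 = v 0) (x : ℕ) :
    MeetsLastColumn l v I J x ↔ ∃ t, InLastColumn P t ∧ (box P t).1 = x := by
  constructor
  · rintro (⟨h1, h2⟩ | ⟨h1, h2⟩)
    · obtain ⟨t, ht, rfl⟩ := h.exists_first x h1
      exact ⟨t, (h.inLastColumn_first hv ht).2 h2, rfl⟩
    · obtain ⟨t, ht, rfl⟩ := h.exists_second x h1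
      exact ⟨t, (h.inLastColumn_second hv ht).2 h2, rfl⟩
  · rintro ⟨t, h1, rfl⟩
    rcases Nat.lt_or_ge (t : ℕ) p with ht | ht
    · exact Or.inl ⟨(h.first t ht).1, (h.inLastColumn_first hv ht).1 h1⟩
    · exact Or.inr ⟨(h.second t ht).1, (h.inLastColumn_second hv ht).1 h1⟩

/-- Within one column, smaller labels are lower rows. -/
theorem isLowestInLastColumn_iff (h : IsStripPath P p q l I J) (hv : P.last.rowLen 0 = v 0)
    {a : Fin P.length} (ha : InLastColumn P a) : IsLowestInLastColumn P a ↔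
      ∀ x, MeetsLastColumn l v I J x → x ≤ (box P a).1 := by
  simp only [IsLowestInLastColumn, ha, true_and, h.meetsLastColumn_iff hv]
  rw [InLastColumn] at ha
  constructor
  · rintro H _ ⟨t, ht, rfl⟩
    have := H t ht
    rw [InLastColumn] at ht
    simp only [label] at this
    omega
  · intro H t ht
    have := H _ ⟨t, ht, rfl⟩
    rw [InLastColumn] at ht
    simp only [label]
    omega

theorem isLastRight_iff (h : IsStripPath P p q l I J) (hl : Antitone l)
    (hm : Antitone (addRows l I)) (hv : P.last.rowLen 0 = v 0) {a : Fin P.length}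
    (ha : p ≤ (a : ℕ)) : IsLastRight P p a ↔ addRows l I (box P a).1 + 1 = v 0 ∧
      ∀ x ∈ J, addRows l I x + 1 = v 0 → (box P a).1 ≤ x := by
  simp only [IsLastRight, ha, true_and, h.inLastColumn_second hv ha]
  refine and_congr_right fun _ => ⟨fun H x hx hxc => ?_, fun H t h1 h2 h3 => ?_⟩
  · obtain ⟨t, ht, rfl⟩ := h.exists_second x hx
    rcases eq_or_ne t a with rfl | hne
    · exact le_rfl
    · have := H t ((h.inLastColumn_second hv ht).2 hxc) ht hne
      rw [h.before_same hl hm (by omega), h.label_second t ht, h.label_second a ha,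
        (rowLabel_strictAnti hm).lt_iff_gt] at this
      exact le_of_lt this
  · rw [h.before_same hl hm (by omega), h.label_second t h2, h.label_second a ha,
      (rowLabel_strictAnti hm).lt_iff_gt]
    have h4 := H _ (h.second t h2).1 ((h.inLastColumn_second hv h2).1 h1)
    exact lt_of_le_of_ne h4 fun e => h3 (h.second_inj h2 ha e.symm)

theorem mem_exceptional_iff {mu : YoungDiagram}
    (h : IsStripPath P (mu.colLen 0) (mu.colLen 1) l I J) (hs : IsStripPair n l v I J)
    (hv : ∀ r, P.last.rowLen r = v r) (hlast : P.last.colLen 0 ≤ n) :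
    P ∈ exceptional n k mu ↔ Fits mu P ∧ IsExceptionalPair n k l v I J := by
  have hlabel : ∀ a, InLastColumn P a → label P a = (v 0 : ℤ) - 1 - (box P a).1 := by
    intro a ha
    rw [InLastColumn, hv] at ha
    rw [label]
    omega
  simp only [exceptional, edge, Set.mem_ofPred_eq, hlast, true_and, hv, h.firstMeetsRow_iff,
    h.secondMeetsRow_iff, IsExceptionalPair]
  -- As the second strip avoids row `n - 1`, any letter in that row is a left parenthesis, and
  -- pairing can be expressed by rows.
  have key : n - 1 ∉ J → ((∃ a a₁ : Fin P.length,
      IsLastRight P (mu.colLen 0) a ∧ IsLowestInLastColumn P a₁ ∧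
      (∀ s : Fin P.length, label P s = label P a₁ - 1 → ¬ Paired P (mu.colLen 0) s a) ∧
      ∀ s : Fin P.length, (box P s).1 = n - 1 →
        (∀ t : Fin P.length, ¬ Paired P (mu.colLen 0) s t) ∨ Paired P (mu.colLen 0) s a) ↔
    ∃ z y, (z ∈ J ∧ addRows l I z + 1 = v 0 ∧ ∀ x ∈ J, addRows l I x + 1 = v 0 → z ≤ x) ∧
      (MeetsLastColumn l v I J y ∧ ∀ x, MeetsLastColumn l v I J x → x ≤ y) ∧
      (∀ w ∈ I, rowLabel l w = (v 0 : ℤ) - 2 - y → ¬ RowPaired l I J w z) ∧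
      (n - 1 ∈ I → (∀ t ∈ J, ¬ RowPaired l I J (n - 1) t) ∨ RowPaired l I J (n - 1) z)) := by
    intro hJ
    constructor
    · rintro ⟨a, a₁, ha, ha₁, h3, h4⟩
      have hap := ha.2.1
      have ha' := (h.isLastRight_iff hs.start hs.mid (hv 0) hap).1 ha
      refine ⟨(box P a).1, (box P a₁).1, ⟨(h.second a hap).1, ha'⟩,
        ⟨(h.meetsLastColumn_iff (hv 0) _).2 ⟨a₁, ha₁.1, rfl⟩,
          (h.isLowestInLastColumn_iff (hv 0) ha₁.1).1 ha₁⟩, fun w hw hwl => ?_, fun hI => ?_⟩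
      · obtain ⟨s, hsp, rfl⟩ := h.exists_first w hw
        have := h3 s (by rw [h.label_first s hsp, hwl, hlabel a₁ ha₁.1]; ring)
        rwa [h.paired_iff hs.start hs.mid hsp hap] at this
      · obtain ⟨s, hsp, hsn⟩ := h.exists_first _ hI
        rcases h4 s hsn with h5 | h5
        · left
          intro t ht
          obtain ⟨t, htp, rfl⟩ := h.exists_second t ht
          have := h5 t
          rwa [h.paired_iff hs.start hs.mid hsp htp, hsn] at this
        · right
          rwa [h.paired_iff hs.start hs.mid hsp hap, hsn] at h5
    · rintro ⟨z, y, ⟨hz, hz'⟩, ⟨hy, hy'⟩, h3, h4⟩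
      obtain ⟨a, hap, rfl⟩ := h.exists_second z hz
      obtain ⟨a₁, ha₁, rfl⟩ := (h.meetsLastColumn_iff (hv 0) y).1 hy
      refine ⟨a, a₁, (h.isLastRight_iff hs.start hs.mid (hv 0) hap).2 hz',
        (h.isLowestInLastColumn_iff (hv 0) ha₁).2 hy', fun s hsl hp => ?_, fun s hsn => ?_⟩
      · have hsp := hp.1
        rw [h.paired_iff hs.start hs.mid hsp hap] at hp
        rw [h.label_first s hsp, hlabel a₁ ha₁] at hsl
        exact h3 _ (h.first s hsp).1 (by rw [hsl]; ring) hp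
      · have hsp : (s : ℕ) < mu.colLen 0 := by
          by_contra hc
          exact hJ (hsn ▸ (h.second s (not_lt.1 hc)).1)
        rcases h4 (hsn ▸ (h.first s hsp).1) with h5 | h5
        · left
          intro t ht
          have htp := ht.2.1
          rw [h.paired_iff hs.start hs.mid hsp htp, hsn] at ht
          exact h5 _ (h.second t htp).1 ht
        · right
          rwa [h.paired_iff hs.start hs.mid hsp hap, hsn]
  constructor
  · rintro ⟨e1, e2, e3, e4, e5, e6⟩
    obtain ⟨z, y, f1, f2, f3, f4⟩ := (key e5).1 e6
    exact ⟨e2, e1, e3, e4, e5, z, y, f1, f2, f3, f4 e4⟩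
  · rintro ⟨e2, e1, e3, e4, e5, z, y, f1, f2, f3, f4⟩
    exact ⟨e1, e2, e3, e4, e5, (key e5).2 ⟨z, y, f1, f2, f3, fun _ => f4⟩⟩

end IsStripPath

theorem isStripPath_of_mem_restrictedPaths {n k p q : ℕ} {P : LatticePath}
    (hP : P ∈ restrictedPaths n k p q) :
    IsStripPath P p q P.head.rowLen (firstRows P p) (secondRows P p) ∧
      IsStripPair n P.head.rowLen P.last.rowLen (firstRows P p) (secondRows P p) ∧
      firstRows P p ∈ midStrips n k p P.head.rowLen P.last.rowLen := by
  obtain ⟨hlen, hdec, hres⟩ := hP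
  have h := isStripPath_of_decreasing hlen hdec
  have hmid : IsRestricted n k (addRows P.head.rowLen (firstRows P p)) := by
    have h1 := mem_restricted_iff.1 (hres ⟨p, by omega⟩ (Or.inr (Or.inl rfl)))
    rwa [show (P.toFun ⟨p, by omega⟩).rowLen = addRows P.head.rowLen (firstRows P p) from
      funext (h.mid ⟨p, by omega⟩ rfl)] at h1
  have hlast : IsRestricted n k P.last.rowLen :=
    mem_restricted_iff.1 (hres (Fin.last _) (Or.inr (Or.inr (by simp [hlen]))))
  have hI : firstRows P p ⊆ Finset.range n := by
    intro x hx
    by_contra hc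
    have := hmid.eq_zero x (by simpa using hc)
    rw [addRows, if_pos hx] at this
    omega
  have hJ : secondRows P p ⊆ Finset.range n := by
    intro x hx
    by_contra hc
    have := hlast.eq_zero x (by simpa using hc)
    rw [h.last, addRows, if_pos hx] at this
    omega
  refine ⟨h, ⟨fun i j hij => P.head.rowLen_anti i j hij, hmid.antitone, hlast.antitone, hI, hJ,
    h.last⟩, mem_midStrips.2 ⟨⟨hI, h.card_first⟩, hmid, fun i => ?_⟩⟩
  rw [h.last]
  simp only [addRows]
  split_ifs <;> omega

theorem mem_kFusion_iff {n k : ℕ} (hn : 2 ≤ n) {mu : YoungDiagram} (hmu : mu.rowLen 0 ≤ 2)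
    {P : LatticePath} (hP : P ∈ restrictedPaths n k (mu.colLen 0) (mu.colLen 1)) :
    P ∈ kFusion n k mu ↔
      IsFusionStrip n k P.head.rowLen P.last.rowLen (firstRows P (mu.colLen 0)) := by
  obtain ⟨h, hs, -⟩ := isStripPath_of_mem_restrictedPaths hP
  have hlast : P.last.colLen 0 ≤ n :=
    (hP.2.2 (Fin.last _) (Or.inr (Or.inr (by simp [hP.1])))).1
  have h1 := h.fits_iff_isBallot hmu hs.start hs.mid hs.first hs.second hs.eq
  have h2 := h.mem_exceptional_iff (k := k) hs (fun _ => rfl) hlast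
  rw [kFusion, Set.mem_sdiff, h2, Set.mem_ofPred_eq, IsFusionStrip, ← h1]
  refine and_congr_right fun hf => ?_
  rw [hs.isExceptionalPair_iff hn (h1.1 hf)]
  simp [hf]

theorem firstRows_injOn {n k p q : ℕ} {P P' : LatticePath} (hP : P ∈ restrictedPaths n k p q)
    (hP' : P' ∈ restrictedPaths n k p q) (hhead : P.head = P'.head) (hlast : P.last = P'.last)
    (heq : firstRows P p = firstRows P' p) : P = P' := by
  obtain ⟨h, -, -⟩ := isStripPath_of_mem_restrictedPaths hP
  obtain ⟨h', -, -⟩ := isStripPath_of_mem_restrictedPaths hP'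
  have hJ : secondRows P p = secondRows P' p := by
    ext x
    have h1 := h.last x
    have h2 := h'.last x
    rw [hlast, h2, ← heq, ← hhead] at h1
    simp only [addRows] at h1
    by_cases h3 : x ∈ secondRows P p <;> by_cases h4 : x ∈ secondRows P' p <;> simp_all
  rw [← heq, ← hJ, ← hhead] at h'
  exact h.eq_of_head_eq h' hhead

/-- This excludes paths when the sizes do not add up, the case in which the coefficient is zero by
definition. -/
theorem card_last_eq {n k p q : ℕ} {P : LatticePath} (hP : P ∈ restrictedPaths n k p q) :
    P.last.card = P.head.card + (p + q) := by
  obtain ⟨h, hs, -⟩ := isStripPath_of_mem_restrictedPaths hP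
  have h0 : P.head.colLen 0 ≤ n := (hP.2.2 0 (Or.inl rfl)).1
  have hl : P.last.colLen 0 ≤ n := (hP.2.2 (Fin.last _) (Or.inr (Or.inr (by simp [hP.1])))).1
  rw [card_eq_sum_rowLen h0, card_eq_sum_rowLen hl, Finset.sum_congr rfl fun i _ => h.last i,
    sum_addRows hs.second, sum_addRows hs.first, h.card_first, h.card_second, add_assoc]

theorem fusionCoeff_schurBasis {n k : ℕ} (hn : 2 ≤ n) (hk : 1 ≤ k) {lam mu : YoungDiagram}
    (hlam : lam ∈ restricted n k) (nu : restricted n k) (hmu : mu.colLen 0 ≤ n)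
    (hmu2 : mu.rowLen 0 ≤ 2) :
    fusionCoeff (schurBasis k hn) lam mu nu = (Set.ncard {P : LatticePath |
      P.head = lam ∧ P.last = nu.1 ∧ P ∈ restrictedPaths n k (mu.colLen 0) (mu.colLen 1) ∧
      Fits mu P ∧ P ∈ kFusion n k mu} : ℚ) := by
  classical
  by_cases hcard : nu.1.card = lam.card + mu.card
  · rw [fusionCoeff_eq_card hn hk hlam nu hmu hmu2 hcard, Nat.cast_inj, ← Set.ncard_coe_finset]
    symm
    refine Set.ncard_congr (fun P _ => firstRows P (mu.colLen 0)) ?_ ?_ ?_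
    · rintro P ⟨h1, h2, h3, -, h4⟩
      rw [Finset.coe_filter]
      have e1 := (isStripPath_of_mem_restrictedPaths h3).2.2
      have e2 := (mem_kFusion_iff hn hmu2 h3).1 h4
      rw [h1, h2] at e1 e2
      exact ⟨e1, e2⟩
    · rintro P P' ⟨h1, h2, h3, -⟩ ⟨h1', h2', h3', -⟩ heq
      exact firstRows_injOn h3 h3' (h1.trans h1'.symm) (h2.trans h2'.symm) heq
    · intro I hI
      rw [Finset.coe_filter] at hI
      have hsum : ∑ i ∈ Finset.range n, nu.1.rowLen i =
          ∑ i ∈ Finset.range n, lam.rowLen i + (mu.colLen 0 + mu.colLen 1) := by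
        rw [← card_eq_sum_rowLen nu.2.1, ← card_eq_sum_rowLen hlam.1, ← card_eq_colLen_add hmu2,
          hcard]
      obtain ⟨P, hP, h1, h2, h3⟩ := exists_restrictedPath hlam nu.2 hI.1 hsum
      have h4 : P ∈ kFusion n k mu := by
        rw [mem_kFusion_iff hn hmu2 hP, h1, h2, h3]
        exact hI.2
      exact ⟨P, ⟨h1, h2, hP, h4.1, h4⟩, h3⟩
  · rw [fusionCoeff, if_neg hcard]
    have : {P : LatticePath | P.head = lam ∧ P.last = nu.1 ∧
        P ∈ restrictedPaths n k (mu.colLen 0) (mu.colLen 1) ∧ Fits mu P ∧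
        P ∈ kFusion n k mu} = ∅ := by
      rw [Set.eq_empty_iff_forall_notMem]
      rintro P ⟨h1, h2, h3, -⟩
      have := card_last_eq h3
      rw [h1, h2, ← card_eq_colLen_add hmu2] at this
      exact hcard this
    rw [this, Set.ncard_empty, Nat.cast_zero]

end Fusion

/-- The existential statement also asserts that the classes form a basis; a basis is determined by
its vectors, so no choice is involved. -/
theorem theorem12 (n k : ℕ) (hn : 2 ≤ n) (hk : 1 ≤ k) :
    ∃ b : Module.Basis (Fusion.reduced n k) ℚ (Fusion.FusionAlgebra n k),
      (∀ κ : Fusion.reduced n k, b κ = Fusion.schurClass n k κ) ∧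
      ∀ (lam mu nu : YoungDiagram) (_ : lam ∈ Fusion.restricted n k)
        (hnu : nu ∈ Fusion.restricted n k),
        mu.colLen 0 ≤ n → mu.rowLen 0 ≤ 2 →
        Fusion.fusionCoeff b lam mu ⟨nu, hnu⟩ =
          (Set.ncard {P : Fusion.LatticePath |
            P.head = lam ∧ P.last = nu ∧
            P ∈ Fusion.restrictedPaths n k (mu.colLen 0) (mu.colLen 1) ∧
            Fusion.Fits mu P ∧ P ∈ Fusion.kFusion n k mu} : ℚ) :=
  ⟨Fusion.schurBasis k hn, Fusion.schurBasis_apply hn, fun _ _ nu hlam hnu hmu hmu2 =>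
    Fusion.fusionCoeff_schurBasis hn hk hlam ⟨nu, hnu⟩ hmu hmu2⟩
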